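/- Let $q\in\mathbb{C}$ with $0<|q|<1$. Write $(x;q)_n=\prod_{k=0}^{n-1}(1-xq^k)$, $(x;q)_\infty=\prod_{k\ge 0}(1-xq^k)$, $j(x;q)=(x;q)_\infty(q/x;q)_\infty(q;q)_\infty$, $j(x_1,x_2;q)=j(x_1;q)j(x_2;q)$, $J_{a,m}=j(q^a;q^m)$, $J_m=(q^m;q^m)_\infty$. Let $\mathrm{sg}(r)=1$ for $r\ge 0$ and $\mathrm{sg}(r)=-1$ for $r<0$, and define $$m(x,q,z)=\frac{1}{j(z;q)}\sum_{r\in\mathbb{Z}}\frac{(-1)^rq^{\binom r2}z^r}{1-q^{r-1}xz},\qquad f_{a,b,c}(x,y,q)=\sum_{\mathrm{sg}(r)=\mathrm{sg}(s)}\mathrm{sg}(r)(-1)^{r+s}x^ry^sq^{a\binom r2+brs+c\binom s2},$$ where $x,y,z\ne 0$ and, for $m(x,q,z)$, neither $z$ nor $xz$ is an integral power of $q$. For an odd positive integer $n$ let $$\Theta_{n,2}(x,y,q)=\frac{y^{(n+1)/2}J_{2n,4n}J_{4(n+1),8(n+1)}\,j(y/x,q^{n+2}xy;q^{4(n+1)})\,j(q^{2n}/x^2y^2;q^{8(n+1)})}{q^{(n^2-3)/2}x^{(n-3)/2}\,j(y^n/x^n;q^{4n(n+1)})\,j(-q^{n+2}x^2,-q^{n+2}y^2;q^{4(n+1)})}.$$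 Let $\psi^{(3)}(q)=\sum_{n\ge1}\frac{q^{n^2}}{(q;q^2)_n}$ be the third order mock theta function. Then all the series occurring below converge absolutely, and the following hold. (1) Representations of $\psi^{(3)}$: \begin{align*} \psi^{(3)}(q)&=-\frac{1}{(q;q)_\infty}\sum_{n=1}^\infty(-1)^n(1-q^{2n})q^{2n^2-n}\sum_{j=0}^{n-1}q^{-j(j+1)/2}\\ &=\frac{1}{2J_1}\left(qf_{3,5,3}(q^4,q^5,q)-f_{3,5,3}(1,q,q)\right)\\ &=-\frac{1}{J_1}f_{3,5,3}(1,q,q)\\ &=-m(-q^{22},q^{48},q^3)-q^{-1}m(-q^{14},q^{48},q^{-3})-q^{-2}m(-q^{10},q^{48},q^{-3})-q^{-5}m(-q^2,q^{48},q^3)+\frac{1}{J_1}\Theta_{3,2}(1,q,q)\\ &=-m(q,-q^3,-q)+q\frac{J_{12}^3}{J_{4,12}J_{3,12}}. \end{align*} (2) Companion identity: \begin{align*} \sum_{n=0}^{\infty}\frac{q^{(n^2+n)/2}(-1;q)_n}{(q;q^2)_n} &=\frac{(-q;q)_\infty}{(q;q)_\infty}\Big(1+2\sum_{n=1}^{\infty}(-1)^nq^{(3n^2-n)/2}\Big(q^{-n(n+1)/2}-(1-q^n)\sum_{j=0}^nq^{-j(j+1)/2}\Big)\Big)\\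 &=1-2\frac{J_2}{J_1^2}f_{1,2,1}(q,1,q^2)\\ &=1-2m(q^2,q^6,q). \end{align*} (3) The first representation in (1) agrees with the representations of Andrews and of Mortenson: \begin{align*} -\frac{1}{(q;q)_\infty}\sum_{n=1}^\infty(-1)^n(1-q^{2n})q^{2n^2-n}\sum_{j=0}^{n-1}q^{-j(j+1)/2} &=\frac{1}{(q;q)_\infty}\sum_{n=0}^\infty(-1)^nq^{2n^2+n}(1-q^{6n+6})\sum_{j=0}^nq^{-j(j+1)/2}-1\\ &=\frac{1}{2(q;q)_\infty}\sum_{n=0}^\infty(-1)^nq^{2n^2+n}(1+q^{2n+1})\sum_{j=-n}^{n}q^{-j(j+1)/2}-\frac12. \end{align*} -/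

import Mathlib

noncomputable section

namespace MockTheta

/-- The finite `q`-shifted factorial `(x;q)_n = ∏_{k=0}^{n-1} (1 - x q^k)`. -/
def qPoch (x q : ℂ) (n : ℕ) : ℂ := ∏ k ∈ Finset.range n, (1 - x * q ^ k)

/-- The infinite `q`-shifted factorial `(x;q)_∞ = ∏_{k ≥ 0} (1 - x q^k)`, for `|q| < 1`. -/
def qPochInf (x q : ℂ) : ℂ := ∏' k : ℕ, (1 - x * q ^ k)

/-- The product defining `(x;q)_∞` converges unconditionally for `|q| < 1`. -/
theorem multipliable_qPochInf (x : ℂ) {q : ℂ} (hq : ‖q‖ < 1) :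
    Multipliable fun k : ℕ => 1 - x * q ^ k := by
  have hs : Summable fun k : ℕ => ‖-(x * q ^ k)‖ := by
    simpa [norm_mul, norm_pow] using
      (summable_geometric_of_lt_one (norm_nonneg q) hq).mul_left ‖x‖
  simpa [sub_eq_add_neg] using multipliable_one_add_of_summable hs

/-- The theta function `j(x;q) = (x;q)_∞ (q/x;q)_∞ (q;q)_∞`. -/
def theta (x q : ℂ) : ℂ := qPochInf x q * qPochInf (q / x) q * qPochInf q q

/-- `J_{a,m} = j(q^a; q^m)`. -/
def thetaJ (a m : ℤ) (q : ℂ) : ℂ := theta (q ^ a) (q ^ m)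

/-- `J_m = (q^m; q^m)_∞`. -/
def etaJ (m : ℤ) (q : ℂ) : ℂ := qPochInf (q ^ m) (q ^ m)

/-- The sign convention `sg(r) = 1` for `r ≥ 0` and `sg(r) = -1` for `r < 0`. -/
def sg (r : ℤ) : ℤ := if 0 ≤ r then 1 else -1

/-- The `r`-th term of the bilateral series in the Appell-Lerch sum `m(x,q,z)`. -/
def appellTerm (x q z : ℂ) (r : ℤ) : ℂ :=
  (-1) ^ r * q ^ (r * (r - 1) / 2) * z ^ r / (1 - q ^ (r - 1) * x * z)

/-- The Appell-Lerch sum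
`m(x,q,z) = (1 / j(z;q)) ∑_{r ∈ ℤ} (-1)^r q^{r(r-1)/2} z^r / (1 - q^{r-1} x z)`,
where `x, z ≠ 0` and neither `z` nor `x z` is an integral power of `q`. -/
def appellM (x q z : ℂ) : ℂ := (theta z q)⁻¹ * ∑' r : ℤ, appellTerm x q z r

/-- The `(r,s)` term of the Hecke-type double sum `f_{a,b,c}(x,y,q)`. -/
def heckeTerm (a b c : ℤ) (x y q : ℂ) (p : ℤ × ℤ) : ℂ :=
  if sg p.1 = sg p.2 then
    (sg p.1 : ℂ) * (-1) ^ (p.1 + p.2) * x ^ p.1 * y ^ p.2 *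
      q ^ (a * (p.1 * (p.1 - 1) / 2) + b * p.1 * p.2 + c * (p.2 * (p.2 - 1) / 2))
  else 0

/-- `f_{a,b,c}(x,y,q) =
∑_{sg(r) = sg(s)} sg(r) (-1)^{r+s} x^r y^s q^{a r(r-1)/2 + b r s + c s(s-1)/2}`. -/
def heckeF (a b c : ℤ) (x y q : ℂ) : ℂ := ∑' p : ℤ × ℤ, heckeTerm a b c x y q p

/-- The theta quotient `Θ_{n,2}(x,y,q)`, for a positive odd integer `n`. -/
def thetaQuot (n : ℤ) (x y q : ℂ) : ℂ :=
  (y ^ ((n + 1) / 2) * thetaJ (2 * n) (4 * n) q * thetaJ (4 * (n + 1)) (8 * (n + 1)) q *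
      (theta (y / x) (q ^ (4 * (n + 1))) * theta (q ^ (n + 2) * x * y) (q ^ (4 * (n + 1)))) *
      theta (q ^ (2 * n) / (x ^ 2 * y ^ 2)) (q ^ (8 * (n + 1)))) /
    (q ^ ((n ^ 2 - 3) / 2) * x ^ ((n - 3) / 2) *
      theta (y ^ n / x ^ n) (q ^ (4 * n * (n + 1))) *
      (theta (-(q ^ (n + 2) * x ^ 2)) (q ^ (4 * (n + 1))) *
        theta (-(q ^ (n + 2) * y ^ 2)) (q ^ (4 * (n + 1)))))

/-- The `n`-th term (`n ≥ 1`) of the third order mock theta function `ψ^{(3)}(q)`. -/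
def psiTerm (q : ℂ) (n : ℕ) : ℂ := q ^ (n ^ 2) / qPoch q (q ^ 2) n

/-- `ψ^{(3)}(q) = ∑_{n ≥ 1} q^{n^2} / (q;q^2)_n`. -/
def psi (q : ℂ) : ℂ := ∑' n : ℕ, psiTerm q (n + 1)

/-- `(-1)^n (1 - q^{2n}) q^{2n^2-n} ∑_{j=0}^{n-1} q^{-j(j+1)/2}`. -/
def psiHeckeTerm (q : ℂ) (n : ℕ) : ℂ :=
  (-1) ^ n * (1 - q ^ (2 * n)) * q ^ (2 * (n : ℤ) ^ 2 - n) *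
    ∑ j ∈ Finset.range n, q ^ (-((j : ℤ) * (j + 1) / 2))

/-- `(-1)^n q^{2n^2+n} (1 - q^{6n+6}) ∑_{j=0}^{n} q^{-j(j+1)/2}`. -/
def andrewsTerm (q : ℂ) (n : ℕ) : ℂ :=
  (-1) ^ n * q ^ (2 * n ^ 2 + n) * (1 - q ^ (6 * n + 6)) *
    ∑ j ∈ Finset.range (n + 1), q ^ (-((j : ℤ) * (j + 1) / 2))

/-- `(-1)^n q^{2n^2+n} (1 + q^{2n+1}) ∑_{j=-n}^{n} q^{-j(j+1)/2}`. -/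
def mortensonTerm (q : ℂ) (n : ℕ) : ℂ :=
  (-1) ^ n * q ^ (2 * n ^ 2 + n) * (1 + q ^ (2 * n + 1)) *
    ∑ j ∈ Finset.Icc (-(n : ℤ)) n, q ^ (-(j * (j + 1) / 2))

/-- `q^{(n^2+n)/2} (-1;q)_n / (q;q^2)_n`. -/
def companionTerm (q : ℂ) (n : ℕ) : ℂ :=
  q ^ ((n ^ 2 + n) / 2) * qPoch (-1) q n / qPoch q (q ^ 2) n

/-- `(-1)^n q^{(3n^2-n)/2} (q^{-n(n+1)/2} - (1 - q^n) ∑_{j=0}^{n} q^{-j(j+1)/2})`. -/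
def companionHeckeTerm (q : ℂ) (n : ℕ) : ℂ :=
  (-1) ^ n * q ^ ((3 * (n : ℤ) ^ 2 - n) / 2) *
    (q ^ (-((n : ℤ) * (n + 1) / 2)) -
      (1 - q ^ n) * ∑ j ∈ Finset.range (n + 1), q ^ (-((j : ℤ) * (j + 1) / 2)))

end MockTheta

end

open MockTheta

/-!
The identities are of three kinds, with a different reason behind each.

*Hecke-type sums.* The sequence `β_n = 1 / (q;q^2)_n`, `n ≥ 1`, belongs to a Bailey pair whose
`α_r` is a partial theta sum `∑_{j<r} q^{-j(j+1)/2}` times a monomial and `1 - q^{2r}`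
(`sum_baileyAlpha`). The Bailey transform (`hasSum_bailey`) is fed with two conjugate pairs, both
instances of the limiting `q`-Gauss sum `hasSum_gaussTerm`; one gives `ψ` (`hasSum_psiHeckeTerm`)
and the other the companion series (`hasSum_companionAlpha`). On the other side, a double sum
`f_{a,a+2,a}` with suitable arguments, grouped by `r + s`, is a single sum over the same partial
theta sums (`hasSum_heckeF`), with `a = 3` for `ψ` and `a = 2` for the companion series. The
remaining differences between single-sum representations are the theta series of the pentagonal
number theorem and of Gauss's identity (`hasSum_single_sums`, `hasSum_companionHeckeTerm`).

*Appell-Lerch forms of the double sums.* Shifting the summation indices of `f_{a,b,c}(x,y,q)` shows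
that, up to explicit theta functions, it is quasi-periodic in a variable running through the torus
`ℂˣ / Q^ℤ`; a suitable combination of Appell-Lerch sums satisfies the same functional equation.
After multiplication by the theta functions that cancel its poles, the Appell-Lerch side is
holomorphic (`regAppell`), so that the difference of the two sides is a holomorphic section of a
line bundle on a compact torus. It is determined by its zeros and one value
(`eq_of_mul_invariant`, `mul_eq_mul_of_multiplier`). For `f_{1,2,1}(x,1,q)` the bundle has negative
degree and the difference is zero (`heckeF_121_mul_theta`). For `f_{3,5,3}(t,q/t,q)` the difference
`appellDefect` vanishes where `t^2 / q` is a power of `q^16`, hence is a multiple of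
`t^2 j(t^2/q;q^16)` (`appellDefect_proportional`). The multiple is found at `t^2 = -q^{-5}`, where
all terms of the Appell-Lerch side but one vanish (`appellDefect_of_sq`); at `t = 1` it produces the
theta quotient (`appellDefect_one`, `psi_eq_appellM_four`).

*The eta quotient.* Adding consecutive terms of `ψ` gives a series of reciprocals of
`(q;q^4)_{n+1} (q^3;q^4)_{n+1}`. Expanding these in partial fractions (`tsum_partial_fraction`) and
summing over `n` first turns `ψ` into a bilateral Lambert series (`psi_eq_tsum_lambert`). The
factorisation of `1 - u^3` in its denominators splits it into three sums `lerch`. The first is a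
theta quotient, by the partial fraction expansion of `1 / j` (`lerch_self`), and the other two
combine to `-m(q,-q^3,-q)` by `theta_mul_lerch_eq`, again an identity between sections over a torus.
-/


namespace MockTheta
open Filter Topology

/-! ### Triangular exponents -/

/-- The binomial coefficient `n(n-1)/2` of an integer `n`. -/
def tri (n : ℤ) : ℤ := n * (n - 1) / 2

theorem two_mul_tri (n : ℤ) : 2 * tri n = n * (n - 1) :=
  Int.mul_ediv_cancel' (by simpa [mul_comm] using (Int.even_mul_pred_self n).two_dvd)

theorem tri_add (m n : ℤ) : tri (m + n) = tri m + tri n + m * n := by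
  have h1 := two_mul_tri m
  have h2 := two_mul_tri n
  have h3 := two_mul_tri (m + n)
  refine mul_left_cancel₀ (two_ne_zero) (?_ : (2 : ℤ) * _ = 2 * _)
  linear_combination h3 - h1 - h2

@[simp] theorem tri_zero : tri 0 = 0 := by simp [tri]

@[simp] theorem tri_one : tri 1 = 0 := by simp [tri]

theorem tri_add_one (n : ℤ) : tri (n + 1) = tri n + n := by
  rw [tri_add]; simp

theorem tri_one_sub (n : ℤ) : tri (1 - n) = tri n := by
  unfold tri; congr 1; ring

theorem tri_neg (n : ℤ) : tri (-n) = tri n + n := by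
  have := tri_add_one (-n)
  rw [show -n + 1 = 1 - n by ring, tri_one_sub] at this
  omega

theorem tri_nonneg (n : ℤ) : 0 ≤ tri n := by
  have h := two_mul_tri n
  rcases le_or_gt n 0 with h0 | h0 <;> nlinarith

theorem tri_natCast (n : ℕ) : tri n = ((n * (n - 1) / 2 : ℕ) : ℤ) := by
  rcases n with _ | n
  · simp
  · simp [tri]

/-! ### Convergence of theta-like series -/

theorem summable_pow_mul_pow_tri {ρ : ℝ} (A : ℝ) (h0 : 0 < ρ) (h1 : ρ < 1) :
    Summable fun n : ℕ => A ^ n * ρ ^ (tri n) := by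
  rcases eq_or_ne A 0 with rfl | hA
  · refine summable_of_ne_finset_zero (s := {0}) fun n hn => ?_
    simp at hn
    simp [hn]
  refine summable_of_ratio_test_tendsto_lt_one (l := 0) one_pos
    (Eventually.of_forall fun n => by positivity) ?_
  have : (fun n : ℕ => ‖A ^ (n + 1) * ρ ^ tri ((n + 1 : ℕ) : ℤ)‖ / ‖A ^ n * ρ ^ tri n‖)
      = fun n : ℕ => |A| * ρ ^ n := by
    funext n
    push_cast
    rw [tri_add_one, zpow_add₀ h0.ne', pow_succ]
    simp only [norm_mul, norm_pow, norm_zpow, Real.norm_eq_abs, abs_of_pos h0, zpow_natCast]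
    have : 0 < |A| := abs_pos.mpr hA
    field_simp
  rw [this]
  simpa using (tendsto_pow_atTop_nhds_zero_of_lt_one h0.le h1).const_mul |A|

/-- The basic majorant of all theta-like series over `ℤ`. -/
theorem summable_natAbs_mul_tri {ρ : ℝ} (A : ℝ) (h0 : 0 < ρ) (h1 : ρ < 1) :
    Summable fun n : ℤ => A ^ n.natAbs * ρ ^ (tri n) := by
  refine Summable.of_nat_of_neg ?_ ?_
  · simpa using summable_pow_mul_pow_tri A h0 h1
  · refine (summable_pow_mul_pow_tri (A * ρ) h0 h1).congr fun n => ?_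
    rw [tri_neg, zpow_add₀ h0.ne', mul_pow]
    simp
    ring

theorem norm_zpow_le_pow_natAbs {A : ℝ} {x : ℂ} (h : ‖x‖ ≤ A) (h' : ‖x⁻¹‖ ≤ A) (n : ℤ) :
    ‖x ^ n‖ ≤ A ^ n.natAbs := by
  rcases n.natAbs_eq with hn | hn
  · rw [hn]; simp only [zpow_natCast, norm_pow, Int.natAbs_natCast]
    gcongr
  · rw [hn]; simp only [zpow_neg, zpow_natCast, ← inv_pow, norm_pow, Int.natAbs_neg,
      Int.natAbs_natCast]
    gcongr

theorem norm_neg_one_zpow (n : ℤ) : ‖(-1 : ℂ) ^ n‖ = 1 := by simp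

theorem summable_theta_majorant {q : ℂ} (A : ℝ) (hq0 : q ≠ 0) (hq : ‖q‖ < 1) :
    Summable fun n : ℤ => A ^ n.natAbs * ‖q ^ tri n‖ := by
  simpa using summable_natAbs_mul_tri A (norm_pos_iff.mpr hq0) hq

theorem norm_theta_term_le {q x : ℂ} {A : ℝ} (h : ‖x‖ ≤ A) (h' : ‖x⁻¹‖ ≤ A) (n : ℤ) :
    ‖(-1) ^ n * q ^ tri n * x ^ n‖ ≤ A ^ n.natAbs * ‖q ^ tri n‖ := by
  rw [norm_mul, norm_mul, norm_neg_one_zpow, one_mul, mul_comm]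
  gcongr
  exact norm_zpow_le_pow_natAbs h h' n

theorem summable_theta_term {q : ℂ} (x : ℂ) (hq0 : q ≠ 0) (hq : ‖q‖ < 1) :
    Summable fun n : ℤ => ‖(-1) ^ n * q ^ tri n * x ^ n‖ :=
  (summable_theta_majorant (max ‖x‖ ‖x⁻¹‖) hq0 hq).of_nonneg_of_le (fun _ => norm_nonneg _)
    fun n => norm_theta_term_le (le_max_left _ _) (le_max_right _ _) n

/-! ### Infinite products -/

theorem qPochInf_eq (x : ℂ) {q : ℂ} (hq : ‖q‖ < 1) :
    qPochInf x q = (1 - x) * qPochInf (x * q) q := by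
  have := (multipliable_qPochInf (x * q) hq)
  unfold qPochInf
  rw [tprod_eq_zero_mul' (by simpa [pow_succ', mul_assoc] using this)]
  simp [pow_succ', mul_assoc]

theorem qPoch_zero (x q : ℂ) : qPoch x q 0 = 1 := by simp [qPoch]

theorem qPoch_succ (x q : ℂ) (n : ℕ) : qPoch x q (n + 1) = qPoch x q n * (1 - x * q ^ n) := by
  simp [qPoch, Finset.prod_range_succ]

theorem qPoch_succ' (x q : ℂ) (n : ℕ) : qPoch x q (n + 1) = (1 - x) * qPoch (x * q) q n := by
  simp [qPoch, Finset.prod_range_succ', pow_succ', mul_assoc, mul_comm]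

theorem qPoch_add (x q : ℂ) (m n : ℕ) :
    qPoch x q (m + n) = qPoch x q m * qPoch (x * q ^ m) q n := by
  simp [qPoch, Finset.prod_range_add, pow_add, mul_assoc]

theorem qPochInf_eq_qPoch_mul (x : ℂ) {q : ℂ} (hq : ‖q‖ < 1) (n : ℕ) :
    qPochInf x q = qPoch x q n * qPochInf (x * q ^ n) q := by
  induction n with
  | zero => simp [qPoch_zero]
  | succ n ih => rw [ih, qPoch_succ, qPochInf_eq (x * q ^ n) hq, pow_succ]; ring_nf

theorem tendsto_qPoch (x : ℂ) {q : ℂ} (hq : ‖q‖ < 1) :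
    Tendsto (qPoch x q) atTop (𝓝 (qPochInf x q)) :=
  (multipliable_qPochInf x hq).hasProd.tendsto_prod_nat

theorem qPochInf_ne_zero {x q : ℂ} (hq : ‖q‖ < 1) (h : ∀ k : ℕ, 1 - x * q ^ k ≠ 0) :
    qPochInf x q ≠ 0 := by
  have hs : Summable fun k : ℕ => ‖-(x * q ^ k)‖ := by
    simpa [norm_mul, norm_pow] using
      (summable_geometric_of_lt_one (norm_nonneg q) hq).mul_left ‖x‖
  have := tprod_one_add_ne_zero_of_summable (f := fun k : ℕ => -(x * q ^ k))
    (by simpa [← sub_eq_add_neg] using h) hs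
  simpa [qPochInf, ← sub_eq_add_neg] using this

theorem one_sub_ne_zero_of_norm_ne {x : ℂ} (h : ‖x‖ ≠ 1) : 1 - x ≠ 0 := by
  intro h0
  apply h
  rw [← sub_eq_zero.mp h0]; simp

theorem one_sub_mul_pow_ne_zero {x q : ℂ} (hx : ‖x‖ < 1) (hq : ‖q‖ < 1) (k : ℕ) :
    1 - x * q ^ k ≠ 0 := by
  apply one_sub_ne_zero_of_norm_ne
  rw [norm_mul, norm_pow]
  have : ‖q‖ ^ k ≤ 1 := pow_le_one₀ (norm_nonneg _) hq.le
  nlinarith [norm_nonneg x, pow_nonneg (norm_nonneg q) k]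

theorem qPoch_ne_zero {x q : ℂ} (h : ∀ k : ℕ, 1 - x * q ^ k ≠ 0) (n : ℕ) : qPoch x q n ≠ 0 :=
  Finset.prod_ne_zero_iff.mpr fun k _ => h k

theorem qPoch_self_ne_zero {q : ℂ} (hq : ‖q‖ < 1) (n : ℕ) : qPoch q q n ≠ 0 :=
  qPoch_ne_zero (one_sub_mul_pow_ne_zero hq hq) n

theorem qPochInf_self_ne_zero {q : ℂ} (hq : ‖q‖ < 1) : qPochInf q q ≠ 0 :=
  qPochInf_ne_zero hq (one_sub_mul_pow_ne_zero hq hq)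

theorem norm_qPoch_le {x q : ℂ} {A : ℝ} (hq : ‖q‖ < 1) (hx : ‖x‖ ≤ A) (n : ℕ) :
    ‖qPoch x q n‖ ≤ Real.exp (A / (1 - ‖q‖)) := by
  have h1 : ‖qPoch x q n‖ ≤ Real.exp (∑ k ∈ Finset.range n, ‖x‖ * ‖q‖ ^ k) := by
    rw [qPoch, norm_prod, Real.exp_sum]
    refine Finset.prod_le_prod (fun _ _ => norm_nonneg _) fun k _ => ?_
    calc ‖1 - x * q ^ k‖ ≤ 1 + ‖x‖ * ‖q‖ ^ k := by
          simpa using norm_sub_le (1 : ℂ) (x * q ^ k)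
      _ ≤ _ := by rw [add_comm]; exact Real.add_one_le_exp _
  refine h1.trans (Real.exp_le_exp.mpr ?_)
  rw [← Finset.mul_sum, div_eq_mul_inv]
  have h2 := (summable_geometric_of_lt_one (norm_nonneg q) hq).sum_le_tsum (Finset.range n)
    (fun _ _ => by positivity)
  rw [tsum_geometric_of_lt_one (norm_nonneg q) hq] at h2
  have : 0 ≤ (1 - ‖q‖)⁻¹ := inv_nonneg.mpr (by linarith)
  have hs : 0 ≤ ∑ k ∈ Finset.range n, ‖q‖ ^ k := by positivity
  nlinarith [norm_nonneg x]

theorem norm_qPochInf_le {x q : ℂ} {A : ℝ} (hq : ‖q‖ < 1) (hx : ‖x‖ ≤ A) :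
    ‖qPochInf x q‖ ≤ Real.exp (A / (1 - ‖q‖)) :=
  le_of_tendsto (tendsto_qPoch x hq).norm (Eventually.of_forall fun n => norm_qPoch_le hq hx n)

theorem exists_norm_inv_qPoch_le {x q : ℂ} (hq : ‖q‖ < 1) (h : ∀ k : ℕ, 1 - x * q ^ k ≠ 0) :
    ∃ C : ℝ, 0 < C ∧ ∀ n, ‖(qPoch x q n)⁻¹‖ ≤ C := by
  have ht := (tendsto_qPoch x hq).inv₀ (qPochInf_ne_zero hq h)
  obtain ⟨C, hC⟩ := (Metric.isBounded_range_of_tendsto _ ht).exists_norm_le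
  exact ⟨max C 1, by positivity, fun n => (hC _ ⟨n, rfl⟩).trans (le_max_left _ _)⟩

theorem differentiable_qPochInf {q : ℂ} (hq : ‖q‖ < 1) :
    Differentiable ℂ fun x => qPochInf x q := by
  intro x
  let U := Metric.ball (0 : ℂ) (‖x‖ + 1)
  have hU : IsOpen U := Metric.isOpen_ball
  have hx : x ∈ U := by simp [U]
  have hprod := Summable.hasProdLocallyUniformlyOn_one_add (K := U)
    (f := fun (k : ℕ) (y : ℂ) => -(y * q ^ k)) (u := fun k : ℕ => (‖x‖ + 1) * ‖q‖ ^ k) hU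
    ((summable_geometric_of_lt_one (norm_nonneg q) hq).mul_left _)
    (Eventually.of_forall fun k y hy => by
      simp only [norm_neg, norm_mul, norm_pow]
      gcongr
      simpa [U] using (Metric.mem_ball.mp hy).le)
    (fun k => by fun_prop)
  have hd : DifferentiableOn ℂ (fun y => ∏' k : ℕ, (1 + -(y * q ^ k))) U :=
    hprod.differentiableOn
      (Eventually.of_forall fun s => DifferentiableOn.fun_finsetProd (fun _ _ => by fun_prop)) hU
  have := hd.differentiableAt (hU.mem_nhds hx)
  simpa [qPochInf, ← sub_eq_add_neg] using this

/-- `(x^2;q^2)_∞ = (x;q)_∞ (-x;q)_∞`. -/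
theorem qPochInf_sq (x : ℂ) {q : ℂ} (hq : ‖q‖ < 1) :
    qPochInf (x ^ 2) (q ^ 2) = qPochInf x q * qPochInf (-x) q := by
  unfold qPochInf
  rw [← (multipliable_qPochInf x hq).tprod_mul (multipliable_qPochInf (-x) hq)]
  congr 1; funext k; ring

theorem norm_sq_lt_one {q : ℂ} (hq : ‖q‖ < 1) : ‖q ^ 2‖ < 1 := by
  rw [norm_pow]; exact pow_lt_one₀ (norm_nonneg _) hq (by norm_num)

theorem norm_pow_lt_one {q : ℂ} (hq : ‖q‖ < 1) {n : ℕ} (hn : n ≠ 0) : ‖q ^ n‖ < 1 := by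
  rw [norm_pow]; exact pow_lt_one₀ (norm_nonneg _) hq hn

/-- `(x;q)_∞ = (x;q^2)_∞ (xq;q^2)_∞`. -/
theorem qPochInf_dissect (x : ℂ) {q : ℂ} (hq : ‖q‖ < 1) :
    qPochInf x q = qPochInf x (q ^ 2) * qPochInf (x * q) (q ^ 2) := by
  have h1 := multipliable_qPochInf x (norm_sq_lt_one hq)
  have h2 := multipliable_qPochInf (x * q) (norm_sq_lt_one hq)
  unfold qPochInf
  rw [← tprod_even_mul_odd (f := fun k : ℕ => 1 - x * q ^ k)
    (by simpa [pow_mul] using h1)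
    (by simpa [pow_succ', pow_mul, mul_assoc] using h2)]
  simp [pow_succ', pow_mul, mul_assoc]

/-! ### The theta function -/

theorem theta_eq_zero_one (q : ℂ) (hq : ‖q‖ < 1) : theta 1 q = 0 := by
  rw [theta, qPochInf_eq 1 hq]; simp

theorem theta_q_mul {q x : ℂ} (hq : ‖q‖ < 1) (hq0 : q ≠ 0) (hx : x ≠ 0) :
    theta (q * x) q = -x⁻¹ * theta x q := by
  rw [theta, theta, qPochInf_eq x hq, show q / (q * x) = x⁻¹ by field_simp,
    qPochInf_eq x⁻¹ hq, show x⁻¹ * q = q / x by ring, mul_comm x q]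
  field_simp
  ring

theorem theta_inv {q x : ℂ} (hq : ‖q‖ < 1) (hx : x ≠ 0) (hq0 : q ≠ 0) :
    theta x⁻¹ q = -x⁻¹ * theta x q := by
  rw [theta, theta, qPochInf_eq x hq, qPochInf_eq x⁻¹ hq, show q / x⁻¹ = x * q by field_simp,
    show x⁻¹ * q = q / x by ring]
  field_simp
  ring

theorem theta_div_q {q x : ℂ} (hq : ‖q‖ < 1) (hq0 : q ≠ 0) (hx : x ≠ 0) :
    theta (x / q) q = -(x / q) * theta x q := by
  have h := theta_q_mul hq hq0 (div_ne_zero hx hq0)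
  rw [mul_div_cancel₀ _ hq0] at h
  rw [h]; field_simp

theorem theta_symm {q x : ℂ} (hq0 : q ≠ 0) (hx : x ≠ 0) : theta (q / x) q = theta x q := by
  rw [theta, theta, show q / (q / x) = x by field_simp]; ring

theorem theta_zpow_mul {q x : ℂ} (hq : ‖q‖ < 1) (hq0 : q ≠ 0) (hx : x ≠ 0) (n : ℤ) :
    theta (q ^ n * x) q = (-1) ^ n * q ^ (-tri n) * x ^ (-n) * theta x q := by
  induction n using Int.induction_on with
  | zero => simp
  | succ n ih =>
    rw [zpow_add_one₀ hq0, mul_comm _ q, mul_assoc,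
      theta_q_mul hq hq0 (mul_ne_zero (zpow_ne_zero _ hq0) hx), ih, tri_add_one,
      zpow_add_one₀ (by norm_num), neg_add, neg_add, zpow_add₀ hq0, zpow_add₀ hx, mul_inv]
    simp only [zpow_neg, zpow_one]
    ring
  | pred n ih =>
    have hy : q ^ (-(n : ℤ) - 1) * x ≠ 0 := mul_ne_zero (zpow_ne_zero _ hq0) hx
    have h := theta_q_mul hq hq0 hy
    have e : q * (q ^ (-(n : ℤ) - 1) * x) = q ^ (-(n : ℤ)) * x := by
      rw [← mul_assoc, ← zpow_one_add₀ hq0]; congr 2; ring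
    rw [e, ih] at h
    have h2 : theta (q ^ (-(n : ℤ) - 1) * x) q = -(q ^ (-(n : ℤ) - 1) * x) *
        ((-1) ^ (-(n : ℤ)) * q ^ (-tri (-n)) * x ^ (- -(n : ℤ)) * theta x q) := by
      rw [h]; field_simp
    rw [h2]
    have e2 : tri (-(n : ℤ)) = tri (-n - 1) + (-n - 1) := by
      rw [← tri_add_one]; congr 1; ring
    rw [e2, zpow_sub_one₀ (by norm_num : (-1 : ℂ) ≠ 0), neg_add, zpow_add₀ hq0,
      show -(-(n : ℤ) - 1) = (n : ℤ) + 1 by ring, zpow_add_one₀ hx, neg_neg,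
      zpow_add_one₀ hq0, show -(n : ℤ) - 1 = -(n + 1 : ℤ) by ring, zpow_neg q ((n : ℤ) + 1),
      zpow_add_one₀ hq0]
    field_simp

theorem theta_ne_zero {q x : ℂ} (hq : ‖q‖ < 1) (hq0 : q ≠ 0) (hx : x ≠ 0)
    (h : ∀ n : ℤ, x * q ^ n ≠ 1) : theta x q ≠ 0 := by
  refine mul_ne_zero (mul_ne_zero ?_ ?_) (qPochInf_self_ne_zero hq)
  · refine qPochInf_ne_zero hq fun k hk => h k ?_
    rw [sub_eq_zero] at hk; simpa using hk.symm
  · refine qPochInf_ne_zero hq fun k hk => h (-(k + 1 : ℤ)) ?_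
    rw [sub_eq_zero] at hk
    rw [zpow_neg, zpow_add_one₀ hq0, zpow_natCast]
    field_simp at hk ⊢
    rw [hk]

theorem differentiableOn_theta {q : ℂ} (hq : ‖q‖ < 1) :
    DifferentiableOn ℂ (fun x => theta x q) {0}ᶜ := by
  have h := differentiable_qPochInf hq
  unfold theta
  refine DifferentiableOn.mul (DifferentiableOn.mul h.differentiableOn ?_)
    (differentiableOn_const _)
  exact h.comp_differentiableOn
    (DifferentiableOn.div (differentiableOn_const _) differentiableOn_id fun x hx => hx)

/-- `theta w p` with the factor that vanishes at `w = p ^ (-k)` removed; it satisfies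
`regTheta k w p * (1 - p ^ k * w) = theta w p`. -/
noncomputable def regTheta (k : ℤ) (w p : ℂ) : ℂ :=
  match k with
  | .ofNat n => qPoch w p n * qPochInf (w * p ^ (n + 1)) p * qPochInf (p / w) p * qPochInf p p
  | .negSucc n => -(p ^ (n + 1) / w) * qPochInf w p * qPoch (p / w) p n *
      qPochInf (p / w * p ^ (n + 1)) p * qPochInf p p

theorem regTheta_mul {p w : ℂ} (hp : ‖p‖ < 1) (hp0 : p ≠ 0) (hw : w ≠ 0) (k : ℤ) :
    regTheta k w p * (1 - p ^ k * w) = theta w p := by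
  cases k with
  | ofNat n =>
    rw [theta, qPochInf_eq_qPoch_mul w hp n, qPochInf_eq (w * p ^ n) hp]
    simp only [regTheta, Int.ofNat_eq_natCast, zpow_natCast, pow_succ]
    ring_nf
  | negSucc n =>
    rw [theta, qPochInf_eq_qPoch_mul (p / w) hp n, qPochInf_eq (p / w * p ^ n) hp]
    simp only [regTheta, zpow_negSucc, pow_succ]
    rw [← mul_assoc (p / w) (p ^ n) p]
    field_simp
    ring

theorem exists_norm_regTheta_le {p : ℂ} (hp : ‖p‖ < 1) (A : ℝ) :
    ∃ C : ℝ, 0 < C ∧ ∀ (k : ℤ) (w : ℂ), ‖w‖ ≤ A → ‖w⁻¹‖ ≤ A → ‖regTheta k w p‖ ≤ C := by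
  set M := Real.exp (A / (1 - ‖p‖)) with hM
  set P := Real.exp (1 / (1 - ‖p‖)) with hP
  have hMp : 0 < M := Real.exp_pos _
  have hPp : 0 < P := Real.exp_pos _
  refine ⟨M * M * M * P + |A| * M * M * M * P, by positivity, fun k w h1 h2 => ?_⟩
  have hA : 0 ≤ A := (norm_nonneg _).trans h1
  have hpn : ∀ n : ℕ, ‖p‖ ^ n ≤ 1 := fun n => pow_le_one₀ (norm_nonneg _) hp.le
  have hself : ‖qPochInf p p‖ ≤ P := norm_qPochInf_le hp hp.le
  have hpw : ‖p / w‖ ≤ A := by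
    rw [div_eq_mul_inv, norm_mul]; nlinarith [norm_nonneg p, norm_nonneg w⁻¹]
  have hmul : ∀ (y : ℂ) (n : ℕ), ‖y‖ ≤ A → ‖y * p ^ n‖ ≤ A := fun y n hy => by
    rw [norm_mul, norm_pow]
    nlinarith [hpn n, norm_nonneg y, pow_nonneg (norm_nonneg p) n]
  cases k with
  | ofNat n =>
    have : ‖regTheta (Int.ofNat n) w p‖ ≤ M * M * M * P := by
      simp only [regTheta, norm_mul]
      gcongr
      · exact norm_qPoch_le hp h1 n
      · exact norm_qPochInf_le hp (hmul _ _ h1)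
      · exact norm_qPochInf_le hp hpw
    have h3 : 0 ≤ |A| * M * M * M * P := by positivity
    linarith
  | negSucc n =>
    have : ‖regTheta (Int.negSucc n) w p‖ ≤ |A| * M * M * M * P := by
      simp only [regTheta, norm_mul, norm_neg]
      gcongr
      · rw [abs_of_nonneg hA, div_eq_mul_inv, norm_mul, norm_pow]
        nlinarith [hpn (n + 1), norm_nonneg w⁻¹, pow_nonneg (norm_nonneg p) (n + 1)]
      · exact norm_qPochInf_le hp h1
      · exact norm_qPoch_le hp hpw n
      · exact norm_qPochInf_le hp (hmul _ _ hpw)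
    have h3 : 0 ≤ M * M * M * P := by positivity
    linarith

theorem differentiableOn_regTheta {p : ℂ} (hp : ‖p‖ < 1) (k : ℤ) :
    DifferentiableOn ℂ (fun w => regTheta k w p) {0}ᶜ := by
  have h := differentiable_qPochInf hp
  have hi : DifferentiableOn ℂ (fun w : ℂ => p / w) {0}ᶜ :=
    DifferentiableOn.div (differentiableOn_const _) differentiableOn_id fun x hx => hx
  have hfin : ∀ n : ℕ, Differentiable ℂ fun w => qPoch w p n := fun n => by
    unfold qPoch
    exact Differentiable.fun_finsetProd (fun _ _ => by fun_prop)
  cases k with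
  | ofNat n =>
    simp only [regTheta]
    refine DifferentiableOn.mul (DifferentiableOn.mul (DifferentiableOn.mul
      (hfin n).differentiableOn ?_) (h.comp_differentiableOn hi)) (differentiableOn_const _)
    exact (h.comp (differentiable_id.mul_const _)).differentiableOn
  | negSucc n =>
    simp only [regTheta]
    refine DifferentiableOn.mul (DifferentiableOn.mul (DifferentiableOn.mul (DifferentiableOn.mul
      (DifferentiableOn.neg ?_) h.differentiableOn) ((hfin n).comp_differentiableOn hi)) ?_)
      (differentiableOn_const _)
    · exact DifferentiableOn.div (differentiableOn_const _) differentiableOn_id fun x hx => hx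
    · exact h.comp_differentiableOn (hi.mul_const _)

theorem exists_norm_inv_one_sub_le {p w : ℂ} (hp : ‖p‖ < 1) (hp0 : p ≠ 0) (hw : w ≠ 0)
    (h : ∀ n : ℤ, 1 - p ^ n * w ≠ 0) : ∃ C : ℝ, 0 < C ∧ ∀ n : ℤ, ‖(1 - p ^ n * w)⁻¹‖ ≤ C := by
  obtain ⟨C, hC, hb⟩ := exists_norm_regTheta_le hp (max ‖w‖ ‖w⁻¹‖)
  have ht : theta w p ≠ 0 := theta_ne_zero hp hp0 hw fun n hn => h n (by rw [mul_comm, hn, sub_self])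
  refine ⟨C / ‖theta w p‖, div_pos hC (norm_pos_iff.mpr ht), fun n => ?_⟩
  have := regTheta_mul hp hp0 hw n
  rw [← this, norm_mul, norm_inv]
  have hr : regTheta n w p ≠ 0 := fun h0 => ht (by rw [← this, h0, zero_mul])
  have hr' := norm_pos_iff.mpr hr
  have hn' := norm_pos_iff.mpr (h n)
  rw [le_div_iff₀ (by positivity)]
  calc ‖1 - p ^ n * w‖⁻¹ * (‖regTheta n w p‖ * ‖1 - p ^ n * w‖) = ‖regTheta n w p‖ := by field_simp
    _ ≤ C := hb n w (le_max_left _ _) (le_max_right _ _)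

/-! ### The limiting `q`-Gauss sum and its consequences -/

/-- The reciprocal `1 / (q;q)_m`, extended by `0` to negative `m`, so that the recurrence
`invPoch_sub_one` holds for every integer `m`. -/
noncomputable def invPoch (q : ℂ) (m : ℤ) : ℂ := if m < 0 then 0 else (qPoch q q m.toNat)⁻¹

@[simp] theorem invPoch_natCast (q : ℂ) (m : ℕ) : invPoch q m = (qPoch q q m)⁻¹ := by
  simp [invPoch]

theorem invPoch_of_neg (q : ℂ) {m : ℤ} (h : m < 0) : invPoch q m = 0 := by simp [invPoch, h]

@[simp] theorem invPoch_zero (q : ℂ) : invPoch q 0 = 1 := by simp [invPoch, qPoch_zero]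

theorem invPoch_sub_one {q : ℂ} (hq : ‖q‖ < 1) (m : ℤ) :
    invPoch q (m - 1) = (1 - q ^ m) * invPoch q m := by
  rcases lt_trichotomy m 0 with h | rfl | h
  · rw [invPoch_of_neg q h, invPoch_of_neg q (by omega), mul_zero]
  · simp [invPoch]
  · obtain ⟨n, rfl⟩ : ∃ n : ℕ, m = n + 1 := ⟨(m - 1).toNat, by omega⟩
    rw [add_sub_cancel_right, ← Nat.cast_succ, invPoch_natCast, invPoch_natCast, qPoch_succ,
      zpow_natCast, Nat.succ_eq_add_one, pow_succ']
    have h1 := qPoch_self_ne_zero hq n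
    have h2 := one_sub_mul_pow_ne_zero hq hq n
    field_simp

theorem exists_norm_invPoch_le {q : ℂ} (hq : ‖q‖ < 1) :
    ∃ C : ℝ, 0 < C ∧ ∀ m, ‖invPoch q m‖ ≤ C := by
  obtain ⟨C, hC, h⟩ := exists_norm_inv_qPoch_le hq (one_sub_mul_pow_ne_zero hq hq)
  refine ⟨C, hC, fun m => ?_⟩
  unfold invPoch
  split_ifs
  · simpa using hC.le
  · exact h _

/-- The `m`-th term of the limiting `q`-Gauss sum. -/
noncomputable def gaussTerm (b c q : ℂ) (m : ℕ) : ℂ :=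
  q ^ tri m * (∏ i ∈ Finset.range m, (c * q ^ i - b)) / (qPoch q q m * qPoch c q m)

theorem exists_norm_gaussTerm_le {q c : ℂ} (b : ℂ) (hq : ‖q‖ < 1)
    (hc : ∀ k : ℕ, 1 - c * q ^ k ≠ 0) :
    ∃ M A : ℝ, 0 < M ∧ 0 ≤ A ∧ ∀ N m : ℕ, ‖gaussTerm (b * q ^ N) (c * q ^ N) q m‖ ≤
      (‖q‖ ^ N) ^ m * (M * (A ^ m * ‖q‖ ^ tri m)) := by
  obtain ⟨C1, hC1, h1⟩ := exists_norm_inv_qPoch_le hq (one_sub_mul_pow_ne_zero hq hq)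
  obtain ⟨C2, hC2, h2⟩ := exists_norm_inv_qPoch_le hq hc
  set B := Real.exp (‖c‖ / (1 - ‖q‖))
  have hB : 0 < B := Real.exp_pos _
  refine ⟨C1 * (C2 * B), ‖c‖ + ‖b‖, by positivity, by positivity, fun N m => ?_⟩
  have hden : ‖(qPoch (c * q ^ N) q m)⁻¹‖ ≤ C2 * B := by
    have e := qPoch_add c q N m
    have hN := qPoch_ne_zero hc N
    have hNm := qPoch_ne_zero hc (N + m)
    have : (qPoch (c * q ^ N) q m)⁻¹ = (qPoch c q (N + m))⁻¹ * qPoch c q N := by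
      rw [e] at hNm ⊢
      have := right_ne_zero_of_mul hNm
      field_simp
    rw [this, norm_mul]
    gcongr
    · exact h2 _
    · exact norm_qPoch_le hq le_rfl N
  have hprod : ‖∏ i ∈ Finset.range m, (c * q ^ N * q ^ i - b * q ^ N)‖ ≤
      (‖q‖ ^ N * (‖c‖ + ‖b‖)) ^ m := by
    rw [norm_prod]
    rw [← Finset.card_range m, ← Finset.prod_const, Finset.card_range]
    refine Finset.prod_le_prod (fun _ _ => norm_nonneg _) fun i _ => ?_
    have hi : ‖q‖ ^ i ≤ 1 := pow_le_one₀ (norm_nonneg _) hq.le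
    calc ‖c * q ^ N * q ^ i - b * q ^ N‖ ≤ ‖c * q ^ N * q ^ i‖ + ‖b * q ^ N‖ := norm_sub_le _ _
      _ = ‖q‖ ^ N * (‖c‖ * ‖q‖ ^ i + ‖b‖) := by simp only [norm_mul, norm_pow]; ring
      _ ≤ ‖q‖ ^ N * (‖c‖ * 1 + ‖b‖) := by gcongr
      _ = _ := by ring
  rw [gaussTerm, div_eq_mul_inv, mul_inv, norm_mul, norm_mul, norm_mul, norm_zpow]
  calc _ ≤ ‖q‖ ^ tri m * (‖q‖ ^ N * (‖c‖ + ‖b‖)) ^ m * (C1 * (C2 * B)) := by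
        gcongr
        exact h1 m
    _ = _ := by rw [mul_pow]; ring

theorem summable_gaussTerm {q c : ℂ} (b : ℂ) (hq0 : q ≠ 0) (hq : ‖q‖ < 1)
    (hc : ∀ k : ℕ, 1 - c * q ^ k ≠ 0) : Summable fun m => ‖gaussTerm b c q m‖ := by
  obtain ⟨M, A, hM, hA, h⟩ := exists_norm_gaussTerm_le b hq hc
  refine ((summable_pow_mul_pow_tri A (norm_pos_iff.mpr hq0) hq).mul_left M).of_nonneg_of_le
    (fun _ => norm_nonneg _) fun m => by simpa using h 0 m

/-- The telescoping identity behind the contiguity relation for the limiting `q`-Gauss sum. -/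
theorem gaussTerm_contiguous {q c : ℂ} (b : ℂ) (hq0 : q ≠ 0) (hq : ‖q‖ < 1)
    (hc : ∀ k : ℕ, 1 - c * q ^ k ≠ 0) (m : ℕ) :
    (1 - c) * gaussTerm b c q m - (1 - b) * gaussTerm (b * q) (c * q) q m =
      (1 - c) * (1 - q ^ m) * gaussTerm b c q m -
        (1 - c) * (1 - q ^ (m + 1)) * gaussTerm b c q (m + 1) := by
  have h1 := qPoch_self_ne_zero hq m
  have h2 := qPoch_ne_zero hc m
  have h3 : 1 - c * q ^ m ≠ 0 := hc m
  have h4 : 1 - q * q ^ m ≠ 0 := one_sub_mul_pow_ne_zero hq hq m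
  have h5 : 1 - c ≠ 0 := by simpa using hc 0
  have e1 : qPoch (c * q) q m = qPoch c q m * (1 - c * q ^ m) / (1 - c) := by
    rw [eq_div_iff h5, ← qPoch_succ, qPoch_succ']; ring
  have e2 : ∏ i ∈ Finset.range m, (c * q * q ^ i - b * q) =
      q ^ m * ∏ i ∈ Finset.range m, (c * q ^ i - b) := by
    rw [← Finset.card_range m, ← Finset.prod_const, Finset.card_range, ← Finset.prod_mul_distrib]
    exact Finset.prod_congr rfl fun i _ => by ring
  simp only [gaussTerm]
  rw [e1, e2, Finset.prod_range_succ, qPoch_succ, qPoch_succ]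
  push_cast
  rw [tri_add_one, zpow_add₀ hq0, zpow_natCast, pow_succ' q m]
  generalize q ^ m = a at *
  generalize 1 - q * a = d at *
  field_simp
  ring

theorem tsum_gaussTerm_contiguous {q c : ℂ} (b : ℂ) (hq0 : q ≠ 0) (hq : ‖q‖ < 1)
    (hc : ∀ k : ℕ, 1 - c * q ^ k ≠ 0) :
    (1 - c) * ∑' m, gaussTerm b c q m = (1 - b) * ∑' m, gaussTerm (b * q) (c * q) q m := by
  have hs := (summable_gaussTerm b hq0 hq hc).of_norm
  have hc' : ∀ k : ℕ, 1 - c * q * q ^ k ≠ 0 := fun k => by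
    simpa [pow_succ', mul_assoc] using hc (k + 1)
  have hs' := (summable_gaussTerm (b * q) hq0 hq hc').of_norm
  have hG : Summable fun m => (1 - c) * (1 - q ^ m) * gaussTerm b c q m := by
    refine Summable.of_norm_bounded (g := fun m => ‖1 - c‖ * 2 * ‖gaussTerm b c q m‖)
      ((summable_gaussTerm b hq0 hq hc).mul_left _) fun m => ?_
    rw [norm_mul, norm_mul]
    gcongr
    calc ‖1 - q ^ m‖ ≤ 1 + ‖q‖ ^ m := by simpa using norm_sub_le (1 : ℂ) (q ^ m)
      _ ≤ 2 := by linarith [pow_le_one₀ (n := m) (norm_nonneg q) hq.le]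
  have hG0 := hG.tsum_eq_zero_add
  rw [← sub_eq_zero, ← tsum_mul_left, ← tsum_mul_left,
    ← (hs.mul_left _).tsum_sub (hs'.mul_left _)]
  simp_rw [gaussTerm_contiguous b hq0 hq hc]
  rw [hG.tsum_sub ((summable_nat_add_iff 1).mpr hG), hG0]
  simp

/-- The limit of the `q`-Gauss sum:
`∑ q^{m(m-1)/2} ∏_{i<m} (c q^i - b) / ((q;q)_m (c;q)_m) = (b;q)_∞ / (c;q)_∞`.
The contiguity relation moves `(b, c)` to `(b q^N, c q^N)`, where the sum tends to `1`. -/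
theorem hasSum_gaussTerm {q c : ℂ} (b : ℂ) (hq0 : q ≠ 0) (hq : ‖q‖ < 1)
    (hc : ∀ k : ℕ, 1 - c * q ^ k ≠ 0) :
    HasSum (gaussTerm b c q) (qPochInf b q / qPochInf c q) := by
  have hs := (summable_gaussTerm b hq0 hq hc).of_norm
  suffices h : qPochInf b q / qPochInf c q = ∑' m, gaussTerm b c q m by
    rw [h]; exact hs.hasSum
  have hcN : ∀ N k : ℕ, 1 - c * q ^ N * q ^ k ≠ 0 := fun N k => by
    simpa [pow_add, mul_assoc] using hc (N + k)
  have key : ∀ N : ℕ, qPoch c q N * ∑' m, gaussTerm b c q m =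
      qPoch b q N * ∑' m, gaussTerm (b * q ^ N) (c * q ^ N) q m := by
    intro N
    induction N with
    | zero => simp [qPoch_zero]
    | succ N ih =>
      have h := tsum_gaussTerm_contiguous (b * q ^ N) hq0 hq (hcN N)
      rw [qPoch_succ, qPoch_succ, mul_right_comm, ih, pow_succ, ← mul_assoc, ← mul_assoc]
      linear_combination qPoch b q N * h
  obtain ⟨M, A, hM, hA, hb⟩ := exists_norm_gaussTerm_le b hq hc
  have hlim : Tendsto (fun N : ℕ => ∑' m, gaussTerm (b * q ^ N) (c * q ^ N) q m) atTop
      (𝓝 (∑' m : ℕ, if m = 0 then (1 : ℂ) else 0)) := by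
    refine tendsto_tsum_of_dominated_convergence
      ((summable_pow_mul_pow_tri A (norm_pos_iff.mpr hq0) hq).mul_left M) (fun m => ?_)
      (Eventually.of_forall fun N m => (hb N m).trans ?_)
    · rcases m with _ | m
      · simp [gaussTerm, qPoch_zero]
      · simp only [Nat.add_eq_zero_iff, one_ne_zero, and_false, if_false]
        refine squeeze_zero_norm (fun N => hb N (m + 1)) ?_
        have h0 := ((tendsto_pow_atTop_nhds_zero_of_lt_one (norm_nonneg q) hq).pow
          (m + 1)).mul_const (M * (A ^ (m + 1) * ‖q‖ ^ tri ((m + 1 : ℕ) : ℤ)))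
        simpa using h0
    · have : (‖q‖ ^ N) ^ m ≤ 1 :=
        pow_le_one₀ (by positivity) (pow_le_one₀ (norm_nonneg _) hq.le)
      exact mul_le_of_le_one_left (by positivity) this
  rw [tsum_ite_eq] at hlim
  have hl := (tendsto_qPoch b hq).mul hlim
  have hr := (tendsto_qPoch c hq).mul_const (∑' m, gaussTerm b c q m)
  simp_rw [key] at hr
  have := tendsto_nhds_unique hr hl
  rw [div_eq_iff (qPochInf_ne_zero hq hc), mul_comm, this, mul_one]

/-- Euler's expansion of `(x;q)_∞`, as a bilateral series. -/
theorem hasSum_euler (x : ℂ) {q : ℂ} (hq0 : q ≠ 0) (hq : ‖q‖ < 1) :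
    HasSum (fun n : ℤ => (-1) ^ n * q ^ tri n * x ^ n * invPoch q n) (qPochInf x q) := by
  have h := hasSum_gaussTerm (c := 0) x hq0 hq (by simp)
  have e0 : qPochInf 0 q = 1 := by simp [qPochInf]
  rw [e0, div_one] at h
  refine (Function.Injective.hasSum_iff Nat.cast_injective ?_).mp (h.congr_fun ?_)
  · intro n hn
    rw [invPoch_of_neg, mul_zero]
    by_contra h0
    exact hn ⟨n.toNat, by simp; omega⟩
  · intro m
    simp [gaussTerm, qPoch, neg_pow x]
    ring

/-- Cauchy's identity `∑_m q^{m^2+ms} / ((q)_m (q)_{m+s}) = 1 / (q)_∞`, for every integer `s`. -/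
theorem hasSum_cauchy {q : ℂ} (hq0 : q ≠ 0) (hq : ‖q‖ < 1) (s : ℤ) :
    HasSum (fun m : ℤ => q ^ (m ^ 2 + m * s) * invPoch q m * invPoch q (m + s))
      (1 / qPochInf q q) := by
  wlog hs : 0 ≤ s generalizing s
  · have h := this (-s) (by omega)
    rw [← (Equiv.addRight s).hasSum_iff] at h
    refine h.congr_fun fun m => ?_
    simp only [Function.comp, Equiv.coe_addRight, add_neg_cancel_right]
    rw [show (m + s) ^ 2 + (m + s) * -s = m ^ 2 + m * s by ring]
    ring
  obtain ⟨s, rfl⟩ := Int.eq_ofNat_of_zero_le hs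
  have hcs : ∀ k : ℕ, 1 - q ^ (s + 1) * q ^ k ≠ 0 := fun k =>
    one_sub_mul_pow_ne_zero (norm_pow_lt_one hq (by omega)) hq k
  have h := (hasSum_gaussTerm 0 hq0 hq hcs).mul_right (qPoch q q s)⁻¹
  have e : qPochInf 0 q / qPochInf (q ^ (s + 1)) q * (qPoch q q s)⁻¹ = 1 / qPochInf q q := by
    rw [qPochInf_eq_qPoch_mul q hq s, show qPochInf 0 q = 1 by simp [qPochInf], pow_succ']
    rw [div_mul_eq_mul_div, one_mul, div_eq_mul_inv, one_div, mul_inv]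
  rw [e] at h
  refine (Function.Injective.hasSum_iff Nat.cast_injective ?_).mp (h.congr_fun ?_)
  · intro n hn
    rw [invPoch_of_neg q (m := n), mul_zero, zero_mul]
    by_contra h0
    exact hn ⟨n.toNat, by simp; omega⟩
  · intro m
    have e1 : (q : ℂ) ^ ((m : ℤ) ^ 2 + m * s) =
        q ^ tri m * ∏ i ∈ Finset.range m, (q ^ (s + 1) * q ^ i - 0) := by
      have : ∀ m : ℕ, ∏ i ∈ Finset.range m, (q ^ (s + 1) * q ^ i - 0) =
          q ^ (tri m + m * (s + 1)) := fun m => by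
        induction m with
        | zero => simp
        | succ m ih =>
          rw [Finset.prod_range_succ, ih, sub_zero, ← pow_add, ← zpow_natCast q, ← zpow_add₀ hq0]
          congr 1; push_cast; rw [tri_add_one]; ring
      rw [this, ← zpow_add₀ hq0]
      congr 1
      linear_combination -two_mul_tri m
    rw [Function.comp, ← Nat.cast_add, invPoch_natCast, invPoch_natCast, add_comm m s,
      qPoch_add, e1, gaussTerm, ← pow_succ']
    simp only [div_eq_mul_inv, mul_inv]
    ring

theorem triple_product_term {q x : ℂ} (hq0 : q ≠ 0) (hx : x ≠ 0) (s m : ℤ) :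
    (-1) ^ (m + s) * q ^ tri (m + s) * x ^ (m + s) * invPoch q (m + s) *
      ((-1) ^ m * q ^ tri m * (q / x) ^ m * invPoch q m) =
    (-1) ^ s * q ^ tri s * x ^ s * (q ^ (m ^ 2 + m * s) * invPoch q m * invPoch q (m + s)) := by
  have e1 : (q : ℂ) ^ tri (m + s) * q ^ tri m * q ^ m = q ^ tri s * q ^ (m ^ 2 + m * s) := by
    rw [← zpow_add₀ hq0, ← zpow_add₀ hq0, ← zpow_add₀ hq0, tri_add]
    congr 1; linear_combination two_mul_tri m
  have e2 : (-1 : ℂ) ^ (m + s) * (-1) ^ m = (-1) ^ s := by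
    rw [← zpow_add₀ (by norm_num), show m + s + m = s + 2 * m by ring,
      zpow_add₀ (by norm_num), zpow_mul]
    norm_num
  have e3 : x ^ (m + s) * (q / x) ^ m = x ^ s * q ^ m := by
    rw [div_zpow, zpow_add₀ hx]
    field_simp
  calc _ = ((-1 : ℂ) ^ (m + s) * (-1) ^ m) * (q ^ tri (m + s) * q ^ tri m) *
        (x ^ (m + s) * (q / x) ^ m) * invPoch q m * invPoch q (m + s) := by ring
    _ = (-1 : ℂ) ^ s * (q ^ tri (m + s) * q ^ tri m * q ^ m) *
        x ^ s * invPoch q m * invPoch q (m + s) := by rw [e2, e3]; ring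
    _ = _ := by rw [e1]; ring

/-- The shear `(s, m) ↦ (m + s, m)` of `ℤ × ℤ`. -/
def shear : ℤ × ℤ ≃ ℤ × ℤ where
  toFun p := (p.2 + p.1, p.2)
  invFun p := (p.1 - p.2, p.2)
  left_inv p := by simp
  right_inv p := by simp

theorem summable_prod_mul {ι κ : Type*} {f : ι → ℂ} {g : κ → ℂ} (hf : Summable fun i => ‖f i‖)
    (hg : Summable fun k => ‖g k‖) : Summable fun p : ι × κ => f p.1 * g p.2 :=
  summable_mul_of_summable_norm hf hg

theorem hasSum_prod_mul {ι κ : Type*} {f : ι → ℂ} {g : κ → ℂ} {a b : ℂ} (ha : HasSum f a)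
    (hb : HasSum g b) (hf : Summable fun i => ‖f i‖)
    (hg : Summable fun k => ‖g k‖) : HasSum (fun p : ι × κ => f p.1 * g p.2) (a * b) :=
  ha.mul hb (summable_prod_mul hf hg)

theorem summable_euler_norm {q : ℂ} (hq0 : q ≠ 0) (hq : ‖q‖ < 1) (y : ℂ) :
    Summable fun n : ℤ => ‖(-1) ^ n * q ^ tri n * y ^ n * invPoch q n‖ := by
  obtain ⟨C, hC, hb⟩ := exists_norm_invPoch_le hq
  refine ((summable_theta_term y hq0 hq).mul_right C).of_nonneg_of_le
    (fun _ => norm_nonneg _) fun n => ?_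
  rw [norm_mul _ (invPoch q n)]
  exact mul_le_mul_of_nonneg_left (hb n) (norm_nonneg _)

/-- The Jacobi triple product: comparing Euler's expansions of `(x)_∞` and `(q/x)_∞`, the
coefficient of `x^s` is evaluated by Cauchy's identity. -/
theorem hasSum_theta {q x : ℂ} (hq0 : q ≠ 0) (hq : ‖q‖ < 1) (hx : x ≠ 0) :
    HasSum (fun n : ℤ => (-1) ^ n * q ^ tri n * x ^ n) (theta x q) := by
  have hmul := hasSum_prod_mul (hasSum_euler x hq0 hq) (hasSum_euler (q / x) hq0 hq)
    (summable_euler_norm hq0 hq x) (summable_euler_norm hq0 hq (q / x))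
  rw [← shear.hasSum_iff] at hmul
  have hinner : ∀ s : ℤ, HasSum (fun m : ℤ => ((-1) ^ (m + s) * q ^ tri (m + s) * x ^ (m + s) *
      invPoch q (m + s) * ((-1) ^ m * q ^ tri m * (q / x) ^ m * invPoch q m)))
      ((-1) ^ s * q ^ tri s * x ^ s * (1 / qPochInf q q)) := fun s => by
    simp_rw [triple_product_term hq0 hx s]
    exact (hasSum_cauchy hq0 hq s).mul_left ((-1) ^ s * q ^ tri s * x ^ s)
  have hfib := HasSum.prod_fiberwise hmul hinner
  have h := hfib.mul_right (qPochInf q q)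
  have hne := qPochInf_self_ne_zero hq
  simp_rw [mul_assoc _ (1 / qPochInf q q), one_div_mul_cancel hne, mul_one] at h
  exact h

/-! ### A Bailey pair with `β_n = 1 / (q;q^2)_n` -/

/-- The partial theta sum `∑_{j<n} q^{-j(j+1)/2}`. -/
noncomputable def partialTheta (q : ℂ) (n : ℕ) : ℂ :=
  ∑ j ∈ Finset.range n, q ^ (-((j : ℤ) * (j + 1) / 2))

theorem tri_succ_eq (j : ℤ) : tri (j + 1) = j * (j + 1) / 2 := by
  unfold tri; congr 1; ring

theorem partialTheta_succ (q : ℂ) (n : ℕ) :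
    partialTheta q (n + 1) = partialTheta q n + q ^ (-tri (n + 1)) := by
  rw [partialTheta, Finset.sum_range_succ, ← tri_succ_eq]; rfl

/-- The summand of the inversion of the Bailey pair, with `j = i + 1`. -/
noncomputable def baileyInvTerm (q : ℂ) (r i : ℕ) : ℂ :=
  qPoch q q (r + i) * (-1) ^ (i + 1) * q ^ tri (r - 1 - i) * invPoch q (r - 1 - i) *
    (qPoch q (q ^ 2) (i + 1))⁻¹

theorem qPoch_odd_ne_zero {q : ℂ} (hq : ‖q‖ < 1) (n : ℕ) : qPoch q (q ^ 2) n ≠ 0 :=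
  qPoch_ne_zero (one_sub_mul_pow_ne_zero hq (norm_sq_lt_one hq)) n

/-- The telescoped form of the recurrence in `r` satisfied by the sums of `baileyInvTerm`. -/
theorem sum_baileyInvTerm_succ_sub {q : ℂ} (hq0 : q ≠ 0) (hq : ‖q‖ < 1) (r m : ℕ) :
    ∑ i ∈ Finset.range m, (baileyInvTerm q (r + 1) i - q ^ (2 * r) * baileyInvTerm q r i) =
      (-1) ^ m * qPoch q q (r + m) * q ^ tri (r - m + 1) * invPoch q (r - m) *
        (qPoch q (q ^ 2) m)⁻¹ - q ^ tri (r + 1) := by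
  induction m with
  | zero =>
    have := qPoch_self_ne_zero hq r
    simp [qPoch_zero]
    field_simp
    ring
  | succ m ih =>
    rw [Finset.sum_range_succ, ih]
    have h1 := qPoch_odd_ne_zero hq m
    have h2 := one_sub_mul_pow_ne_zero hq (norm_sq_lt_one hq) m
    have e0 : invPoch q (r - (m + 1)) = (1 - q ^ ((r : ℤ) - m)) * invPoch q (r - m) := by
      rw [← invPoch_sub_one hq]; congr 1; ring
    simp only [baileyInvTerm]
    push_cast
    rw [show (r : ℤ) + 1 - 1 - m = r - m by ring, show (r : ℤ) - 1 - m = r - (m + 1) by ring, e0,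
      show r + (m + 1) = r + m + 1 by ring, show r + 1 + m = r + m + 1 by ring, qPoch_succ,
      qPoch_succ, show (r : ℤ) - (m + 1) + 1 = r - m by ring]
    have t1 : tri ((r : ℤ) - m + 1) = tri (r - m) + (r - m) := tri_add_one _
    have t2 : tri ((r : ℤ) - (m + 1)) = tri (r - m) + (-(r - m) + 1) := by
      have := tri_add_one ((r : ℤ) - (m + 1))
      rw [show (r : ℤ) - (m + 1) + 1 = r - m by ring] at this
      omega
    rw [t1, t2, zpow_add₀ hq0, zpow_add₀ hq0, zpow_add₀ hq0, zpow_neg, zpow_one, zpow_sub₀ hq0,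
      zpow_natCast, zpow_natCast, ← pow_mul, pow_succ (-1 : ℂ), mul_comm 2 r, mul_comm 2 m,
      pow_add, pow_mul, pow_mul] at *
    have h3 : q ^ r ≠ 0 := pow_ne_zero _ hq0
    have h4 : q ^ m ≠ 0 := pow_ne_zero _ hq0
    generalize q ^ r = a at *
    generalize q ^ m = b at *
    generalize hd : 1 - q * b ^ 2 = d at *
    field_simp
    rw [← hd]
    ring

/-- Creative telescoping in `j` gives a first order recurrence in `r`. -/
theorem sum_baileyInvTerm {q : ℂ} (hq0 : q ≠ 0) (hq : ‖q‖ < 1) (r : ℕ) :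
    ∑ i ∈ Finset.range r, baileyInvTerm q r i = -q ^ ((r : ℤ) ^ 2 - r) * partialTheta q r := by
  induction r with
  | zero => simp [partialTheta]
  | succ r ih =>
    have h := sum_baileyInvTerm_succ_sub hq0 hq r (r + 1)
    rw [invPoch_of_neg q (by push_cast; omega), Finset.sum_sub_distrib, ← Finset.mul_sum,
      Finset.sum_range_succ (fun i => baileyInvTerm q r i)] at h
    have h0 : baileyInvTerm q r r = 0 := by
      rw [baileyInvTerm, invPoch_of_neg q (by omega)]; simp
    rw [h0, ih] at h
    rw [partialTheta_succ]
    have e1 : q ^ (((r + 1 : ℕ) : ℤ) ^ 2 - ((r + 1 : ℕ) : ℤ)) =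
        q ^ (2 * r) * q ^ ((r : ℤ) ^ 2 - r) := by
      rw [← zpow_natCast, ← zpow_add₀ hq0]; congr 1; push_cast; ring
    have e2 : q ^ (((r + 1 : ℕ) : ℤ) ^ 2 - ((r + 1 : ℕ) : ℤ)) * q ^ (-tri (r + 1)) =
        q ^ tri (r + 1) := by
      rw [← zpow_add₀ hq0]; congr 1; push_cast
      linear_combination -two_mul_tri ((r : ℤ) + 1)
    linear_combination h + e2 + partialTheta q r * e1

/-- The telescoped form of the orthogonality relation that inverts Bailey pairs. -/
theorem sum_bailey_orthogonality {q : ℂ} (hq0 : q ≠ 0) (hq : ‖q‖ < 1) (n i m : ℕ) :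
    (1 - q ^ ((n : ℤ) - (i + 1))) * ∑ r ∈ Finset.range m, (1 - q ^ (2 * (r + 1))) *
      (qPoch q q (r + 1 + i) * (-1) ^ (r + i) * q ^ tri (r - i) * invPoch q (r - i)) *
        (invPoch q (n - (r + 1)) * invPoch q (n + (r + 1))) =
    (-1) ^ (m + i + 1) * q ^ tri (m - i) * qPoch q q (m + i + 1) * invPoch q (m - (i + 1)) *
      (invPoch q (n - m - 1) * invPoch q (n + m)) := by
  induction m with
  | zero =>
    rw [invPoch_of_neg q (m := ((0 : ℕ) : ℤ) - (i + 1)) (by push_cast; omega)]; simp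
  | succ m ih =>
    rw [Finset.sum_range_succ, mul_add, ih]
    have e1 : invPoch q ((m : ℤ) - (i + 1)) = (1 - q ^ ((m : ℤ) - i)) * invPoch q (m - i) := by
      rw [← invPoch_sub_one hq]; congr 1; ring
    have e2 : invPoch q ((n : ℤ) - m - 1 - 1) =
        (1 - q ^ ((n : ℤ) - m - 1)) * invPoch q (n - m - 1) := invPoch_sub_one hq _
    have e3 : invPoch q ((n : ℤ) + m) =
        (1 - q ^ ((n : ℤ) + m + 1)) * invPoch q (n + m + 1) := by
      rw [← invPoch_sub_one hq]; congr 1; ring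
    push_cast
    rw [show ((m : ℤ) + 1 - (i + 1)) = m - i by ring, show (n : ℤ) - (m + 1) - 1 = n - m - 1 - 1 by
      ring, show (n : ℤ) - (m + 1) = n - m - 1 by ring, show (n : ℤ) + (m + 1) = n + m + 1 by ring,
      show (m : ℤ) + 1 - i = m - i + 1 by ring, e1, e2, e3, tri_add_one,
      show m + 1 + i + 1 = m + i + 1 + 1 by ring, show m + 1 + i = m + i + 1 by ring,
      qPoch_succ q q (m + i + 1), show (n : ℤ) - (i + 1) = n - i - 1 by ring]
    simp only [zpow_add₀ hq0, zpow_sub₀ hq0, zpow_natCast, zpow_one, pow_add, pow_one, pow_mul,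
      mul_add, mul_one]
    have h2 : q ^ n ≠ 0 := pow_ne_zero _ hq0
    have h3 : q ^ m ≠ 0 := pow_ne_zero _ hq0
    have h4 : q ^ i ≠ 0 := pow_ne_zero _ hq0
    rw [show (q ^ 2) ^ m = (q ^ m) ^ 2 by ring]
    generalize q ^ n = a at *
    generalize q ^ m = b at *
    generalize q ^ i = c at *
    field_simp
    ring

/-- The `α`-side of the Bailey pair, for `r ≥ 1`; its value at `r = 0` is `0`. -/
noncomputable def baileyAlpha (q : ℂ) (r : ℕ) : ℂ :=
  -(-1) ^ r * (1 - q ^ (2 * r)) * q ^ ((r : ℤ) ^ 2 - r) * partialTheta q r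

theorem baileyAlpha_eq_sum {q : ℂ} (hq0 : q ≠ 0) (hq : ‖q‖ < 1) {r n : ℕ} (h : r ≤ n) :
    baileyAlpha q r = ∑ i ∈ Finset.range n,
      (-1) ^ r * (1 - q ^ (2 * r)) * baileyInvTerm q r i := by
  rw [← Finset.mul_sum, ← Finset.sum_subset (Finset.range_mono h), sum_baileyInvTerm hq0 hq,
    baileyAlpha]
  · ring
  · intro i _ hi
    simp only [Finset.mem_range, not_lt] at hi
    rw [baileyInvTerm, invPoch_of_neg q (by omega)]; simp

/-- `β_n = ∑_r α_r / ((q)_{n-r} (q)_{n+r})` for the Bailey pair with `β_n = 1 / (q;q^2)_n`,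
`n ≥ 1`. -/
theorem sum_baileyAlpha {q : ℂ} (hq0 : q ≠ 0) (hq : ‖q‖ < 1) (n : ℕ) :
    ∑ r ∈ Finset.range (n + 1), baileyAlpha q (r + 1) *
      (invPoch q (n - r) * invPoch q (n + r + 2)) = (qPoch q (q ^ 2) (n + 1))⁻¹ := by
  have e : ∀ r ∈ Finset.range (n + 1), baileyAlpha q (r + 1) *
      (invPoch q (n - r) * invPoch q (n + r + 2)) = ∑ i ∈ Finset.range (n + 1),
        (qPoch q (q ^ 2) (i + 1))⁻¹ * ((1 - q ^ (2 * (r + 1))) *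
      (qPoch q q (r + 1 + i) * (-1) ^ (r + i) * q ^ tri (r - i) * invPoch q (r - i)) *
        (invPoch q ((n + 1 : ℕ) - (r + 1)) * invPoch q ((n + 1 : ℕ) + (r + 1)))) := by
    intro r hr
    rw [baileyAlpha_eq_sum hq0 hq (n := n + 1) (by simpa using hr), Finset.sum_mul]
    refine Finset.sum_congr rfl fun i _ => ?_
    rw [baileyInvTerm]
    push_cast
    rw [show (r : ℤ) + 1 - 1 - i = r - i by ring, show (n : ℤ) + 1 - (r + 1) = n - r by ring,
      show (n : ℤ) + 1 + (r + 1) = n + r + 2 by ring]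
    ring
  -- After exchanging the sums, orthogonality leaves only the term with `i = n`.
  rw [Finset.sum_congr rfl e, Finset.sum_comm, Finset.sum_eq_single n]
  · rw [← Finset.mul_sum, Finset.sum_eq_single n]
    · have := qPoch_self_ne_zero hq (2 * n + 1)
      have h2 := one_sub_mul_pow_ne_zero hq hq (2 * n + 1)
      rw [show n + 1 + n = 2 * n + 1 by ring, show ((n + 1 : ℕ) : ℤ) + (n + 1) =
        ((2 * n + 1 + 1 : ℕ) : ℤ) by push_cast; ring, invPoch_natCast, qPoch_succ q q (2 * n + 1), ← two_mul,
        pow_mul (-1 : ℂ)]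
      rw [← pow_succ'] at *
      rw [show 2 * n + 1 + 1 = 2 * (n + 1) by ring] at *
      simp
      field_simp
    · intro r hr hrn
      have : r < n := by simp at hr; omega
      rw [invPoch_of_neg q (m := (r : ℤ) - n) (by omega)]; simp
    · simp
  · intro i hi hin
    have hin' : i < n := by simp at hi; omega
    have h := sum_bailey_orthogonality hq0 hq (n + 1) i (n + 1)
    rw [invPoch_of_neg q (m := ((n + 1 : ℕ) : ℤ) - (n + 1 : ℕ) - 1) (by omega)] at h
    rw [← Finset.mul_sum]
    simp only [zero_mul, mul_zero] at h
    rcases mul_eq_zero.mp h with h | h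
    · exfalso
      rw [show ((n + 1 : ℕ) : ℤ) - (i + 1) = ((n - i : ℕ) : ℤ) by omega, zpow_natCast] at h
      have : 1 - q ^ (n - i) ≠ 0 := by
        have := one_sub_mul_pow_ne_zero hq hq (n - i - 1)
        rwa [← pow_succ', show n - i - 1 + 1 = n - i by omega] at this
      exact this h
    · rw [h, mul_zero]
  · simp

theorem norm_partialTheta_le {q : ℂ} (hq0 : q ≠ 0) (hq : ‖q‖ < 1) (n : ℕ) :
    ‖partialTheta q n‖ ≤ n * ‖q‖ ^ (-tri n) := by
  refine (norm_sum_le _ _).trans ?_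
  refine (Finset.sum_le_sum (g := fun _ => ‖q‖ ^ (-tri n)) fun j hj => ?_).trans_eq (by simp)
  rw [norm_zpow, ← tri_succ_eq]
  refine zpow_le_zpow_right_of_le_one₀ (norm_pos_iff.mpr hq0) hq.le ?_
  have hj' : (j : ℤ) + 1 ≤ n := by exact_mod_cast Finset.mem_range.mp hj
  have h1 := two_mul_tri n
  have h2 := two_mul_tri ((j : ℤ) + 1)
  have : (0 : ℤ) ≤ j := by positivity
  nlinarith

theorem norm_one_sub_pow_le {q : ℂ} (hq : ‖q‖ < 1) (n : ℕ) : ‖1 - q ^ n‖ ≤ 2 := by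
  calc ‖1 - q ^ n‖ ≤ 1 + ‖q‖ ^ n := by simpa using norm_sub_le (1 : ℂ) (q ^ n)
    _ ≤ 2 := by linarith [pow_le_one₀ (n := n) (norm_nonneg q) hq.le]

theorem summable_nat_mul_tri {q : ℂ} (hq0 : q ≠ 0) (hq : ‖q‖ < 1) :
    Summable fun n : ℕ => (n : ℝ) * ‖q‖ ^ tri n := by
  refine (summable_pow_mul_pow_tri 2 (norm_pos_iff.mpr hq0) hq).of_nonneg_of_le
    (fun n => by positivity) fun n => ?_
  gcongr
  exact_mod_cast Nat.lt_two_pow_self.le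

theorem summable_baileyAlpha {q : ℂ} (hq0 : q ≠ 0) (hq : ‖q‖ < 1) :
    Summable fun r : ℕ => ‖baileyAlpha q r‖ := by
  refine ((summable_nat_mul_tri hq0 hq).mul_left 2).of_nonneg_of_le (fun _ => norm_nonneg _)
    fun r => ?_
  have hp := norm_pos_iff.mpr hq0
  rw [baileyAlpha, norm_mul, norm_mul, norm_mul, norm_neg, norm_pow, norm_neg, norm_one, one_pow,
    one_mul, norm_zpow]
  calc _ ≤ 2 * ‖q‖ ^ ((r : ℤ) ^ 2 - r) * (r * ‖q‖ ^ (-tri r)) := by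
        gcongr
        · exact norm_one_sub_pow_le hq _
        · exact norm_partialTheta_le hq0 hq r
    _ = 2 * (r * (‖q‖ ^ ((r : ℤ) ^ 2 - r) * ‖q‖ ^ (-tri r))) := by ring
    _ = _ := by
      rw [← zpow_add₀ hp.ne']
      congr 3
      linear_combination -two_mul_tri (r : ℤ)

theorem summable_prod_mul_norm {ι κ : Type*} {f : ι → ℂ} {g : κ → ℂ}
    (hf : Summable fun i => ‖f i‖) (hg : Summable fun k => ‖g k‖) :
    Summable fun p : ι × κ => ‖f p.1 * g p.2‖ :=
  Summable.mul_norm hf hg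

/-- The Bailey transform for the pair above. -/
theorem hasSum_bailey {q : ℂ} (hq0 : q ≠ 0) (hq : ‖q‖ < 1) {δ γ : ℕ → ℂ}
    (hδ : Summable fun n => ‖δ n‖)
    (hγ : ∀ r : ℕ, HasSum (fun n : ℕ => δ n * (invPoch q (n - r) * invPoch q (n + r + 2))) (γ r)) :
    HasSum (fun r => baileyAlpha q (r + 1) * γ r)
      (∑' n, δ n * (qPoch q (q ^ 2) (n + 1))⁻¹) := by
  obtain ⟨C, hC, hb⟩ := exists_norm_invPoch_le hq
  have hα : Summable fun r : ℕ => ‖baileyAlpha q (r + 1)‖ :=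
    (summable_nat_add_iff 1).mpr (summable_baileyAlpha hq0 hq)
  have hs : Summable fun p : ℕ × ℕ => baileyAlpha q (p.1 + 1) *
      (δ p.2 * (invPoch q (p.2 - p.1) * invPoch q (p.2 + p.1 + 2))) := by
    refine Summable.of_norm_bounded
      ((summable_prod_mul_norm hα hδ).mul_right (C * C)) fun p => ?_
    rw [← mul_assoc, norm_mul, norm_mul _ (invPoch q (p.2 + p.1 + 2))]
    gcongr
    · exact hb _
    · exact hb _
  have h2 := hs.hasSum.prod_fiberwise fun r => (hγ r).mul_left (baileyAlpha q (r + 1))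
  have e : ∑' n, δ n * (qPoch q (q ^ 2) (n + 1))⁻¹ = ∑' p : ℕ × ℕ, baileyAlpha q (p.1 + 1) *
      (δ p.2 * (invPoch q (p.2 - p.1) * invPoch q (p.2 + p.1 + 2))) := by
    refine Eq.trans ?_ ((Equiv.prodComm ℕ ℕ).tsum_eq fun p : ℕ × ℕ => baileyAlpha q (p.1 + 1) *
      (δ p.2 * (invPoch q (p.2 - p.1) * invPoch q (p.2 + p.1 + 2))))
    refine Eq.trans ?_ hs.prod_symm.tsum_prod.symm
    refine tsum_congr fun n => ?_
    rw [← sum_baileyAlpha hq0 hq n, Finset.mul_sum, tsum_eq_sum (s := Finset.range (n + 1))]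
    · exact Finset.sum_congr rfl fun r _ => by simp only [Prod.swap]; ring
    · intro r hr
      simp only [Prod.swap]
      rw [invPoch_of_neg q (by simp at hr; omega)]; simp
  rw [e]
  exact h2

/-! ### The Hecke-type series for `ψ` and for the companion series -/

theorem summable_pow_sq {q : ℂ} (hq0 : q ≠ 0) (hq : ‖q‖ < 1) :
    Summable fun n : ℕ => ‖q ^ ((n + 1) ^ 2)‖ := by
  refine ((summable_nat_add_iff 1).mpr (summable_pow_mul_pow_tri 1
    (norm_pos_iff.mpr hq0) hq)).of_nonneg_of_le (fun _ => norm_nonneg _) fun n => ?_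
  rw [one_pow, one_mul, norm_pow, ← zpow_natCast]
  refine zpow_le_zpow_right_of_le_one₀ (norm_pos_iff.mpr hq0) hq.le ?_
  have := two_mul_tri ((n + 1 : ℕ) : ℤ)
  push_cast at *
  nlinarith

/-- The conjugate Bailey pair with `δ_n = q^{n^2}`, with `n` and `r` shifted by one. -/
theorem hasSum_gamma_psi {q : ℂ} (hq0 : q ≠ 0) (hq : ‖q‖ < 1) (r : ℕ) :
    HasSum (fun n : ℕ => q ^ ((n + 1) ^ 2) * (invPoch q (n - r) * invPoch q (n + r + 2)))
      (q ^ ((r + 1) ^ 2) * (1 / qPochInf q q)) := by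
  have h := (hasSum_cauchy hq0 hq (2 * r + 2)).mul_left (q ^ ((r + 1) ^ 2))
  rw [← (Equiv.subRight (r : ℤ)).hasSum_iff] at h
  refine ((Function.Injective.hasSum_iff Nat.cast_injective ?_).mpr h).congr_fun ?_
  · intro n hn
    simp only [Function.comp, Equiv.subRight_apply]
    rw [invPoch_of_neg q (m := n - r), mul_zero, zero_mul, mul_zero]
    by_contra h0
    exact hn ⟨n.toNat, by simp; omega⟩
  · intro n
    simp only [Function.comp, Equiv.subRight_apply]
    have e : (q : ℂ) ^ ((n + 1) ^ 2) = q ^ ((r + 1) ^ 2) *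
        q ^ (((n : ℤ) - r) ^ 2 + (n - r) * (2 * r + 2)) := by
      rw [← zpow_natCast, ← zpow_natCast, ← zpow_add₀ hq0]
      congr 1; push_cast; ring
    rw [e, show (n : ℤ) - r + (2 * r + 2) = n + r + 2 by ring]
    ring

theorem exists_norm_inv_qPoch_odd_le {q : ℂ} (hq : ‖q‖ < 1) :
    ∃ C : ℝ, 0 < C ∧ ∀ n, ‖(qPoch q (q ^ 2) n)⁻¹‖ ≤ C :=
  exists_norm_inv_qPoch_le (norm_sq_lt_one hq) (one_sub_mul_pow_ne_zero hq (norm_sq_lt_one hq))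

theorem summable_psiTerm {q : ℂ} (hq0 : q ≠ 0) (hq : ‖q‖ < 1) :
    Summable fun n : ℕ => psiTerm q (n + 1) := by
  obtain ⟨C, hC, hb⟩ := exists_norm_inv_qPoch_odd_le hq
  refine Summable.of_norm_bounded ((summable_pow_sq hq0 hq).mul_right C) fun n => ?_
  rw [psiTerm, div_eq_mul_inv, norm_mul]
  gcongr
  exact hb _

theorem psiHeckeTerm_eq {q : ℂ} (hq0 : q ≠ 0) (r : ℕ) :
    psiHeckeTerm q r = -(baileyAlpha q r * q ^ (r ^ 2)) := by
  have e : q ^ (2 * (r : ℤ) ^ 2 - r) = q ^ ((r : ℤ) ^ 2 - r) * q ^ (r ^ 2) := by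
    rw [← zpow_natCast, ← zpow_add₀ hq0]; congr 1; push_cast; ring
  rw [psiHeckeTerm, e, baileyAlpha, partialTheta]
  ring

theorem hasSum_psiHeckeTerm {q : ℂ} (hq0 : q ≠ 0) (hq : ‖q‖ < 1) :
    HasSum (fun n : ℕ => psiHeckeTerm q (n + 1)) (-(qPochInf q q * psi q)) := by
  have h := (hasSum_bailey hq0 hq (summable_pow_sq hq0 hq) (hasSum_gamma_psi hq0 hq)).mul_left
    (-qPochInf q q)
  have e : ∑' n : ℕ, q ^ ((n + 1) ^ 2) * (qPoch q (q ^ 2) (n + 1))⁻¹ = psi q := by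
    simp only [psi, psiTerm, div_eq_mul_inv]
  rw [e, neg_mul] at h
  refine h.congr_fun fun n => ?_
  rw [psiHeckeTerm_eq hq0]
  have := qPochInf_self_ne_zero hq
  field_simp

theorem psi_eq_tsum_psiHeckeTerm {q : ℂ} (hq0 : q ≠ 0) (hq : ‖q‖ < 1) :
    psi q = -(1 / qPochInf q q) * ∑' n : ℕ, psiHeckeTerm q (n + 1) := by
  rw [(hasSum_psiHeckeTerm hq0 hq).tsum_eq]
  have := qPochInf_self_ne_zero hq
  field_simp

theorem qPoch_neg_one_succ (q : ℂ) (n : ℕ) :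
    qPoch (-1) q (n + 1) = 2 * qPoch (-q) q n := by
  rw [qPoch_succ']; norm_num

theorem neg_qPoch_ne {q : ℂ} (hq : ‖q‖ < 1) {n : ℕ} (hn : n ≠ 0) : 1 + q ^ n ≠ 0 := by
  have := one_sub_ne_zero_of_norm_ne (x := -q ^ n) (by
    rw [norm_neg]; exact (norm_pow_lt_one hq hn).ne)
  simpa using this

/-- The summand of the conjugate pair below is that of a limiting `q`-Gauss sum. -/
theorem gaussTerm_companion {q : ℂ} (hq0 : q ≠ 0) (R m : ℕ) :
    q ^ tri (m + R + 1) * qPoch (-1) q (m + R) * (invPoch q m * invPoch q (m + 2 * R)) =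
      gaussTerm (-q ^ (R + 1)) (q ^ (2 * R + 1)) q m *
        (q ^ tri (R + 1) * qPoch (-1) q R * (qPoch q q (2 * R))⁻¹) := by
  have e1 : ∏ i ∈ Finset.range m, (q ^ (2 * R + 1) * q ^ i - -q ^ (R + 1)) =
      (q ^ (R + 1)) ^ m * qPoch (-1 * q ^ R) q m := by
    rw [qPoch, ← Finset.card_range m, ← Finset.prod_const, Finset.card_range,
      ← Finset.prod_mul_distrib]
    exact Finset.prod_congr rfl fun i _ => by ring
  have e2 : q ^ tri (m + R + 1) = q ^ tri m * q ^ tri (R + 1) * (q ^ (R + 1)) ^ m := by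
    rw [← pow_mul, ← zpow_natCast q, ← zpow_add₀ hq0, ← zpow_add₀ hq0, add_assoc, tri_add]
    congr 1; push_cast; ring
  have e3 : invPoch q (m + 2 * R) = (qPoch q q (2 * R))⁻¹ * (qPoch (q ^ (2 * R + 1)) q m)⁻¹ := by
    rw [show (m : ℤ) + 2 * R = ((2 * R + m : ℕ) : ℤ) by push_cast; ring, invPoch_natCast,
      qPoch_add, mul_inv, ← pow_succ']
  rw [gaussTerm, e1, e2, e3, invPoch_natCast, add_comm m R, qPoch_add]
  simp only [div_eq_mul_inv, mul_inv]
  ring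

/-- The conjugate Bailey pair with `δ_n = q^{n(n+1)/2} (-1;q)_n`, with `n` and `r`
shifted by one. -/
theorem hasSum_gamma_companion {q : ℂ} (hq0 : q ≠ 0) (hq : ‖q‖ < 1) (r : ℕ) :
    HasSum (fun n : ℕ => q ^ tri (n + 2) * qPoch (-1) q (n + 1) *
        (invPoch q (n - r) * invPoch q (n + r + 2)))
      (q ^ tri (r + 2) * (2 / (1 + q ^ (r + 1))) * (qPochInf (-q) q / qPochInf q q)) := by
  have hc : ∀ k : ℕ, 1 - q ^ (2 * (r + 1) + 1) * q ^ k ≠ 0 := fun k =>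
    one_sub_mul_pow_ne_zero (norm_pow_lt_one hq (by omega)) hq k
  have h := (hasSum_gaussTerm (-q ^ (r + 1 + 1)) hq0 hq hc).mul_right
    (q ^ tri ((r + 1 : ℕ) + 1) * qPoch (-1) q (r + 1) * (qPoch q q (2 * (r + 1)))⁻¹)
  simp_rw [← gaussTerm_companion hq0] at h
  have e : qPochInf (-q ^ (r + 1 + 1)) q / qPochInf (q ^ (2 * (r + 1) + 1)) q *
      (q ^ tri ((r + 1 : ℕ) + 1) * qPoch (-1) q (r + 1) * (qPoch q q (2 * (r + 1)))⁻¹) =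
      q ^ tri (r + 2) * (2 / (1 + q ^ (r + 1))) * (qPochInf (-q) q / qPochInf q q) := by
    have h1 := qPochInf_eq_qPoch_mul q hq (2 * (r + 1))
    have h2 := qPochInf_eq_qPoch_mul (-q) hq (r + 1)
    rw [← pow_succ'] at h1
    rw [neg_mul, ← pow_succ', qPoch_succ] at h2
    rw [h1, h2, qPoch_neg_one_succ, show (((r + 1 : ℕ) : ℤ) + 1) = r + 2 by push_cast; ring]
    have h3 := qPoch_self_ne_zero hq (2 * (r + 1))
    have h4 := qPochInf_ne_zero hq hc
    have h5 := neg_qPoch_ne hq (n := r + 1) (by omega)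
    rw [neg_mul, sub_neg_eq_add, ← pow_succ']
    field_simp
  rw [e] at h
  refine (Function.Injective.hasSum_iff (add_left_injective r) ?_).mp (h.congr_fun ?_)
  · intro n hn
    rw [invPoch_of_neg q (m := n - r), zero_mul, mul_zero]
    by_contra h0
    exact hn ⟨n - r, by simp; omega⟩
  · intro m
    simp only [Function.comp]
    push_cast
    rw [show (m : ℤ) + r - r = m by ring, show (m : ℤ) + r + r + 2 = m + 2 * (r + 1) by ring,
      show (m : ℤ) + (r + 1) + 1 = m + r + 2 by ring, add_assoc m r 1]

theorem companionTerm_succ (q : ℂ) (n : ℕ) : companionTerm q (n + 1) =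
    q ^ tri (n + 2) * qPoch (-1) q (n + 1) * (qPoch q (q ^ 2) (n + 1))⁻¹ := by
  have : q ^ (((n + 1) ^ 2 + (n + 1)) / 2) = q ^ tri (n + 2) := by
    have h := tri_natCast (n + 2)
    rw [Nat.cast_add, Nat.cast_ofNat] at h
    rw [h, zpow_natCast]
    congr 2
    rw [show n + 2 - 1 = n + 1 by omega]; ring
  rw [companionTerm, this, div_eq_mul_inv]

theorem summable_companion_weight {q : ℂ} (hq0 : q ≠ 0) (hq : ‖q‖ < 1) :
    Summable fun n : ℕ => ‖q ^ tri (n + 2) * qPoch (-1) q (n + 1)‖ := by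
  have h := (summable_nat_add_iff 2).mpr (summable_pow_mul_pow_tri 1 (norm_pos_iff.mpr hq0) hq)
  refine (h.mul_right (Real.exp (1 / (1 - ‖q‖)))).of_nonneg_of_le (fun _ => norm_nonneg _)
    fun n => ?_
  rw [norm_mul, norm_zpow, one_pow, one_mul]
  push_cast
  gcongr
  exact norm_qPoch_le hq (by simp) _

theorem summable_companionTerm {q : ℂ} (hq0 : q ≠ 0) (hq : ‖q‖ < 1) :
    Summable (companionTerm q) := by
  obtain ⟨C, hC, hb⟩ := exists_norm_inv_qPoch_odd_le hq
  refine (summable_nat_add_iff 1).mp (Summable.of_norm_bounded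
    ((summable_companion_weight hq0 hq).mul_right C) fun n => ?_)
  rw [companionTerm_succ, norm_mul]
  gcongr
  exact hb _

/-- The `n`-th term of the Hecke-type series attached to the companion series. -/
noncomputable def companionAlpha (q : ℂ) (n : ℕ) : ℂ :=
  (-1) ^ n * (1 - q ^ n) * q ^ (n ^ 2 - n + tri (n + 1)) * partialTheta q n

theorem hasSum_companionAlpha {q : ℂ} (hq0 : q ≠ 0) (hq : ‖q‖ < 1) :
    HasSum (fun n : ℕ => companionAlpha q (n + 1))
      ((1 - ∑' n, companionTerm q n) * (qPochInf q q / (2 * qPochInf (-q) q))) := by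
  have h := (hasSum_bailey hq0 hq (summable_companion_weight hq0 hq)
    (hasSum_gamma_companion hq0 hq)).mul_left (-(qPochInf q q / (2 * qPochInf (-q) q)))
  simp_rw [← companionTerm_succ] at h
  have e := (summable_companionTerm hq0 hq).tsum_eq_zero_add
  have e0 : companionTerm q 0 = 1 := by simp [companionTerm, qPoch_zero]
  have e1 : ∑' n, companionTerm q (n + 1) = ∑' n, companionTerm q n - 1 := by
    rw [e, e0]; ring
  rw [e1] at h
  have e2 : -(qPochInf q q / (2 * qPochInf (-q) q)) * (∑' n, companionTerm q n - 1) =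
      (1 - ∑' n, companionTerm q n) * (qPochInf q q / (2 * qPochInf (-q) q)) := by ring
  rw [e2] at h
  refine h.congr_fun fun n => ?_
  have h1 := qPochInf_self_ne_zero hq
  have h2 : qPochInf (-q) q ≠ 0 :=
    qPochInf_ne_zero hq (one_sub_mul_pow_ne_zero (by simpa using hq) hq)
  have h3 := neg_qPoch_ne hq (n := n + 1) (by omega)
  rw [companionAlpha, baileyAlpha, mul_comm 2 (n + 1), pow_mul]
  have e3 : q ^ (((n + 1 : ℕ) : ℤ) ^ 2 - (n + 1 : ℕ) + tri ((n + 1 : ℕ) + 1)) =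
      q ^ (((n + 1 : ℕ) : ℤ) ^ 2 - (n + 1 : ℕ)) * q ^ tri (n + 2) := by
    rw [← zpow_add₀ hq0]; push_cast; rw [show (n : ℤ) + 1 + 1 = n + 2 by ring]
  rw [e3]
  field_simp
  ring

/-! ### Hecke-type double sums -/

theorem norm_heckeTerm_le {a b c : ℤ} (hb : 0 ≤ b) {x y q : ℂ} {A : ℝ} (hq0 : q ≠ 0)
    (hq : ‖q‖ < 1) (hx : ‖x‖ ≤ A) (hx' : ‖x⁻¹‖ ≤ A) (hy : ‖y‖ ≤ A) (hy' : ‖y⁻¹‖ ≤ A)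
    (p : ℤ × ℤ) : ‖heckeTerm a b c x y q p‖ ≤
      (A ^ p.1.natAbs * ‖(q ^ a) ^ tri p.1‖) * (A ^ p.2.natAbs * ‖(q ^ c) ^ tri p.2‖) := by
  have hA : 0 ≤ A := (norm_nonneg _).trans hx
  unfold heckeTerm
  split_ifs with h
  · have h1 : ‖(sg p.1 : ℂ)‖ = 1 := by unfold sg; split_ifs <;> simp
    have hrs : 0 ≤ p.1 * p.2 := by
      unfold sg at h
      split_ifs at h <;> first | positivity | nlinarith
    have hm : ‖q ^ (b * p.1 * p.2)‖ ≤ 1 := by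
      rw [norm_zpow]
      refine zpow_le_one₀ (norm_pos_iff.mpr hq0) hq.le ?_
      rw [mul_assoc]; positivity
    change ‖(sg p.1 : ℂ) * (-1) ^ (p.1 + p.2) * x ^ p.1 * y ^ p.2 *
      q ^ (a * tri p.1 + b * p.1 * p.2 + c * tri p.2)‖ ≤ _
    rw [zpow_add₀ hq0, zpow_add₀ hq0, zpow_mul, zpow_mul q c]
    simp only [norm_mul] at hm ⊢
    rw [h1, norm_neg_one_zpow, one_mul, one_mul]
    calc _ = ‖x ^ p.1‖ * ‖(q ^ a) ^ tri p.1‖ * (‖y ^ p.2‖ * ‖(q ^ c) ^ tri p.2‖) *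
          ‖q ^ (b * p.1 * p.2)‖ := by ring
      _ ≤ A ^ p.1.natAbs * ‖(q ^ a) ^ tri p.1‖ * (A ^ p.2.natAbs * ‖(q ^ c) ^ tri p.2‖) * 1 := by
        gcongr
        · exact norm_zpow_le_pow_natAbs hx hx' _
        · exact norm_zpow_le_pow_natAbs hy hy' _
      _ = _ := mul_one _
  · rw [norm_zero]; positivity

theorem norm_zpow_lt_one {q : ℂ} (hq : ‖q‖ < 1) {a : ℤ} (ha : 0 < a) : ‖q ^ a‖ < 1 := by
  obtain ⟨n, rfl⟩ := Int.eq_ofNat_of_zero_le ha.le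
  rw [zpow_natCast]; exact norm_pow_lt_one hq (by omega)

theorem summable_prod_mul_real {ι κ : Type*} {f : ι → ℝ} {g : κ → ℝ} (hf : Summable f)
    (hg : Summable g) (hf0 : ∀ i, 0 ≤ f i) (hg0 : ∀ k, 0 ≤ g k) :
    Summable fun p : ι × κ => f p.1 * g p.2 :=
  hf.mul_of_nonneg hg hf0 hg0

theorem summable_hecke_majorant {a c : ℤ} (ha : 0 < a) (hc : 0 < c) {q : ℂ} {A : ℝ} (hA : 0 ≤ A)
    (hq0 : q ≠ 0) (hq : ‖q‖ < 1) : Summable fun p : ℤ × ℤ =>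
      (A ^ p.1.natAbs * ‖(q ^ a) ^ tri p.1‖) * (A ^ p.2.natAbs * ‖(q ^ c) ^ tri p.2‖) := by
  have h1 := summable_theta_majorant A (zpow_ne_zero a hq0) (norm_zpow_lt_one hq ha)
  have h2 := summable_theta_majorant A (zpow_ne_zero c hq0) (norm_zpow_lt_one hq hc)
  have h3 : ∀ b : ℤ, ∀ n : ℤ, 0 ≤ A ^ n.natAbs * ‖(q ^ b) ^ tri n‖ :=
    fun b n => mul_nonneg (pow_nonneg hA _) (norm_nonneg _)
  have h4 := h3 a
  have h5 := h3 c
  exact summable_prod_mul_real (f := fun n : ℤ => A ^ n.natAbs * ‖(q ^ a) ^ tri n‖)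
    (g := fun n : ℤ => A ^ n.natAbs * ‖(q ^ c) ^ tri n‖) h1 h2 h4 h5

theorem summable_heckeTerm {a b c : ℤ} (ha : 0 < a) (hb : 0 ≤ b) (hc : 0 < c) (x y : ℂ) {q : ℂ}
    (hq0 : q ≠ 0) (hq : ‖q‖ < 1) : Summable (heckeTerm a b c x y q) := by
  set A := max (max ‖x‖ ‖x⁻¹‖) (max ‖y‖ ‖y⁻¹‖)
  have hA : 0 ≤ A := (norm_nonneg x).trans ((le_max_left _ _).trans (le_max_left _ _))
  exact Summable.of_norm_bounded (summable_hecke_majorant ha hc hA hq0 hq)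
    (norm_heckeTerm_le hb hq0 hq ((le_max_left _ _).trans (le_max_left _ _))
      ((le_max_right _ _).trans (le_max_left _ _)) ((le_max_left _ _).trans (le_max_right _ _))
      ((le_max_right _ _).trans (le_max_right _ _)))

theorem heckeTerm_swap (a b c : ℤ) (x y q : ℂ) (p : ℤ × ℤ) :
    heckeTerm a b c x y q p.swap = heckeTerm c b a y x q p := by
  simp only [heckeTerm, Prod.fst_swap, Prod.snd_swap, eq_comm (a := sg p.2)]
  split_ifs with h
  · rw [h, add_comm p.2, show a * (p.2 * (p.2 - 1) / 2) + b * p.2 * p.1 +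
      c * (p.1 * (p.1 - 1) / 2) = c * (p.1 * (p.1 - 1) / 2) + b * p.1 * p.2 +
      a * (p.2 * (p.2 - 1) / 2) by ring]
    ring
  · rfl

theorem heckeF_swap (a b c : ℤ) (x y q : ℂ) : heckeF a b c x y q = heckeF c b a y x q := by
  unfold heckeF
  rw [← (Equiv.prodComm ℤ ℤ).tsum_eq]
  exact tsum_congr fun p => heckeTerm_swap a b c x y q p

/-- The summand of a Hecke-type double sum without the sign factor. -/
noncomputable def heckeWeight (a b c : ℤ) (x y q : ℂ) (r s : ℤ) : ℂ :=
  (-1) ^ (r + s) * x ^ r * y ^ s * q ^ (a * tri r + b * r * s + c * tri s)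

theorem heckeTerm_eq (a b c : ℤ) (x y q : ℂ) (p : ℤ × ℤ) : heckeTerm a b c x y q p =
    (if sg p.1 = sg p.2 then (sg p.1 : ℂ) else 0) * heckeWeight a b c x y q p.1 p.2 := by
  unfold heckeTerm heckeWeight tri
  split_ifs <;> ring

theorem heckeWeight_shift {x q : ℂ} (a b c : ℤ) (y : ℂ) (hq0 : q ≠ 0) (hx : x ≠ 0)
    (r s : ℤ) :
    -x * heckeWeight a b c (q ^ a * x) (q ^ b * y) q r s = heckeWeight a b c x y q (r + 1) s := by
  unfold heckeWeight
  have e : q ^ (a * tri (r + 1) + b * (r + 1) * s + c * tri s) =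
      q ^ (a * tri r + b * r * s + c * tri s) * (q ^ a) ^ r * (q ^ b) ^ s := by
    rw [← zpow_mul, ← zpow_mul, ← zpow_add₀ hq0, ← zpow_add₀ hq0, tri_add_one]
    congr 1; ring
  rw [e, mul_zpow, mul_zpow, zpow_add_one₀ hx, show r + 1 + s = r + s + 1 by ring,
    zpow_add_one₀ (by norm_num : (-1 : ℂ) ≠ 0)]
  ring

/-- Shifting the first summation index of a Hecke-type sum. -/
theorem heckeF_shift_left {a b c : ℤ} (ha : 0 < a) (hb : 0 ≤ b) (hc : 0 < c) {x y q : ℂ}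
    (hq0 : q ≠ 0) (hq : ‖q‖ < 1) (hx : x ≠ 0) (hy : y ≠ 0) :
    heckeF a b c x y q = theta y (q ^ c) - x * heckeF a b c (q ^ a * x) (q ^ b * y) q := by
  have h1 : HasSum (heckeTerm a b c x y q) (heckeF a b c x y q) :=
    (summable_heckeTerm ha hb hc x y hq0 hq).hasSum
  have h2 : HasSum (heckeTerm a b c (q ^ a * x) (q ^ b * y) q)
      (heckeF a b c (q ^ a * x) (q ^ b * y) q) :=
    (summable_heckeTerm ha hb hc _ _ hq0 hq).hasSum
  have h3 := (h2.mul_left (-x))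
  rw [← ((Equiv.subRight (1 : ℤ)).prodCongr (Equiv.refl ℤ)).hasSum_iff] at h3
  have h4 := h1.sub h3
  have h5 : HasSum (fun p : ℤ × ℤ => if p.1 = 0 then heckeWeight a b c x y q p.1 p.2 else 0)
      (heckeF a b c x y q - -x * heckeF a b c (q ^ a * x) (q ^ b * y) q) := by
    refine h4.congr_fun fun p => ?_
    obtain ⟨r, s⟩ := p
    simp only [Function.comp, Equiv.prodCongr_apply, Prod.map, Equiv.subRight_apply,
      Equiv.refl_apply, heckeTerm_eq]
    have := heckeWeight_shift a b c y hq0 hx (r - 1) s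
    rw [sub_add_cancel] at this
    rw [mul_left_comm, this, ← sub_mul]
    unfold sg
    rcases lt_trichotomy r 0 with h | rfl | h <;> rcases lt_or_ge s 0 with h' | h'
    · simp [h.not_ge, h'.not_ge, h.ne, (show ¬ (1 : ℤ) ≤ r by omega)]
    · simp [h.not_ge, h', h.ne, (show ¬ (1 : ℤ) ≤ r by omega)]
    · simp [h'.not_ge]
    · simp [h']
    · simp [h.le, h'.not_ge, h.ne', (show (1 : ℤ) ≤ r by omega)]
    · simp [h.le, h', h.ne', (show (1 : ℤ) ≤ r by omega)]
  have h6 := hasSum_theta (zpow_ne_zero c hq0) (norm_zpow_lt_one hq hc) hy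
  have h7 : HasSum (fun p : ℤ × ℤ => if p.1 = 0 then heckeWeight a b c x y q p.1 p.2 else 0)
      (theta y (q ^ c)) := by
    refine (Function.Injective.hasSum_iff (Prod.mk_right_injective (0 : ℤ)) ?_).mp
      (h6.congr_fun fun s => ?_)
    · rintro ⟨r, s⟩ hp
      have : r ≠ 0 := fun h => hp ⟨s, by rw [h]⟩
      simp [this]
    · simp [heckeWeight, zpow_mul]; ring
  have := h5.unique h7
  linear_combination this

/-- Shifting the second summation index of a Hecke-type sum. -/
theorem heckeF_shift_right {a b c : ℤ} (ha : 0 < a) (hb : 0 ≤ b) (hc : 0 < c) {x y q : ℂ}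
    (hq0 : q ≠ 0) (hq : ‖q‖ < 1) (hx : x ≠ 0) (hy : y ≠ 0) :
    heckeF a b c x y q = theta x (q ^ a) - y * heckeF a b c (q ^ b * x) (q ^ c * y) q := by
  rw [heckeF_swap a, heckeF_swap a, heckeF_shift_left hc hb ha hq0 hq hy hx]

/-! ### Hecke-type sums as single sums over partial theta sums -/

/-- As `s` runs through `0, …, n`, the number `tri (2 s - n)` takes each of the values `0, 1, 3,
…, n(n+1)/2` once. -/
theorem sum_pow_tri_reflect (q : ℂ) (n : ℕ) :
    ∑ s ∈ Finset.range (n + 1), q ^ (-tri (2 * s - n)) = partialTheta q (n + 1) := by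
  induction n with
  | zero => simp [partialTheta]
  | succ n ih =>
    rw [partialTheta_succ, ← ih, ← Finset.sum_range_reflect, Finset.sum_range_succ (n := n + 1)]
    congr 1
    · refine Finset.sum_congr rfl fun s hs => ?_
      have : s < n + 1 := Finset.mem_range.mp hs
      rw [← tri_one_sub]; congr 2
      congr 1; push_cast [show n + 1 + 1 - 1 - s = n + 1 - s by omega, Nat.cast_sub this.le]; ring
    · rw [← tri_one_sub]; congr 2
      congr 1; push_cast [show n + 1 + 1 - 1 - (n + 1) = 0 by omega]; simp; ring

theorem hasSum_antidiagonal {f : ℕ × ℕ → ℂ} {a : ℂ} (h : HasSum f a) :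
    HasSum (fun n => ∑ p ∈ Finset.HasAntidiagonal.antidiagonal n, f p) a := by
  rw [← Finset.HasAntidiagonal.sigmaAntidiagonalEquivProd.hasSum_iff] at h
  refine h.sigma fun n => ?_
  rw [← Finset.sum_coe_sort]
  exact hasSum_fintype _

theorem sum_antidiagonal_heckeWeight {q : ℂ} (hq0 : q ≠ 0) (a : ℤ) (n : ℕ) :
    ∑ p ∈ Finset.HasAntidiagonal.antidiagonal n, heckeWeight a (a + 2) a 1 q q p.1 p.2 =
      (-1) ^ n * q ^ (a * tri n + tri (n + 1)) * partialTheta q (n + 1) := by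
  rw [← sum_pow_tri_reflect, Finset.mul_sum, Finset.Nat.sum_antidiagonal_eq_sum_range_succ
    (fun i j => heckeWeight a (a + 2) a 1 q q i j), ← Finset.sum_range_reflect]
  refine Finset.sum_congr rfl fun s hs => ?_
  have hs' : s ≤ n := by simpa [Nat.lt_succ_iff] using hs
  have e1 : n + 1 - 1 - s = n - s := by omega
  have e2 : n - (n - s) = s := by omega
  rw [e1, e2, heckeWeight, one_zpow, mul_one, mul_assoc, ← zpow_add₀ hq0,
    mul_assoc ((-1 : ℂ) ^ n), ← zpow_add₀ hq0, show (((n - s : ℕ) : ℤ) + s) = n by omega, zpow_natCast]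
  congr 2
  push_cast [hs']
  have h1 := tri_add ((n : ℤ) - s) s
  have h2 := two_mul_tri (n : ℤ)
  have h3 := two_mul_tri ((n : ℤ) + 1)
  have h4 := two_mul_tri (2 * s - n : ℤ)
  rw [sub_add_cancel] at h1
  refine mul_left_cancel₀ (two_ne_zero) (?_ : (2 : ℤ) * _ = 2 * _)
  linear_combination -2 * a * h1 - h3 + h4

theorem sum_antidiagonal_heckeWeight_neg {q : ℂ} (hq0 : q ≠ 0) (a : ℤ) (n : ℕ) :
    ∑ p ∈ Finset.HasAntidiagonal.antidiagonal n,
      heckeWeight a (a + 2) a 1 q q (-(p.1 + 1)) (-(p.2 + 1)) =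
      (-1) ^ n * q ^ (a * tri (n + 3) + tri (n + 2)) * partialTheta q (n + 1) := by
  rw [← sum_pow_tri_reflect, Finset.mul_sum, Finset.Nat.sum_antidiagonal_eq_sum_range_succ
    (fun i j => heckeWeight a (a + 2) a 1 q q (-(i + 1)) (-(j + 1)))]
  refine Finset.sum_congr rfl fun s hs => ?_
  have hs' : s ≤ n := by simpa [Nat.lt_succ_iff] using hs
  rw [heckeWeight, one_zpow, mul_one, mul_assoc, ← zpow_add₀ hq0,
    mul_assoc ((-1 : ℂ) ^ n), ← zpow_add₀ hq0]
  push_cast [hs']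
  have e : (-1 : ℂ) ^ (-((s : ℤ) + 1) + -((n : ℤ) - s + 1)) = (-1) ^ n := by
    rw [show -((s : ℤ) + 1) + -((n : ℤ) - s + 1) = -(n + 2) by ring, zpow_neg,
      zpow_add₀ (by norm_num), zpow_natCast]
    norm_num
    rw [← inv_pow]; norm_num
  rw [e]
  congr 2
  have h1 := tri_add (-((s : ℤ) + 1)) (-((n : ℤ) - s + 1))
  have h2 := two_mul_tri (n + 3 : ℤ)
  have h3 := two_mul_tri (n + 2 : ℤ)
  have h4 := two_mul_tri (2 * s - n : ℤ)
  have h5 := two_mul_tri (-((s : ℤ) + 1) + -((n : ℤ) - s + 1))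
  refine mul_left_cancel₀ (two_ne_zero) (?_ : (2 : ℤ) * _ = 2 * _)
  linear_combination -2 * a * h1 - h3 + h4 + a * h5 - a * h2

theorem norm_heckeTerm_eq (a b c : ℤ) (x y q : ℂ) (p : ℤ × ℤ) : ‖heckeTerm a b c x y q p‖ =
    if sg p.1 = sg p.2 then ‖heckeWeight a b c x y q p.1 p.2‖ else 0 := by
  have h1 : ‖(sg p.1 : ℂ)‖ = 1 := by unfold sg; split_ifs <;> simp
  rw [heckeTerm_eq]
  split_ifs
  · rw [norm_mul, h1, one_mul]
  · simp

/-- A Hecke-type sum is the difference of its sums over the two quadrants of equal signs. -/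
theorem hasSum_heckeF_split {a b c : ℤ} (ha : 0 < a) (hb : 0 ≤ b) (hc : 0 < c) (x y : ℂ) {q : ℂ}
    (hq0 : q ≠ 0) (hq : ‖q‖ < 1) : ∃ u v : ℂ, heckeF a b c x y q = u - v ∧
      HasSum (fun p : ℕ × ℕ => heckeWeight a b c x y q p.1 p.2) u ∧
      HasSum (fun p : ℕ × ℕ => heckeWeight a b c x y q (-(p.1 + 1)) (-(p.2 + 1))) v := by
  have hs := summable_heckeTerm ha hb hc x y hq0 hq
  have hi1 : Function.Injective fun p : ℕ × ℕ => ((p.1 : ℤ), (p.2 : ℤ)) := by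
    rintro ⟨a, b⟩ ⟨c, d⟩ h; simpa using h
  have hi2 : Function.Injective fun p : ℕ × ℕ => (-((p.1 : ℤ) + 1), -((p.2 : ℤ) + 1)) := by
    rintro ⟨a, b⟩ ⟨c, d⟩ h; simpa using h
  let f1 : ℤ × ℤ → ℂ := fun p =>
    if 0 ≤ p.1 ∧ 0 ≤ p.2 then heckeWeight a b c x y q p.1 p.2 else 0
  let f2 : ℤ × ℤ → ℂ := fun p =>
    if p.1 < 0 ∧ p.2 < 0 then heckeWeight a b c x y q p.1 p.2 else 0
  have hs1 : Summable f1 := by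
    refine Summable.of_norm_bounded hs.norm fun p => ?_
    rw [norm_heckeTerm_eq]
    by_cases h : 0 ≤ p.1 ∧ 0 ≤ p.2
    · simp [f1, h, sg]
    · simp only [f1, h, if_false, norm_zero]; positivity
  have hs2 : Summable f2 := by
    refine Summable.of_norm_bounded hs.norm fun p => ?_
    rw [norm_heckeTerm_eq]
    by_cases h : p.1 < 0 ∧ p.2 < 0
    · simp [f2, h, sg, h.1.not_ge, h.2.not_ge]
    · simp only [f2, h, if_false, norm_zero]; positivity
  refine ⟨∑' p, f1 p, ∑' p, f2 p, ?_, ?_, ?_⟩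
  · rw [← hs1.tsum_sub hs2, heckeF]
    refine tsum_congr fun p => ?_
    rw [heckeTerm_eq]
    rcases le_or_gt 0 p.1 with hr | hr <;> rcases le_or_gt 0 p.2 with hs' | hs'
    · simp [f1, f2, sg, hr, hs', hr.not_gt]
    · simp [f1, f2, sg, hr, hs', hr.not_gt, hs'.not_ge]
    · simp [f1, f2, sg, hr, hs', hr.not_ge, hs'.not_gt]
    · simp [f1, f2, sg, hr, hs', hr.not_ge, hs'.not_ge]
  · refine ((hi1.hasSum_iff (f := f1) ?_).mpr hs1.hasSum).congr_fun fun p => ?_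
    · intro p hp
      refine if_neg fun h => hp ⟨(p.1.toNat, p.2.toNat), ?_⟩
      ext <;> simp [h.1, h.2]
    · simp [f1]
  · refine ((hi2.hasSum_iff (f := f2) ?_).mpr hs2.hasSum).congr_fun fun p => ?_
    · intro p hp
      refine if_neg fun h => hp ⟨((-p.1 - 1).toNat, (-p.2 - 1).toNat), ?_⟩
      ext <;> simp <;> omega
    · have h1 : -((p.1 : ℤ) + 1) < 0 := by omega
      have h2 : -((p.2 : ℤ) + 1) < 0 := by omega
      simp only [f2, Function.comp, h1, h2, and_self, if_true]

theorem summable_neg_one_pow_tri {q : ℂ} (hq0 : q ≠ 0) (hq : ‖q‖ < 1) {a : ℤ} (ha : 0 < a) :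
    Summable fun n : ℕ => (-1 : ℂ) ^ n * q ^ (a * tri n) := by
  refine Summable.of_norm_bounded (summable_pow_mul_pow_tri 1 (norm_pos_iff.mpr
    (zpow_ne_zero a hq0)) (norm_zpow_lt_one hq ha)) fun n => ?_
  simp [zpow_mul]

/-- The double sums with exponent `a tri r + (a+2) r s + a tri s + s`, grouped by `n = r + s`. -/
theorem hasSum_heckeF {q : ℂ} (hq0 : q ≠ 0) (hq : ‖q‖ < 1) {a : ℤ} (ha : 0 < a) :
    HasSum (fun n : ℕ => (-1) ^ (n + 1) * (q ^ (a * tri (n + 1) + tri (n + 2)) -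
        q ^ (a * tri (n + 2) + tri (n + 1))) * partialTheta q (n + 1))
      (heckeF a (a + 2) a 1 q q) := by
  obtain ⟨u, v, huv, hu, hv⟩ := hasSum_heckeF_split ha (b := a + 2) (by omega) ha 1 q hq0 hq
  have hu' := hasSum_antidiagonal hu
  have hv' := hasSum_antidiagonal hv
  simp_rw [sum_antidiagonal_heckeWeight hq0] at hu'
  simp_rw [sum_antidiagonal_heckeWeight_neg hq0] at hv'
  -- The stated summand has `s_{n+1}` in both parts where the quadrants give `s_{n+2}` and `s_n`; the
  -- two corrections are tails of the same series `U`.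
  have hU := (summable_neg_one_pow_tri hq0 hq ha).hasSum
  set U := ∑' n : ℕ, (-1 : ℂ) ^ n * q ^ (a * tri n)
  have hU1 := (hasSum_nat_add_iff' 1).mpr hU
  have hU2 := (hasSum_nat_add_iff' 2).mpr hU
  have hu1 := (hasSum_nat_add_iff' 1).mpr hu'
  have hv1 : HasSum (fun n : ℕ => (-1) ^ (n + 1) * q ^ (a * tri (n + 2) + tri (n + 1)) *
      partialTheta q n) v := by
    refine (hasSum_nat_add_iff' 1).mp ?_
    have h0 : partialTheta q 0 = 0 := by simp [partialTheta]
    rw [Finset.sum_range_one, h0, mul_zero, sub_zero]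
    refine hv'.congr_fun fun n => ?_
    push_cast
    rw [show (n : ℤ) + 1 + 2 = n + 3 by ring, show (n : ℤ) + 1 + 1 = n + 2 by ring, pow_succ, pow_succ]
    ring
  have h := ((hu1.sub hU1).sub hv1).add hU2
  have e : u - ∑ i ∈ Finset.range 1, (-1) ^ i * q ^ (a * tri i + tri (i + 1)) *
        partialTheta q (i + 1) - (U - ∑ i ∈ Finset.range 1, (-1 : ℂ) ^ i * q ^ (a * tri i)) - v +
      (U - ∑ i ∈ Finset.range 2, (-1 : ℂ) ^ i * q ^ (a * tri i)) = heckeF a (a + 2) a 1 q q := by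
    rw [huv]
    simp [Finset.sum_range_succ, partialTheta]
    ring
  rw [e] at h
  refine h.congr_fun fun n => ?_
  have e1 : q ^ (a * tri (n + 1) + tri (n + 2)) * q ^ (-tri (n + 2)) = q ^ (a * tri (n + 1)) := by
    rw [← zpow_add₀ hq0]; congr 1; ring
  have e2 : q ^ (a * tri (n + 2) + tri (n + 1)) * q ^ (-tri (n + 1)) = q ^ (a * tri (n + 2)) := by
    rw [← zpow_add₀ hq0]; congr 1; ring
  rw [partialTheta_succ q (n + 1), partialTheta_succ q n]
  push_cast
  rw [show (n : ℤ) + 1 + 1 = n + 2 by ring, pow_add _ n 2, pow_succ (-1 : ℂ) n]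
  linear_combination (-1 : ℂ) ^ n * e1 + (-1 : ℂ) ^ n * e2

/-! ### Euler's pentagonal number theorem and Gauss's square identity -/

theorem qPoch_trisect (x q : ℂ) (n : ℕ) : qPoch x q (n * 3) =
    qPoch x (q ^ 3) n * qPoch (x * q) (q ^ 3) n * qPoch (x * q ^ 2) (q ^ 3) n := by
  induction n with
  | zero => simp [qPoch]
  | succ n ih =>
    rw [show (n + 1) * 3 = n * 3 + 1 + 1 + 1 by ring, qPoch_succ, qPoch_succ, qPoch_succ, ih,
      qPoch_succ, qPoch_succ, qPoch_succ, ← pow_mul, mul_comm 3 n]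
    ring

theorem qPochInf_trisect (x : ℂ) {q : ℂ} (hq : ‖q‖ < 1) : qPochInf x q =
    qPochInf x (q ^ 3) * qPochInf (x * q) (q ^ 3) * qPochInf (x * q ^ 2) (q ^ 3) := by
  have h3 := norm_pow_lt_one hq (n := 3) (by norm_num)
  have h := (tendsto_qPoch x hq).comp (tendsto_id.atTop_mul_const' (r := 3) (by norm_num))
  refine tendsto_nhds_unique h ((((tendsto_qPoch x h3).mul (tendsto_qPoch (x * q) h3)).mul
    (tendsto_qPoch (x * q ^ 2) h3)).congr fun n => ?_)
  exact (qPoch_trisect x q n).symm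

theorem theta_self_cube {q : ℂ} (hq0 : q ≠ 0) (hq : ‖q‖ < 1) :
    theta q (q ^ 3) = qPochInf q q := by
  rw [qPochInf_trisect q hq, theta, show q ^ 3 / q = q * q by field_simp,
    show q * q ^ 2 = q ^ 3 by ring]

theorem theta_self_sq {q : ℂ} (hq0 : q ≠ 0) (hq : ‖q‖ < 1) :
    theta q (q ^ 2) * qPochInf (-q) q = qPochInf q q := by
  have h1 := qPochInf_dissect q hq
  have h2 := qPochInf_sq q hq
  rw [← sq] at h1
  have h3 := qPochInf_self_ne_zero hq
  rw [theta, show q ^ 2 / q = q by field_simp]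
  refine mul_left_cancel₀ h3 ?_
  linear_combination -(qPochInf q q + qPochInf q (q ^ 2) * qPochInf (q ^ 2) (q ^ 2)) * h1 -
    (qPochInf q (q ^ 2) ^ 2 * qPochInf (q ^ 2) (q ^ 2)) * h2

theorem qPochInf_neg_self_ne_zero {q : ℂ} (hq : ‖q‖ < 1) : qPochInf (-q) q ≠ 0 :=
  qPochInf_ne_zero hq (one_sub_mul_pow_ne_zero (by rwa [norm_neg]) hq)

/-- The pentagonal number theorem, with the terms of opposite indices paired; the index `0` is
counted twice. -/
theorem hasSum_pentagonal {q : ℂ} (hq0 : q ≠ 0) (hq : ‖q‖ < 1) :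
    HasSum (fun n : ℕ => (-1) ^ n * q ^ (3 * tri n + n) + (-1) ^ n * q ^ (3 * tri n + 2 * n))
      (qPochInf q q + 1) := by
  have h := (hasSum_theta (pow_ne_zero 3 hq0) (norm_pow_lt_one hq (by norm_num)) hq0).nat_add_neg
  rw [theta_self_cube hq0 hq] at h
  simp only [tri_zero, zpow_zero, mul_one] at h
  refine h.congr_fun fun n => ?_
  rw [zpow_neg, zpow_natCast, ← inv_pow, inv_neg_one, ← zpow_natCast q 3, ← zpow_mul, ← zpow_mul,
    mul_assoc, mul_assoc, ← zpow_add₀ hq0, ← zpow_add₀ hq0, tri_neg]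
  congr 3
  push_cast; ring

/-- Gauss's identity `∑_{n ∈ ℤ} (-1)^n q^{n^2} = (q)_∞ / (-q)_∞`, with the terms of opposite
indices paired. -/
theorem hasSum_gauss {q : ℂ} (hq0 : q ≠ 0) (hq : ‖q‖ < 1) :
    HasSum (fun n : ℕ => 2 * ((-1) ^ (n + 1) * q ^ ((n + 1) ^ 2)))
      (qPochInf q q / qPochInf (-q) q - 1) := by
  have h := (hasSum_theta (pow_ne_zero 2 hq0) (norm_pow_lt_one hq (by norm_num)) hq0).nat_add_neg
  have h' := theta_self_sq hq0 hq
  rw [← eq_div_iff (qPochInf_neg_self_ne_zero hq)] at h'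
  rw [h'] at h
  have h2 := (hasSum_nat_add_iff' 1).mpr h
  simp only [tri_zero, zpow_zero, mul_one, Finset.sum_range_one, Nat.cast_zero, neg_zero] at h2
  rw [show qPochInf q q / qPochInf (-q) q - 1 =
    qPochInf q q / qPochInf (-q) q + 1 - (1 + 1) by ring]
  refine h2.congr_fun fun n => ?_
  rw [zpow_neg, zpow_natCast, ← inv_pow, inv_neg_one, ← zpow_natCast q 2, ← zpow_mul, ← zpow_mul,
    mul_assoc, mul_assoc, ← zpow_add₀ hq0, ← zpow_add₀ hq0, tri_neg, ← zpow_natCast q ((n + 1) ^ 2)]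
  have := two_mul_tri ((n + 1 : ℕ) : ℤ)
  rw [show (((2 : ℕ) : ℤ) * tri (n + 1 : ℕ) + (n + 1 : ℕ)) = ((n + 1) ^ 2 : ℕ) by
    push_cast at this ⊢; linear_combination this, show (((2 : ℕ) : ℤ) * (tri (n + 1 : ℕ) +
      (n + 1 : ℕ)) + -(n + 1 : ℕ)) = ((n + 1) ^ 2 : ℕ) by
    push_cast at this ⊢; linear_combination this]
  ring

/-! ### The Hecke-type representations -/

theorem heckeF_353_one {q : ℂ} (hq0 : q ≠ 0) (hq : ‖q‖ < 1) :
    heckeF 3 5 3 1 q q = -(qPochInf q q * psi q) := by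
  refine (hasSum_heckeF hq0 hq (a := 3) (by norm_num)).unique
    ((hasSum_psiHeckeTerm hq0 hq).congr_fun fun n => ?_)
  have h1 := two_mul_tri ((n : ℤ) + 1)
  have h2 := tri_add_one ((n : ℤ) + 1)
  rw [show (n : ℤ) + 1 + 1 = n + 2 by ring] at h2
  rw [psiHeckeTerm, partialTheta, show 3 * tri (n + 2) + tri (n + 1) =
    (2 * (n + 1 : ℕ) : ℕ) + (2 * ((n + 1 : ℕ) : ℤ) ^ 2 - (n + 1 : ℕ)) by
      push_cast; linear_combination 3 * h2 + 2 * h1,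
    show 3 * tri (n + 1) + tri (n + 2) = 2 * ((n + 1 : ℕ) : ℤ) ^ 2 - (n + 1 : ℕ) by
      push_cast; linear_combination h2 + 2 * h1, zpow_add₀ hq0, zpow_natCast]
  ring

theorem heckeF_353_shift {q : ℂ} (hq0 : q ≠ 0) (hq : ‖q‖ < 1) :
    heckeF 3 5 3 1 q q = -(q * heckeF 3 5 3 (q ^ 4) (q ^ 5) q) := by
  have h3 := norm_pow_lt_one hq (n := 3) (by norm_num)
  rw [heckeF_shift_right (by norm_num) (by norm_num) (by norm_num) hq0 hq one_ne_zero hq0,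
    zpow_ofNat, zpow_ofNat, theta_eq_zero_one _ h3, heckeF_swap 3 5 3 (q ^ 4), mul_one,
    ← pow_succ]
  ring

theorem heckeF_121_eq (q : ℂ) : heckeF 1 2 1 q 1 (q ^ 2) = heckeF 2 4 2 1 q q := by
  rw [heckeF_swap]
  unfold heckeF
  refine tsum_congr fun p => ?_
  rw [heckeTerm_eq, heckeTerm_eq, heckeWeight, heckeWeight, ← zpow_natCast q 2, ← zpow_mul]
  congr 3
  push_cast; ring

theorem heckeF_121 {q : ℂ} (hq0 : q ≠ 0) (hq : ‖q‖ < 1) : heckeF 1 2 1 q 1 (q ^ 2) =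
    (1 - ∑' n, companionTerm q n) * (qPochInf q q / (2 * qPochInf (-q) q)) := by
  rw [heckeF_121_eq]
  refine (hasSum_heckeF hq0 hq (a := 2) (by norm_num)).unique
    ((hasSum_companionAlpha hq0 hq).congr_fun fun n => ?_)
  have h1 := two_mul_tri ((n : ℤ) + 1)
  have h2 := tri_add_one ((n : ℤ) + 1)
  rw [show (n : ℤ) + 1 + 1 = n + 2 by ring] at h2
  rw [companionAlpha, show 2 * tri (n + 2) + tri (n + 1) =
    (n + 1 : ℕ) + (2 * tri (n + 1) + tri (n + 2)) by
      push_cast; linear_combination h2, show 2 * tri (n + 1) + tri (n + 2) =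
      ((n + 1 : ℕ) : ℤ) ^ 2 - (n + 1 : ℕ) + tri ((n + 1 : ℕ) + 1) by
      push_cast; rw [show (n : ℤ) + 1 + 1 = n + 2 by ring]; linear_combination h1,
      zpow_add₀ hq0 ((n + 1 : ℕ) : ℤ), zpow_natCast]
  ring

theorem etaJ_one (q : ℂ) : etaJ 1 q = qPochInf q q := by simp [etaJ]

theorem etaJ_two_div {q : ℂ} (hq : ‖q‖ < 1) :
    etaJ 2 q / etaJ 1 q ^ 2 = qPochInf (-q) q / qPochInf q q := by
  have h := qPochInf_sq q hq
  have h3 := qPochInf_self_ne_zero hq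
  rw [etaJ_one, etaJ, zpow_ofNat, h]
  field_simp

theorem companion_eq_heckeF {q : ℂ} (hq0 : q ≠ 0) (hq : ‖q‖ < 1) :
    (∑' n : ℕ, companionTerm q n) =
      1 - 2 * (etaJ 2 q / etaJ 1 q ^ 2) * heckeF 1 2 1 q 1 (q ^ 2) := by
  rw [heckeF_121 hq0 hq, etaJ_two_div hq]
  have h1 := qPochInf_self_ne_zero hq
  have h2 := qPochInf_neg_self_ne_zero hq
  field_simp
  ring

/-- The squares appearing here sum to the theta series of Gauss's identity. -/
theorem companionHeckeTerm_eq {q : ℂ} (hq0 : q ≠ 0) (n : ℕ) :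
    companionHeckeTerm q n = (-1) ^ n * q ^ (n ^ 2) - companionAlpha q n := by
  have h1 := two_mul_tri (n : ℤ)
  have h2 := tri_add_one (n : ℤ)
  have e : (3 * (n : ℤ) ^ 2 - n) / 2 = n ^ 2 - n + tri (n + 1) :=
    Int.ediv_eq_of_eq_mul_right (by norm_num) (by linear_combination -2 * h2 - h1)
  have e2 : q ^ ((n : ℤ) ^ 2 - n + tri (n + 1)) * q ^ (-tri (n + 1)) * q ^ n = q ^ (n ^ 2) := by
    rw [← zpow_natCast, ← zpow_natCast, ← zpow_add₀ hq0, ← zpow_add₀ hq0]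
    congr 1; push_cast; ring
  have h3 := partialTheta_succ q n
  rw [companionHeckeTerm, companionAlpha, e, ← tri_succ_eq,
    show ∑ j ∈ Finset.range (n + 1), q ^ (-((j : ℤ) * (j + 1) / 2)) = partialTheta q (n + 1)
      from rfl, h3]
  linear_combination (-1) ^ n * e2

theorem hasSum_companionHeckeTerm {q : ℂ} (hq0 : q ≠ 0) (hq : ‖q‖ < 1) :
    HasSum (fun n : ℕ => companionHeckeTerm q (n + 1))
      ((∑' n, companionTerm q n) * (qPochInf q q / (2 * qPochInf (-q) q)) - 1 / 2) := by
  have h := ((hasSum_gauss hq0 hq).mul_left (1 / 2)).sub (hasSum_companionAlpha hq0 hq)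
  have e : 1 / 2 * (qPochInf q q / qPochInf (-q) q - 1) -
      (1 - ∑' n, companionTerm q n) * (qPochInf q q / (2 * qPochInf (-q) q)) =
      (∑' n, companionTerm q n) * (qPochInf q q / (2 * qPochInf (-q) q)) - 1 / 2 := by
    have h2 := qPochInf_neg_self_ne_zero hq
    field_simp
    ring
  rw [e] at h
  refine h.congr_fun fun n => ?_
  rw [companionHeckeTerm_eq hq0]
  ring

theorem companion_eq_tsum {q : ℂ} (hq0 : q ≠ 0) (hq : ‖q‖ < 1) :
    (∑' n : ℕ, companionTerm q n) = qPochInf (-q) q / qPochInf q q *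
        (1 + 2 * ∑' n : ℕ, companionHeckeTerm q (n + 1)) := by
  rw [(hasSum_companionHeckeTerm hq0 hq).tsum_eq]
  have h1 := qPochInf_self_ne_zero hq
  have h2 := qPochInf_neg_self_ne_zero hq
  field_simp
  ring

/-! ### Comparison of the three single-sum representations -/

theorem summable_sign_mul_partialTheta {q : ℂ} (hq0 : q ≠ 0) (hq : ‖q‖ < 1) {k : ℕ → ℤ}
    (hk : ∀ n : ℕ, 2 * tri n ≤ k n) :
    Summable fun n : ℕ => (-1) ^ n * q ^ k n * partialTheta q n := by
  refine Summable.of_norm_bounded (summable_nat_mul_tri hq0 hq) fun n => ?_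
  have hp := norm_pos_iff.mpr hq0
  rw [norm_mul, norm_mul, norm_pow, norm_neg, norm_one, one_pow, one_mul, norm_zpow]
  calc _ ≤ ‖q‖ ^ (2 * tri n) * (n * ‖q‖ ^ (-tri n)) := by
        refine mul_le_mul (zpow_le_zpow_right_of_le_one₀ hp hq.le (hk n))
          (norm_partialTheta_le hq0 hq n) (norm_nonneg _) (by positivity)
    _ = _ := by
      rw [mul_left_comm, ← zpow_add₀ hp.ne']
      congr 2; ring

theorem summable_sign_mul_tri {q : ℂ} (hq0 : q ≠ 0) (hq : ‖q‖ < 1) {k : ℕ → ℤ}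
    (hk : ∀ n : ℕ, tri n ≤ k n) : Summable fun n : ℕ => (-1) ^ n * q ^ k n := by
  refine Summable.of_norm_bounded (summable_pow_mul_pow_tri 1 (norm_pos_iff.mpr hq0) hq)
    fun n => ?_
  rw [norm_mul, norm_pow, norm_neg, norm_one, one_pow, one_mul, norm_zpow, one_mul]
  exact zpow_le_zpow_right_of_le_one₀ (norm_pos_iff.mpr hq0) hq.le (hk n)

theorem sum_Icc_neg_eq (q : ℂ) (n : ℕ) : ∑ j ∈ Finset.Icc (-(n : ℤ)) n, q ^ (-(j * (j + 1) / 2)) =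
    partialTheta q n + partialTheta q (n + 1) := by
  induction n with
  | zero => simp [partialTheta]
  | succ n ih =>
    have e : Finset.Icc (-((n + 1 : ℕ) : ℤ)) (n + 1 : ℕ) =
        insert (-((n : ℤ) + 1)) (insert ((n : ℤ) + 1) (Finset.Icc (-(n : ℤ)) n)) := by
      ext j; simp only [Finset.mem_insert, Finset.mem_Icc]; push_cast; omega
    rw [e, Finset.sum_insert, Finset.sum_insert, ih, partialTheta_succ q (n + 1),
      partialTheta_succ q n, ← tri_succ_eq, ← tri_succ_eq,
      show -((n : ℤ) + 1) + 1 = 1 - (n + 1) by ring, tri_one_sub]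
    · push_cast; ring
    · simp
    · simp only [Finset.mem_insert, Finset.mem_Icc]; omega

/-- With `v = ∑ (-1)^n q^{2n^2-n} s_n` and `w = ∑ (-1)^n q^{2n^2+n} s_n`, where `s_n` are the
partial theta sums, the three series are combinations of `v`, `w` and the pentagonal series. -/
theorem hasSum_single_sums {q : ℂ} (hq0 : q ≠ 0) (hq : ‖q‖ < 1) : ∃ v w : ℂ,
    HasSum (fun n : ℕ => psiHeckeTerm q (n + 1)) (v - w) ∧
    HasSum (andrewsTerm q) (w - v + qPochInf q q) ∧
    HasSum (mortensonTerm q) (2 * w - 2 * v + qPochInf q q) := by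
  have t0 : ∀ n : ℕ, 0 ≤ tri n := fun n => tri_nonneg n
  have hv := (summable_sign_mul_partialTheta hq0 hq (k := fun n => 4 * tri n + n)
    fun n => by have := t0 n; omega).hasSum
  have hw := (summable_sign_mul_partialTheta hq0 hq (k := fun n => 4 * tri n + 3 * n)
    fun n => by have := t0 n; omega).hasSum
  have hp := (summable_sign_mul_tri hq0 hq (k := fun n => 3 * tri n + n)
    fun n => by have := t0 n; omega).hasSum
  have hr := (summable_sign_mul_tri hq0 hq (k := fun n => 3 * tri n + 2 * n)
    fun n => by have := t0 n; omega).hasSum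
  simp only at hv hw hp hr
  set v := ∑' n : ℕ, (-1) ^ n * q ^ (4 * tri n + n) * partialTheta q n
  set w := ∑' n : ℕ, (-1) ^ n * q ^ (4 * tri n + 3 * n) * partialTheta q n
  set P := ∑' n : ℕ, (-1) ^ n * q ^ (3 * tri n + n)
  set R := ∑' n : ℕ, (-1) ^ n * q ^ (3 * tri n + 2 * n)
  have hPR : P + R = qPochInf q q + 1 := (hp.add hr).unique (hasSum_pentagonal hq0 hq)
  have s0 : partialTheta q 0 = 0 := by simp [partialTheta]
  have s1 : partialTheta q 1 = 1 := by simp [partialTheta]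
  have hv1 := (hasSum_nat_add_iff' 1).mpr hv
  have hv2 := (hasSum_nat_add_iff' 2).mpr hv
  have hw1 := (hasSum_nat_add_iff' 1).mpr hw
  have hp1 := (hasSum_nat_add_iff' 1).mpr hp
  have hp2 := (hasSum_nat_add_iff' 2).mpr hp
  simp only [Finset.sum_range_succ, Finset.sum_range_zero, s0, s1, mul_zero, add_zero, sub_zero,
    Nat.cast_zero, Nat.cast_one, tri_zero, tri_one, pow_zero, zpow_zero, mul_one, pow_one,
    zero_add, zpow_one] at hv1 hv2 hw1 hp1 hp2
  have T1 : ∀ n : ℕ, tri ((n + 1 : ℕ) : ℤ) = tri n + n := fun n => by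
    push_cast; exact tri_add_one n
  have T2 : ∀ n : ℕ, tri ((n + 2 : ℕ) : ℤ) = tri n + 2 * n + 1 := fun n => by
    rw [show n + 2 = n + 1 + 1 from rfl, T1, T1]; push_cast; ring
  have S : ∀ n : ℕ, ∑ j ∈ Finset.range (n + 1), q ^ (-((j : ℤ) * (j + 1) / 2)) =
    partialTheta q (n + 1) := fun _ => rfl
  refine ⟨v, w, ?_, ?_, ?_⟩
  · refine (hv1.sub hw1).congr_fun fun n => ?_
    rw [psiHeckeTerm, S]
    have := two_mul_tri ((n + 1 : ℕ) : ℤ)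
    have e1 : q ^ (4 * tri (n + 1 : ℕ) + (n + 1 : ℕ)) =
        q ^ (2 * ((n + 1 : ℕ) : ℤ) ^ 2 - (n + 1 : ℕ)) := by
      congr 1; linear_combination 2 * this
    have e2 : q ^ (4 * tri (n + 1 : ℕ) + 3 * (n + 1 : ℕ)) =
        q ^ (2 * ((n + 1 : ℕ) : ℤ) ^ 2 - (n + 1 : ℕ)) * q ^ (2 * (n + 1)) := by
      rw [← zpow_natCast, ← zpow_add₀ hq0]
      congr 1; push_cast at this ⊢; linear_combination 2 * this
    rw [e1, e2]
    ring
  · have h := ((hw.sub hv2).add hr).add hp2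
    have e : w - (v - -1 * q) + R + (P - (1 + -1 * q)) = w - v + qPochInf q q := by
      linear_combination hPR
    rw [e] at h
    refine h.congr_fun fun n => ?_
    have := two_mul_tri (n : ℤ)
    rw [andrewsTerm, S, partialTheta_succ q (n + 1), partialTheta_succ q n, T2]
    have a1 : q ^ (2 * n ^ 2 + n) = q ^ (4 * tri n + 3 * n) := by
      rw [← zpow_natCast]; congr 1; push_cast; linear_combination -2 * this
    have a2 : q ^ (2 * n ^ 2 + n) * q ^ (6 * n + 6) =
        q ^ (4 * (tri n + 2 * n + 1) + (n + 2 : ℕ)) := by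
      rw [a1, ← zpow_natCast, ← zpow_add₀ hq0]; congr 1; push_cast; ring
    have a3 : q ^ (4 * (tri n + 2 * n + 1) + (n + 2 : ℕ)) * q ^ (-tri ((n + 1 : ℕ) + 1)) =
        q ^ (3 * (tri n + 2 * n + 1) + (n + 2 : ℕ)) := by
      rw [← zpow_add₀ hq0, tri_add_one, T1]; congr 1; push_cast; ring
    have a4 : q ^ (4 * tri n + 3 * n) * q ^ (-tri (n + 1)) = q ^ (3 * tri n + 2 * n) := by
      rw [← zpow_add₀ hq0, tri_add_one]; congr 1; ring
    rw [mul_sub, mul_one, mul_assoc ((-1 : ℂ) ^ n), a2, a1, pow_add _ n 2]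
    linear_combination (-1 : ℂ) ^ n * a4 + (-1 : ℂ) ^ n * a3
  · have h := (((hw.mul_left 2).sub (hv1.mul_left 2)).add hr).add hp1
    have e : 2 * w - 2 * v + R + (P - 1) = 2 * w - 2 * v + qPochInf q q := by
      linear_combination hPR
    rw [e] at h
    refine h.congr_fun fun n => ?_
    have := two_mul_tri (n : ℤ)
    rw [mortensonTerm, sum_Icc_neg_eq, partialTheta_succ q n, T1]
    have a1 : q ^ (2 * n ^ 2 + n) = q ^ (4 * tri n + 3 * n) := by
      rw [← zpow_natCast]; congr 1; push_cast; linear_combination -2 * this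
    have a2 : q ^ (2 * n ^ 2 + n) * q ^ (2 * n + 1) =
        q ^ (4 * (tri n + n) + (n + 1 : ℕ)) := by
      rw [a1, ← zpow_natCast, ← zpow_add₀ hq0]; congr 1; push_cast; ring
    have a3 : q ^ (4 * (tri n + n) + (n + 1 : ℕ)) * q ^ (-tri (n + 1)) =
        q ^ (3 * (tri n + n) + (n + 1 : ℕ)) := by
      rw [← zpow_add₀ hq0, tri_add_one]; congr 1; push_cast; ring
    have a4 : q ^ (4 * tri n + 3 * n) * q ^ (-tri (n + 1)) = q ^ (3 * tri n + 2 * n) := by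
      rw [← zpow_add₀ hq0, tri_add_one]; congr 1; ring
    rw [mul_add ((-1 : ℂ) ^ n * _), mul_one, mul_assoc ((-1 : ℂ) ^ n), a2, a1, pow_succ _ n]
    linear_combination (-1 : ℂ) ^ n * a4 - (-1 : ℂ) ^ n * a3

/-! ### Holomorphic functions on the punctured plane -/

/-- A holomorphic function on the punctured plane that is invariant under multiplication by `Q`
descends to the compact torus `ℂˣ / Q^ℤ`, hence is constant. -/
theorem eq_of_mul_invariant {F : ℂ → ℂ} (hF : DifferentiableOn ℂ F {0}ᶜ) {Q : ℂ} (hQ0 : Q ≠ 0)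
    (hQ : ‖Q‖ < 1) (h : ∀ z, z ≠ 0 → F (Q * z) = F z) {z w : ℂ} (hz : z ≠ 0) (hw : w ≠ 0) :
    F z = F w := by
  have hp := norm_pos_iff.mpr hQ0
  have hZ : ∀ n : ℤ, ∀ z, z ≠ 0 → F (Q ^ n * z) = F z := by
    intro n
    induction n using Int.induction_on with
    | zero => simp
    | succ n ih =>
      intro z hz
      rw [zpow_add_one₀ hQ0, mul_assoc, ih _ (mul_ne_zero hQ0 hz), h z hz]
    | pred n ih =>
      intro z hz
      rw [← h _ (mul_ne_zero (zpow_ne_zero _ hQ0) hz), ← mul_assoc, ← zpow_one_add₀ hQ0,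
        show (1 : ℤ) + (-n - 1) = -n by ring, ih z hz]
  -- The closed annulus `‖Q‖ ≤ ‖z‖ ≤ 1` meets every orbit, so `F` is bounded; Liouville's theorem
  -- applies to `F ∘ exp`.
  set K : Set ℂ := Metric.closedBall 0 1 ∩ (Metric.ball 0 ‖Q‖)ᶜ with hK
  have hKc : IsCompact K := (isCompact_closedBall _ _).inter_right Metric.isOpen_ball.isClosed_compl
  have hK0 : K ⊆ {0}ᶜ := by
    rintro z ⟨-, hz⟩ rfl
    exact hz (Metric.mem_ball_self hp)
  obtain ⟨C, hC⟩ := hKc.exists_bound_of_continuousOn (hF.continuousOn.mono hK0)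
  have hb : ∀ z, z ≠ 0 → ‖F z‖ ≤ C := by
    intro z hz
    obtain ⟨n, hn1, hn2⟩ := exists_mem_Ioc_zpow (norm_pos_iff.mpr hz) (one_lt_inv₀ hp |>.mpr hQ)
    rw [← hZ (n + 1) z hz]
    refine hC _ ⟨?_, ?_⟩
    · rw [mem_closedBall_zero_iff, norm_mul, norm_zpow]
      calc ‖Q‖ ^ (n + 1) * ‖z‖ ≤ ‖Q‖ ^ (n + 1) * ‖Q‖⁻¹ ^ (n + 1) := by gcongr
        _ = 1 := by rw [← mul_zpow, mul_inv_cancel₀ hp.ne', one_zpow]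
    · rw [Set.mem_compl_iff, mem_ball_zero_iff, not_lt, norm_mul, norm_zpow]
      calc ‖Q‖ = ‖Q‖ ^ (n + 1) * ‖Q‖⁻¹ ^ n := by
            rw [inv_zpow, ← zpow_neg, ← zpow_add₀ hp.ne']; simp
        _ ≤ _ := by gcongr
  have hd : Differentiable ℂ (F ∘ Complex.exp) := fun z =>
    ((hF.differentiableAt (isOpen_compl_singleton.mem_nhds (Complex.exp_ne_zero z))).comp z
      Complex.differentiable_exp.differentiableAt)
  have hr : Bornology.IsBounded (Set.range (F ∘ Complex.exp)) := by
    refine (Metric.isBounded_closedBall (x := (0 : ℂ)) (r := C)).subset ?_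
    rintro _ ⟨z, rfl⟩
    rw [mem_closedBall_zero_iff]
    exact hb _ (Complex.exp_ne_zero z)
  have := hd.apply_eq_apply_of_bounded hr (Complex.log z) (Complex.log w)
  simpa [Complex.exp_log hz, Complex.exp_log hw] using this

/-- A holomorphic function can be divided by one with simple zeros at each of which it
vanishes. -/
theorem exists_differentiableOn_div {U : Set ℂ} (hU : IsOpen U) {H K : ℂ → ℂ}
    (hH : DifferentiableOn ℂ H U) (hK : DifferentiableOn ℂ K U)
    (h : ∀ z ∈ U, K z = 0 → H z = 0 ∧ deriv K z ≠ 0) :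
    ∃ G : ℂ → ℂ, DifferentiableOn ℂ G U ∧ ∀ z ∈ U, G z * K z = H z := by
  classical
  let G : ℂ → ℂ := fun z => if K z = 0 then deriv H z / deriv K z else H z / K z
  refine ⟨G, fun z hz => ?_, fun z hz => ?_⟩
  · refine DifferentiableAt.differentiableWithinAt ?_
    have hUz := hU.mem_nhds hz
    by_cases hz0 : K z = 0
    · obtain ⟨hHz, hKz⟩ := h z hz hz0
      have dH := ((Complex.differentiableOn_dslope hUz).mpr hH).differentiableAt hUz
      have dK := ((Complex.differentiableOn_dslope hUz).mpr hK).differentiableAt hUz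
      have hne : dslope K z z ≠ 0 := by rwa [dslope_same]
      refine (dH.div dK hne).congr_of_eventuallyEq ?_
      filter_upwards [dK.continuousAt.eventually_ne hne] with y hy
      by_cases hyz : y = z
      · subst hyz
        simp only [G, hz0, if_true, Pi.div_apply, dslope_same]
      · have hyz' := sub_ne_zero.mpr hyz
        have e1 : dslope K z y = K y / (y - z) := by
          rw [dslope_of_ne _ hyz, slope_def_field, hz0, sub_zero]
        have e2 : dslope H z y = H y / (y - z) := by
          rw [dslope_of_ne _ hyz, slope_def_field, hHz, sub_zero]
        have hKy : K y ≠ 0 := fun h0 => hy (by rw [e1, h0, zero_div])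
        simp only [G, hKy, if_false, Pi.div_apply, e1, e2]
        field_simp
    · refine ((hH.differentiableAt hUz).div (hK.differentiableAt hUz) hz0).congr_of_eventuallyEq ?_
      filter_upwards [(hK.differentiableAt hUz).continuousAt.eventually_ne hz0] with y hy
      simp only [G, hy, if_false, Pi.div_apply]
  · by_cases hz0 : K z = 0
    · rw [hz0, mul_zero, (h z hz hz0).1]
    · simp only [G, hz0, if_false]
      field_simp

/-! ### Regularised Appell-Lerch sums -/

theorem regTheta_q_mul {p w : ℂ} (hp : ‖p‖ < 1) (hp0 : p ≠ 0) (hw : w ≠ 0) (k : ℤ) :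
    regTheta k (p * w) p = -w⁻¹ * regTheta (k + 1) w p := by
  have e0 : p / (p * w) = w⁻¹ := by field_simp
  have e1 : w⁻¹ * p = p / w := by field_simp
  match k with
  | .ofNat n =>
    rw [show Int.ofNat n + 1 = Int.ofNat (n + 1) from rfl]
    simp only [regTheta]
    rw [e0, qPochInf_eq w⁻¹ hp, e1, qPoch_succ' w, mul_comm w p,
      show p * w * p ^ (n + 1) = w * p ^ (n + 1 + 1) by ring]
    field_simp
    ring
  | .negSucc 0 =>
    rw [show Int.negSucc 0 + 1 = Int.ofNat 0 from rfl]
    simp only [regTheta]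
    rw [e0, zero_add, pow_one, e1, mul_comm w p]
    simp only [qPoch_zero]
    field_simp
  | .negSucc (n + 1) =>
    rw [show Int.negSucc (n + 1) + 1 = Int.negSucc n from rfl]
    simp only [regTheta]
    rw [e0, qPochInf_eq w hp, qPoch_succ' w⁻¹, e1, mul_comm w p,
      show w⁻¹ * p ^ (n + 1 + 1) = p / w * p ^ (n + 1) by field_simp; ring]
    field_simp
    ring

theorem regTheta_one {p : ℂ} (hp : ‖p‖ < 1) (hp0 : p ≠ 0) {k : ℤ} (hk : k ≠ 0) :
    regTheta k 1 p = 0 := by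
  have h := regTheta_mul hp hp0 one_ne_zero k
  rw [theta_eq_zero_one p hp, mul_one] at h
  refine (mul_eq_zero.mp h).resolve_right (one_sub_ne_zero_of_norm_ne ?_)
  rw [norm_zpow]
  exact fun h => hk ((zpow_eq_one_iff_right₀ (norm_nonneg p) hp.ne).mp h)

theorem regTheta_zero_one (p : ℂ) : regTheta 0 1 p = qPochInf p p ^ 3 := by
  change qPoch 1 p 0 * qPochInf (1 * p ^ (0 + 1)) p * qPochInf (p / 1) p * qPochInf p p = _
  rw [qPoch_zero, zero_add, pow_one, one_mul, one_mul, div_one]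
  ring

/-- The Appell-Lerch type series `∑ (-1)^r Q^{r(r-1)/2} ζ^r / (1 - p^{k r} w)`, multiplied by
`theta w p`; it has no poles in `w`. -/
noncomputable def regAppell (k : ℤ → ℤ) (p w Q ζ : ℂ) : ℂ :=
  ∑' r : ℤ, (-1) ^ r * Q ^ tri r * ζ ^ r * regTheta (k r) w p

theorem norm_regAppell_term_le {p w Q ζ : ℂ} {A C : ℝ} (k : ℤ → ℤ)
    (hC : ∀ n : ℤ, ‖regTheta n w p‖ ≤ C) (h1 : ‖ζ‖ ≤ A) (h2 : ‖ζ⁻¹‖ ≤ A) (r : ℤ) :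
    ‖(-1) ^ r * Q ^ tri r * ζ ^ r * regTheta (k r) w p‖ ≤ A ^ r.natAbs * ‖Q ^ tri r‖ * C := by
  have hA : 0 ≤ A := (norm_nonneg _).trans h1
  rw [norm_mul]
  exact mul_le_mul (norm_theta_term_le h1 h2 r) (hC _) (norm_nonneg _) (by positivity)

theorem summable_regAppell {p Q : ℂ} (hp : ‖p‖ < 1) (hQ0 : Q ≠ 0) (hQ : ‖Q‖ < 1)
    (k : ℤ → ℤ) (w ζ : ℂ) :
    Summable fun r : ℤ => (-1) ^ r * Q ^ tri r * ζ ^ r * regTheta (k r) w p := by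
  obtain ⟨C, -, hC⟩ := exists_norm_regTheta_le hp (max ‖w‖ ‖w⁻¹‖)
  exact Summable.of_norm_bounded ((summable_theta_majorant (max ‖ζ‖ ‖ζ⁻¹‖) hQ0 hQ).mul_right C)
    (norm_regAppell_term_le k (fun n => hC n w (le_max_left _ _) (le_max_right _ _))
      (le_max_left _ _) (le_max_right _ _))

theorem eventually_norm_le_norm_inv_le {f : ℂ → ℂ} {z : ℂ} (hf : ContinuousAt f z) (h0 : f z ≠ 0) :
    ∀ᶠ y in 𝓝 z, ‖f y‖ ≤ ‖f z‖ + ‖(f z)⁻¹‖ + 1 ∧ ‖(f y)⁻¹‖ ≤ ‖f z‖ + ‖(f z)⁻¹‖ + 1 := by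
  have h1 := hf.norm.eventually_lt_const
    (show ‖f z‖ < ‖f z‖ + ‖(f z)⁻¹‖ + 1 by linarith [norm_nonneg (f z)⁻¹])
  have h2 := (hf.inv₀ h0).norm.eventually_lt_const
    (show ‖(f z)⁻¹‖ < ‖f z‖ + ‖(f z)⁻¹‖ + 1 by linarith [norm_nonneg (f z)])
  filter_upwards [h1, h2] with y h1 h2 using ⟨h1.le, h2.le⟩

theorem differentiableOn_regAppell {p Q : ℂ} (hp : ‖p‖ < 1) (hQ0 : Q ≠ 0) (hQ : ‖Q‖ < 1)
    (k : ℤ → ℤ) {w ζ : ℂ → ℂ} (hw : DifferentiableOn ℂ w {0}ᶜ) (hζ : DifferentiableOn ℂ ζ {0}ᶜ)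
    (hw0 : ∀ z, z ≠ 0 → w z ≠ 0) (hζ0 : ∀ z, z ≠ 0 → ζ z ≠ 0) :
    DifferentiableOn ℂ (fun z => regAppell k p (w z) Q (ζ z)) {0}ᶜ := by
  intro z hz
  refine DifferentiableAt.differentiableWithinAt ?_
  have hU := (isOpen_compl_singleton (x := (0 : ℂ))).mem_nhds hz
  set B := ‖w z‖ + ‖(w z)⁻¹‖ + 1 with hB
  set A := ‖ζ z‖ + ‖(ζ z)⁻¹‖ + 1 with hA
  obtain ⟨V, hVsub, hV, hzV⟩ := mem_nhds_iff.mp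
    ((eventually_norm_le_norm_inv_le (hw.differentiableAt hU).continuousAt (hw0 z hz)).and
      ((eventually_norm_le_norm_inv_le (hζ.differentiableAt hU).continuousAt (hζ0 z hz)).and hU))
  obtain ⟨C, -, hC⟩ := exists_norm_regTheta_le hp B
  have hV0 : V ⊆ {0}ᶜ := fun y hy => (hVsub hy).2.2
  have hd : DifferentiableOn ℂ (fun z => regAppell k p (w z) Q (ζ z)) V := by
    refine Complex.differentiableOn_tsum_of_summable_norm
      ((summable_theta_majorant A hQ0 hQ).mul_right C) (fun r => ?_) hV fun r y hy => ?_
    · refine DifferentiableOn.mul (DifferentiableOn.mul (differentiableOn_const _) ?_) ?_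
      · exact (hζ.mono hV0).zpow (Or.inl fun y hy => hζ0 y (hV0 hy))
      · exact (differentiableOn_regTheta hp (k r)).comp (hw.mono hV0) fun y hy => hw0 y (hV0 hy)
    · obtain ⟨⟨h1, h2⟩, ⟨h3, h4⟩, -⟩ := hVsub hy
      exact norm_regAppell_term_le k (fun n => hC n _ h1 h2) h3 h4 r
  exact hd.differentiableAt (hV.mem_nhds hzV)

/-! ### Hecke-type double sums and Appell-Lerch sums as holomorphic functions -/

theorem differentiableOn_heckeF {a b c : ℤ} (ha : 0 < a) (hb : 0 ≤ b) (hc : 0 < c) {q : ℂ}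
    (hq0 : q ≠ 0) (hq : ‖q‖ < 1) {x y : ℂ → ℂ} (hx : DifferentiableOn ℂ x {0}ᶜ)
    (hy : DifferentiableOn ℂ y {0}ᶜ) (hx0 : ∀ z, z ≠ 0 → x z ≠ 0) (hy0 : ∀ z, z ≠ 0 → y z ≠ 0) :
    DifferentiableOn ℂ (fun z => heckeF a b c (x z) (y z) q) {0}ᶜ := by
  intro z hz
  refine DifferentiableAt.differentiableWithinAt ?_
  have hU := (isOpen_compl_singleton (x := (0 : ℂ))).mem_nhds hz
  have bx := eventually_norm_le_norm_inv_le (hx.differentiableAt hU).continuousAt (hx0 z hz)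
  have by' := eventually_norm_le_norm_inv_le (hy.differentiableAt hU).continuousAt (hy0 z hz)
  obtain ⟨V, hVsub, hV, hzV⟩ := mem_nhds_iff.mp (bx.and (by'.and hU))
  set A := max (‖x z‖ + ‖(x z)⁻¹‖ + 1) (‖y z‖ + ‖(y z)⁻¹‖ + 1)
  have hA : 0 ≤ A := le_trans (by positivity) (le_max_left _ _)
  have hV0 : V ⊆ {0}ᶜ := fun y hy => (hVsub hy).2.2
  have hd : DifferentiableOn ℂ (fun z => heckeF a b c (x z) (y z) q) V := by
    refine Complex.differentiableOn_tsum_of_summable_norm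
      (summable_hecke_majorant ha hc hA hq0 hq) (fun r => ?_) hV fun r s hs => ?_
    · simp only [heckeTerm_eq, heckeWeight]
      refine DifferentiableOn.mul (differentiableOn_const _) (DifferentiableOn.mul
        (DifferentiableOn.mul (DifferentiableOn.mul (differentiableOn_const _) ?_) ?_)
        (differentiableOn_const _))
      · exact (hx.mono hV0).zpow (Or.inl fun y hy => hx0 y (hV0 hy))
      · exact (hy.mono hV0).zpow (Or.inl fun y hy => hy0 y (hV0 hy))
    · obtain ⟨⟨h1, h2⟩, ⟨h3, h4⟩, -⟩ := hVsub hs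
      exact norm_heckeTerm_le hb hq0 hq (h1.trans (le_max_left _ _)) (h2.trans (le_max_left _ _))
        (h3.trans (le_max_right _ _)) (h4.trans (le_max_right _ _)) r
  exact hd.differentiableAt (hV.mem_nhds hzV)

theorem appellTerm_eq_regTheta {p w Q x z : ℂ} {m c : ℤ} (hp : ‖p‖ < 1) (hp0 : p ≠ 0)
    (hw : w ≠ 0) (hQ : Q = p ^ m) (hxz : p ^ c * w = x * z / Q) (h : theta w p ≠ 0) (r : ℤ) :
    appellTerm x Q z r =
      (theta w p)⁻¹ * ((-1) ^ r * Q ^ tri r * z ^ r * regTheta (m * r + c) w p) := by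
  have h1 := regTheta_mul hp hp0 hw (m * r + c)
  have hQ0 : Q ≠ 0 := hQ ▸ zpow_ne_zero m hp0
  have e : Q ^ (r - 1) * x * z = p ^ (m * r + c) * w := by
    rw [zpow_add₀ hp0, mul_assoc _ _ w, hxz, zpow_mul, ← hQ, zpow_sub_one₀ hQ0]
    ring
  rw [appellTerm, e, ← h1]
  rw [← h1] at h
  have h2 := left_ne_zero_of_mul h
  have h3 := right_ne_zero_of_mul h
  rw [show r * (r - 1) / 2 = tri r from rfl]
  field_simp

theorem tsum_appellTerm_eq {p w Q x z : ℂ} {m c : ℤ} (hp : ‖p‖ < 1) (hp0 : p ≠ 0)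
    (hw : w ≠ 0) (hQ : Q = p ^ m) (hxz : p ^ c * w = x * z / Q) (h : theta w p ≠ 0) :
    ∑' r : ℤ, appellTerm x Q z r = (theta w p)⁻¹ * regAppell (fun r => m * r + c) p w Q z := by
  rw [regAppell, ← tsum_mul_left]
  exact tsum_congr (appellTerm_eq_regTheta hp hp0 hw hQ hxz h)

theorem summable_appellTerm {q x z : ℂ} (hq : ‖q‖ < 1) (hq0 : q ≠ 0) (hx : x ≠ 0) (hz : z ≠ 0)
    (h : theta (x * z / q) q ≠ 0) : Summable (appellTerm x q z) := by
  refine ((summable_regAppell hq hq0 hq (fun r => 1 * r + 0) (x * z / q) z).mul_left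
    (theta (x * z / q) q)⁻¹).congr fun r => ?_
  exact (appellTerm_eq_regTheta (x := x) (z := z) (w := x * z / q) hq hq0 (div_ne_zero (mul_ne_zero hx hz) hq0)
    (zpow_one q).symm (by rw [zpow_zero, one_mul]) h r).symm

/-- The theta function does not vanish at points whose modulus is not one of the moduli of the
powers of the nome. -/
theorem theta_ne_zero_of_norm {q p w : ℂ} {a b : ℤ} (hq : ‖q‖ < 1) (hq0 : q ≠ 0) (hb : 0 < b)
    (hp : ‖p‖ = ‖q‖ ^ b) (hw : ‖w‖ = ‖q‖ ^ a) (h : ¬ b ∣ a) : theta w p ≠ 0 := by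
  have hn := norm_pos_iff.mpr hq0
  have hp0 : p ≠ 0 := norm_ne_zero_iff.mp (by rw [hp]; positivity)
  have hw0 : w ≠ 0 := norm_ne_zero_iff.mp (by rw [hw]; positivity)
  have hp1 : ‖p‖ < 1 := by
    rw [hp, ← norm_zpow]; exact norm_zpow_lt_one hq hb
  refine theta_ne_zero hp1 hp0 hw0 fun n hn1 => ?_
  have h1 := congrArg norm hn1
  rw [norm_mul, norm_zpow, hp, hw, norm_one, ← zpow_mul, ← zpow_add₀ hn.ne',
    zpow_eq_one_iff_right₀ hn.le hq.ne] at h1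
  exact h ⟨-n, by linarith⟩

theorem theta_cube {q x : ℂ} (hq : ‖q‖ < 1) (hq0 : q ≠ 0) (hx : x ≠ 0) :
    theta x q * qPochInf (q ^ 3) (q ^ 3) ^ 3 = qPochInf q q *
      (theta x (q ^ 3) * theta (x * q) (q ^ 3) * theta (x * q ^ 2) (q ^ 3)) := by
  unfold theta
  rw [qPochInf_trisect x hq, qPochInf_trisect (q / x) hq,
    show q ^ 3 / (x * q) = q / x * q by field_simp,
    show q ^ 3 / (x * q ^ 2) = q / x by field_simp,
    show q ^ 3 / x = q / x * q ^ 2 by field_simp]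
  ring

theorem differentiableOn_theta_comp {p : ℂ} (hp : ‖p‖ < 1) {w : ℂ → ℂ}
    (hw : DifferentiableOn ℂ w {0}ᶜ) (hw0 : ∀ z, z ≠ 0 → w z ≠ 0) :
    DifferentiableOn ℂ (fun z => theta (w z) p) {0}ᶜ :=
  (differentiableOn_theta hp).comp hw fun z hz => hw0 z hz

theorem regTheta_div_q {p w : ℂ} (hp : ‖p‖ < 1) (hp0 : p ≠ 0) (hw : w ≠ 0) (k : ℤ) :
    regTheta k (w / p) p = -(w / p) * regTheta (k - 1) w p := by
  have h := regTheta_q_mul hp hp0 (div_ne_zero hw hp0) (k - 1)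
  rw [mul_div_cancel₀ _ hp0, sub_add_cancel] at h
  rw [h]
  field_simp

/-- The identity `u^2 / (1 - u w) = w⁻¹^2 (1 / (1 - u w) - (1 + u w))` with `u = p^r`, multiplied
by `theta w p`. -/
theorem zpow_sq_mul_regTheta {p w : ℂ} (hp : ‖p‖ < 1) (hp0 : p ≠ 0) (hw : w ≠ 0) (r : ℤ) :
    (p ^ r) ^ 2 * regTheta r w p = w⁻¹ ^ 2 * (regTheta r w p - theta w p * (1 + p ^ r * w)) := by
  rw [← regTheta_mul hp hp0 hw r]
  field_simp
  ring

/-! ### The double sum with parameters `(1,2,1)` as an Appell-Lerch sum -/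

/-- Two shifts of the second index in `f(x,1)` and one of the first index in `f(q^3 x,1)` lead to
the same value `f(q^4 x,q^2)`. -/
theorem heckeF_121_cube {q x : ℂ} (hq0 : q ≠ 0) (hq : ‖q‖ < 1) (hx : x ≠ 0) :
    heckeF 1 2 1 (q ^ 3 * x) 1 q =
      q ^ 2 * x * (theta x q * (1 - q⁻¹ * x⁻¹ ^ 2) - heckeF 1 2 1 x 1 q) := by
  have h1 := heckeF_shift_right (a := 1) (b := 2) (c := 1) (by norm_num) (by norm_num)
    (by norm_num) hq0 hq hx one_ne_zero
  have h2 := heckeF_shift_right (a := 1) (b := 2) (c := 1) (by norm_num) (by norm_num)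
    (by norm_num) hq0 hq (mul_ne_zero (pow_ne_zero 2 hq0) hx) hq0
  have h3 := heckeF_shift_left (a := 1) (b := 2) (c := 1) (by norm_num) (by norm_num)
    (by norm_num) hq0 hq (mul_ne_zero (pow_ne_zero 3 hq0) hx) one_ne_zero
  have h4 := theta_q_mul hq hq0 hx
  have h5 := theta_q_mul hq hq0 (mul_ne_zero hq0 hx)
  simp only [zpow_ofNat, mul_one, pow_one] at h1 h2 h3
  rw [theta_eq_zero_one q hq, ← mul_assoc, ← pow_succ'] at h3
  rw [← mul_assoc, ← pow_add, ← sq] at h2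
  rw [← mul_assoc, ← sq, h4] at h5
  rw [h5] at h2
  rw [h1, h2, h3]
  field_simp
  ring

/-- The inhomogeneous functional equation under `(w, x) ↦ (w/p, p x)`, which fixes `x w`. -/
theorem regAppell_self_shift {p w x : ℂ} (hp : ‖p‖ < 1) (hp0 : p ≠ 0) (hw : w ≠ 0) (hx : x ≠ 0) :
    regAppell id p (w / p) p (p * x) =
      x * w⁻¹ * (regAppell id p w p x - theta w p * theta x p * (1 - w / x)) := by
  have s1 := (summable_regAppell hp hp0 hp id (w / p) (p * x)).hasSum
  rw [← (Equiv.addRight (1 : ℤ)).hasSum_iff] at s1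
  have s2 := (summable_regAppell hp hp0 hp id w x).hasSum
  have t1 := hasSum_theta hp0 hp hx
  have t2 := hasSum_theta hp0 hp (mul_ne_zero hp0 hx)
  rw [theta_q_mul hp hp0 hx] at t2
  have s3 := (s2.sub ((t1.add (t2.mul_left w)).mul_left (theta w p))).mul_left (x * w⁻¹)
  have := s1.unique (s3.congr_fun fun r => ?_)
  · rw [regAppell, regAppell, this]
    field_simp
    ring
  · simp only [Function.comp, Equiv.coe_addRight, id]
    rw [regTheta_div_q hp hp0 hw, add_sub_cancel_right, tri_add_one, zpow_add₀ hp0,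
      zpow_add_one₀ (by norm_num : (-1 : ℂ) ≠ 0), mul_zpow, mul_zpow, zpow_add_one₀ hx,
      zpow_add_one₀ hp0]
    have h := zpow_sq_mul_regTheta hp hp0 hw r
    have e : x * w⁻¹ * ((-1) ^ r * p ^ tri r * x ^ r * regTheta r w p -
      theta w p * ((-1) ^ r * p ^ tri r * x ^ r + w * ((-1) ^ r * p ^ tri r * (p ^ r * x ^ r)))) =
      x * w * ((-1) ^ r * p ^ tri r * x ^ r) *
        (w⁻¹ ^ 2 * (regTheta r w p - theta w p * (1 + p ^ r * w))) := by
      field_simp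
    rw [e, ← h]
    field_simp

/-- Both sides satisfy the same functional equation under `x ↦ q^3 x`. The homogeneous equation of
their difference has no nonzero holomorphic solution: the product with `j(q^2 x;q^3)` is
invariant, hence constant, and vanishes at `x = q^{-2}`. -/
theorem heckeF_121_mul_theta {q : ℂ} (hq0 : q ≠ 0) (hq : ‖q‖ < 1) {x : ℂ} (hx : x ≠ 0)
    (h2 : theta (x * q ^ 2) (q ^ 3) ≠ 0) :
    heckeF 1 2 1 x 1 q * qPochInf (q ^ 3) (q ^ 3) ^ 3 = -(x * q) * qPochInf q q *
      theta (x * q ^ 2) (q ^ 3) * regAppell id (q ^ 3) (1 / (x * q)) (q ^ 3) x := by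
  have hp := norm_pow_lt_one hq (n := 3) (by norm_num)
  have hp0 := pow_ne_zero 3 hq0
  set E := qPochInf (q ^ 3) (q ^ 3) ^ 3 with hE
  let D : ℂ → ℂ := fun x => heckeF 1 2 1 x 1 q * E - -(x * q) * qPochInf q q *
      theta (x * q ^ 2) (q ^ 3) * regAppell id (q ^ 3) (1 / (x * q)) (q ^ 3) x
  have did : DifferentiableOn ℂ (fun z : ℂ => z) {0}ᶜ := differentiableOn_id
  have dw : DifferentiableOn ℂ (fun z : ℂ => 1 / (z * q)) {0}ᶜ :=
    DifferentiableOn.div (differentiableOn_const _) (did.mul_const _)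
      fun z hz => mul_ne_zero hz hq0
  have dT : DifferentiableOn ℂ (fun z => theta (z * q ^ 2) (q ^ 3)) {0}ᶜ :=
    differentiableOn_theta_comp hp (did.mul_const _) fun z hz => mul_ne_zero hz (pow_ne_zero 2 hq0)
  have dD : DifferentiableOn ℂ D {0}ᶜ := by
    refine ((differentiableOn_heckeF (by norm_num) (by norm_num) (by norm_num) hq0 hq did
      (differentiableOn_const _) (fun z hz => hz) fun _ _ => one_ne_zero).mul_const _).sub ?_
    refine DifferentiableOn.mul (DifferentiableOn.mul ((did.mul_const _).neg.mul_const _) dT)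
      (differentiableOn_regAppell hp hp0 hp _ dw did (fun z hz => ?_) fun z hz => hz)
    exact one_div_ne_zero (mul_ne_zero hz hq0)
  have hD : ∀ z, z ≠ 0 → D (q ^ 3 * z) = -(q ^ 2 * z) * D z := by
    intro z hz
    have hzq := mul_ne_zero hz hq0
    have t1 := theta_cube hq hq0 hz
    have t2 := theta_q_mul hp hp0 (mul_ne_zero hz (pow_ne_zero 2 hq0))
    have t3 := theta_inv hp (one_div_ne_zero hzq) hp0
    rw [one_div, inv_inv] at t3
    have r1 := regAppell_self_shift hp hp0 (one_div_ne_zero hzq) hz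
    rw [show 1 / (z * q) / q ^ 3 = 1 / (q ^ 3 * z * q) by field_simp] at r1
    simp only [D]
    rw [heckeF_121_cube hq0 hq hz, r1, mul_assoc (q ^ 3) z (q ^ 2), t2]
    rw [← hE, t3] at t1
    have e : q ^ 2 * z * (theta z q * (1 - q⁻¹ * z⁻¹ ^ 2) - heckeF 1 2 1 z 1 q) * E =
      q ^ 2 * z * (1 - q⁻¹ * z⁻¹ ^ 2) * (theta z q * E) - q ^ 2 * z * heckeF 1 2 1 z 1 q * E := by
      ring
    rw [e, t1, one_div]
    field_simp
    ring
  have hinv := eq_of_mul_invariant (F := fun z => D z * theta (z * q ^ 2) (q ^ 3)) (dD.mul dT)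
    hp0 hp (fun z hz => by
      have t2 := theta_q_mul hp hp0 (mul_ne_zero hz (pow_ne_zero 2 hq0))
      simp only [hD z hz]
      rw [mul_assoc (q ^ 3) z (q ^ 2), t2]
      field_simp) hx (inv_ne_zero (pow_ne_zero 2 hq0))
  rw [inv_mul_cancel₀ (pow_ne_zero 2 hq0), theta_eq_zero_one _ hp, mul_zero] at hinv
  exact sub_eq_zero.mp ((mul_eq_zero.mp hinv).resolve_right h2)

theorem norm_pow_eq_zpow (q : ℂ) (n : ℕ) : ‖q ^ n‖ = ‖q‖ ^ (n : ℤ) := by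
  rw [norm_pow, zpow_natCast]

/-- The double sum `f_{1,2,1}(x,1,q)` is the product of `j(x;q)` and `m(q^2/x^2,q^3,x)`. -/
theorem heckeF_121_eq_appellM {q : ℂ} (hq0 : q ≠ 0) (hq : ‖q‖ < 1) {x : ℂ} (hx : x ≠ 0)
    (h0 : theta x (q ^ 3) ≠ 0) (h1 : theta (x * q) (q ^ 3) ≠ 0)
    (h2 : theta (x * q ^ 2) (q ^ 3) ≠ 0) :
    heckeF 1 2 1 x 1 q = theta x q * appellM (q ^ 2 / x ^ 2) (q ^ 3) x := by
  have hp := norm_pow_lt_one hq (n := 3) (by norm_num)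
  have hp0 := pow_ne_zero 3 hq0
  have hxq := mul_ne_zero hx hq0
  have h := heckeF_121_mul_theta hq0 hq hx h2
  have t1 := theta_cube hq hq0 hx
  have t3 := theta_inv hp (one_div_ne_zero hxq) hp0
  rw [one_div, inv_inv] at t3
  have ht : theta (1 / (x * q)) (q ^ 3) ≠ 0 := by
    rw [one_div]; rw [t3] at h1; exact right_ne_zero_of_mul h1
  have hE := pow_ne_zero 3 (qPochInf_self_ne_zero hp)
  refine mul_right_cancel₀ hE ?_
  rw [appellM, tsum_appellTerm_eq (m := 1) (c := 0) hp hp0 (one_div_ne_zero hxq) (zpow_one _).symm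
    (by rw [zpow_zero]; field_simp) ht, h, mul_right_comm (theta x q), t1]
  have e : (fun r : ℤ => 1 * r + 0) = id := by ext; simp
  rw [e, t3, ← one_div]
  field_simp

theorem companion_eq_appellM {q : ℂ} (hq0 : q ≠ 0) (hq : ‖q‖ < 1) :
    (∑' n : ℕ, companionTerm q n) = 1 - 2 * appellM (q ^ 2) (q ^ 6) q := by
  have hq2 := norm_sq_lt_one hq
  have hn := norm_pos_iff.mpr hq0
  have hb : ‖(q ^ 2) ^ 3‖ = ‖q‖ ^ (6 : ℤ) := by rw [← pow_mul]; exact norm_pow_eq_zpow q 6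
  have h := heckeF_121_eq_appellM (pow_ne_zero 2 hq0) hq2 hq0
    (theta_ne_zero_of_norm (a := 1) (b := 6) hq hq0 (by norm_num) hb (by simp) (by norm_num))
    (theta_ne_zero_of_norm (a := 3) (b := 6) hq hq0 (by norm_num) hb
      (by rw [← pow_succ']; exact norm_pow_eq_zpow q 3) (by norm_num))
    (theta_ne_zero_of_norm (a := 5) (b := 6) hq hq0 (by norm_num) hb
      (by rw [← pow_mul, ← pow_succ']; exact norm_pow_eq_zpow q 5) (by norm_num))
  rw [companion_eq_heckeF hq0 hq, h, etaJ_two_div hq, ← pow_mul, ← pow_mul,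
    ← theta_self_sq hq0 hq, show q ^ (2 * 2) / q ^ 2 = q ^ 2 by field_simp]
  have h1 := qPochInf_neg_self_ne_zero hq
  have h2 : theta q (q ^ 2) ≠ 0 := theta_ne_zero_of_norm (a := 1) (b := 2) hq hq0 (by norm_num)
    (norm_pow_eq_zpow q 2) (by simp) (by norm_num)
  field_simp

/-! ### The bilateral Lambert series underlying Appell-Lerch sums -/

/-- The bilateral series `∑ (-1)^r p^{r(r-1)/2} ζ^r / (1 - p^r w)`. -/
noncomputable def lerch (p w ζ : ℂ) : ℂ := ∑' r : ℤ, (-1) ^ r * p ^ tri r * ζ ^ r / (1 - p ^ r * w)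

theorem lerch_term_eq {p w : ℂ} (hp : ‖p‖ < 1) (hp0 : p ≠ 0) (hw : w ≠ 0) (h : theta w p ≠ 0)
    (ζ : ℂ) (r : ℤ) : (-1) ^ r * p ^ tri r * ζ ^ r / (1 - p ^ r * w) =
      (theta w p)⁻¹ * ((-1) ^ r * p ^ tri r * ζ ^ r * regTheta (id r) w p) := by
  have h1 := regTheta_mul hp hp0 hw r
  rw [← h1] at h ⊢
  have h2 := left_ne_zero_of_mul h
  have h3 := right_ne_zero_of_mul h
  simp only [id]
  field_simp

theorem hasSum_lerch {p w : ℂ} (hp : ‖p‖ < 1) (hp0 : p ≠ 0) (hw : w ≠ 0) (h : theta w p ≠ 0)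
    (ζ : ℂ) :
    HasSum (fun r : ℤ => (-1) ^ r * p ^ tri r * ζ ^ r / (1 - p ^ r * w)) (lerch p w ζ) := by
  have := (summable_regAppell hp hp0 hp id w ζ).mul_left (theta w p)⁻¹
  exact (this.congr fun r => (lerch_term_eq hp hp0 hw h ζ r).symm).hasSum

theorem lerch_eq_regAppell {p w : ℂ} (hp : ‖p‖ < 1) (hp0 : p ≠ 0) (hw : w ≠ 0)
    (h : theta w p ≠ 0) (ζ : ℂ) : lerch p w ζ = (theta w p)⁻¹ * regAppell id p w p ζ := by
  rw [lerch, regAppell, ← tsum_mul_left]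
  exact tsum_congr (lerch_term_eq hp hp0 hw h ζ)

theorem appellM_eq_lerch {q : ℂ} (hq0 : q ≠ 0) (x z : ℂ) :
    appellM x q z = (theta z q)⁻¹ * lerch q (x * z / q) z := by
  rw [appellM, lerch]
  congr 1
  refine tsum_congr fun r => ?_
  rw [appellTerm, zpow_sub_one₀ hq0, show r * (r - 1) / 2 = tri r from rfl]
  congr 2
  ring

theorem one_sub_zpow_mul_ne_zero {p w : ℂ} (hp : ‖p‖ < 1) (hp0 : p ≠ 0) (hw : w ≠ 0)
    (h : theta w p ≠ 0) (r : ℤ) : 1 - p ^ r * w ≠ 0 := by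
  rw [← regTheta_mul hp hp0 hw r] at h
  exact right_ne_zero_of_mul h

/-- `p^r / (1 - p^r w) = w⁻¹ (1 / (1 - p^r w) - 1)`, summed over `r`. -/
theorem lerch_q_mul {p w ζ : ℂ} (hp : ‖p‖ < 1) (hp0 : p ≠ 0) (hw : w ≠ 0) (hζ : ζ ≠ 0)
    (h : theta w p ≠ 0) : lerch p w (p * ζ) = w⁻¹ * (lerch p w ζ - theta ζ p) := by
  have h1 := ((hasSum_lerch hp hp0 hw h ζ).sub (hasSum_theta hp0 hp hζ)).mul_left w⁻¹
  refine (hasSum_lerch hp hp0 hw h (p * ζ)).unique (h1.congr_fun fun r => ?_)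
  have h2 := one_sub_zpow_mul_ne_zero hp hp0 hw h r
  rw [mul_zpow]
  field_simp
  ring

/-- Under `r ↦ 1 - r` the terms of the two sums differ by those of the series of `j(1;p) = 0`. -/
theorem lerch_one_reflect {p w v : ℂ} (hp : ‖p‖ < 1) (hp0 : p ≠ 0) (hw : w ≠ 0)
    (h : theta w p ≠ 0) (hv : theta v p ≠ 0) (hwv : p * w * v = 1) :
    lerch p v 1 = lerch p w 1 := by
  have hv0 : v ≠ 0 := by rintro rfl; simp at hwv
  have h1 := (hasSum_lerch hp hp0 hw h 1).sub (hasSum_theta hp0 hp one_ne_zero)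
  rw [theta_eq_zero_one p hp, sub_zero] at h1
  have h2 := hasSum_lerch hp hp0 hv0 hv 1
  rw [← (Equiv.subLeft (1 : ℤ)).hasSum_iff] at h2
  refine h2.unique (h1.congr_fun fun r => ?_)
  have h3 := one_sub_zpow_mul_ne_zero hp hp0 hw h r
  have h4 := one_sub_zpow_mul_ne_zero hp hp0 hv0 hv (1 - r)
  have e : p ^ (1 - r) * v * (p ^ r * w) = 1 := by
    rw [← hwv, zpow_sub₀ hp0, zpow_one]; field_simp
  have e' : (-1 : ℂ) ^ (1 - r) = -(-1) ^ r := by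
    rw [zpow_sub₀ (by norm_num), zpow_one, div_eq_mul_inv, ← zpow_neg, neg_one_mul, zpow_neg,
      ← inv_zpow, inv_neg_one]
  simp only [Function.comp, Equiv.subLeft_apply, one_zpow, mul_one, tri_one_sub, e']
  rw [div_sub' h3, div_eq_div_iff h4 h3]
  linear_combination (-1) ^ r * p ^ tri r * e

/-- The partial fraction expansion of the reciprocal of the theta function. -/
theorem lerch_self {p w : ℂ} (hp : ‖p‖ < 1) (hp0 : p ≠ 0) (hw : w ≠ 0) (h : theta w p ≠ 0) :
    lerch p w p = qPochInf p p ^ 3 / theta w p := by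
  have hid : DifferentiableOn ℂ (fun z : ℂ => z) {0}ᶜ := differentiableOn_id
  have hs : ∀ v, v ≠ 0 → regAppell id p v p (p * 1) = v⁻¹ * regAppell id p v p 1 := by
    intro v hv
    have s1 := (summable_regAppell hp hp0 hp id v (p * 1)).hasSum
    have s2 := (summable_regAppell hp hp0 hp id v 1).hasSum
    have t := hasSum_theta hp0 hp one_ne_zero
    rw [theta_eq_zero_one p hp] at t
    have s3 := (s2.sub (t.mul_left (theta v p))).mul_left v⁻¹
    rw [mul_zero, sub_zero] at s3
    refine s1.unique (s3.congr_fun fun r => ?_)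
    rw [← regTheta_mul hp hp0 hv r, mul_zpow]
    simp only [id]
    field_simp
    ring
  have key := eq_of_mul_invariant (F := fun v => regAppell id p v p p)
    (differentiableOn_regAppell hp hp0 hp id hid (differentiableOn_const _) (fun _ h => h)
      fun _ _ => hp0) hp0 hp (fun v hv => by
        have h1 := regAppell_self_shift hp hp0 (mul_ne_zero hp0 hv) one_ne_zero
        have h2 := hs _ (mul_ne_zero hp0 hv)
        rw [mul_div_cancel_left₀ v hp0, theta_eq_zero_one p hp, mul_one, one_mul, mul_zero,
          zero_mul, sub_zero] at h1
        rw [mul_one] at h2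
        simp only [h1, h2]) hw one_ne_zero
  rw [lerch_eq_regAppell hp hp0 hw h, key, regAppell, tsum_eq_single 0]
  · simp only [zpow_zero, tri_zero, id, regTheta_zero_one]
    field_simp
  · intro r hr
    rw [id, regTheta_one hp hp0 hr, mul_zero]

/-! ### A quadrisection of an Appell-Lerch sum -/

theorem qPochInf_pow_four (x : ℂ) {q : ℂ} (hq : ‖q‖ < 1) : qPochInf (x ^ 4) (q ^ 4) =
    qPochInf x q * qPochInf (-x) q * qPochInf (Complex.I * x) q * qPochInf (-(Complex.I * x)) q := by
  have h1 := qPochInf_sq (x ^ 2) (norm_sq_lt_one hq)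
  have h2 := qPochInf_sq (Complex.I * x) hq
  rw [mul_pow, Complex.I_sq, neg_one_mul] at h2
  rw [qPochInf_sq x hq, h2, ← pow_mul, ← pow_mul] at h1
  rw [h1]
  ring

theorem theta_pow_four {q z : ℂ} (hq : ‖q‖ < 1) (hz : z ≠ 0) :
    theta (z ^ 4) (q ^ 4) * qPochInf q q ^ 4 = qPochInf (q ^ 4) (q ^ 4) *
      (theta z q * theta (-z) q * theta (Complex.I * z) q * theta (-(Complex.I * z)) q) := by
  have e1 : q / (Complex.I * z) = -(Complex.I * (q / z)) := by
    have := Complex.I_ne_zero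
    field_simp
    rw [Complex.I_sq]
    ring
  have e2 : q / (-(Complex.I * z)) = Complex.I * (q / z) := by rw [div_neg, e1, neg_neg]
  unfold theta
  rw [← div_pow, qPochInf_pow_four z hq, qPochInf_pow_four (q / z) hq, div_neg, e1, e2]
  ring

/-- In the variable `z`, both sides are sections over the torus `ℂˣ / q^ℤ` with the same
inhomogeneous multiplier, so their difference is determined up to a constant factor; it vanishes
at `z = i`. -/
theorem theta_mul_lerch_eq {q z : ℂ} (hq : ‖q‖ < 1) (hq0 : q ≠ 0) (hz : z ≠ 0)
    (h : theta z q ≠ 0) (hn : theta (-z⁻¹) q ≠ 0) :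
    theta (z ^ 4) (q ^ 4) / theta z q * lerch q (-z⁻¹) z =
      lerch (q ^ 4) (-q⁻¹) (z ^ 4) + z⁻¹ ^ 2 * lerch (q ^ 4) (-q⁻¹ ^ 3) (z ^ 4) := by
  have hI := Complex.I_ne_zero
  have hp := norm_pow_lt_one hq (n := 4) (by norm_num)
  have hp0 := pow_ne_zero 4 hq0
  have hw1 : -q⁻¹ ≠ 0 := neg_ne_zero.mpr (inv_ne_zero hq0)
  have hw2 : -q⁻¹ ^ 3 ≠ 0 := neg_ne_zero.mpr (pow_ne_zero 3 (inv_ne_zero hq0))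
  have ht1 : theta (-q⁻¹) (q ^ 4) ≠ 0 := theta_ne_zero_of_norm (a := -1) (b := 4) hq hq0
    (by norm_num) (norm_pow_eq_zpow q 4) (by simp) (by norm_num)
  have ht2 : theta (-q⁻¹ ^ 3) (q ^ 4) ≠ 0 := theta_ne_zero_of_norm (a := -3) (b := 4) hq hq0
    (by norm_num) (norm_pow_eq_zpow q 4) (by simp [zpow_neg]) (by norm_num)
  have hid : DifferentiableOn ℂ (fun z : ℂ => z) {0}ᶜ := differentiableOn_id
  -- The constant in the factorisation of `j(z^4;q^4)` into the functions `j(i^k z;q)`.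
  set c := qPochInf (q ^ 4) (q ^ 4) / qPochInf q q ^ 4 with hc
  -- `L` is the left-hand side with the theta functions in its denominators cancelled.
  let L : ℂ → ℂ := fun z => c * z * (theta (Complex.I * z) q * theta (-(Complex.I * z)) q) *
    regAppell id q (-z⁻¹) q z
  let R : ℂ → ℂ := fun z => lerch (q ^ 4) (-q⁻¹) (z ^ 4) + z⁻¹ ^ 2 *
    lerch (q ^ 4) (-q⁻¹ ^ 3) (z ^ 4)
  have h4 : ∀ z, z ≠ 0 → theta (z ^ 4) (q ^ 4) =
      c * z * (theta (Complex.I * z) q * theta (-(Complex.I * z)) q) *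
        (theta (-z⁻¹) q * theta z q) := by
    intro z hz
    have h1 := theta_pow_four hq hz
    have h2 := theta_inv hq (neg_ne_zero.mpr hz) hq0
    have h3 := qPochInf_self_ne_zero hq
    rw [inv_neg] at h2
    rw [hc, h2]
    rw [div_mul_eq_mul_div, div_mul_eq_mul_div, div_mul_eq_mul_div, eq_div_iff (pow_ne_zero 4 h3), h1]
    field_simp
  have dL : DifferentiableOn ℂ L {0}ᶜ := by
    refine DifferentiableOn.mul (DifferentiableOn.mul (hid.const_mul c) (DifferentiableOn.mul
      (differentiableOn_theta_comp hq (hid.const_mul _) fun z hz => mul_ne_zero hI hz)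
      (differentiableOn_theta_comp hq (hid.const_mul _).neg
        fun z hz => neg_ne_zero.mpr (mul_ne_zero hI hz))))
      (differentiableOn_regAppell hq hq0 hq _ ?_ hid
        (fun z hz => neg_ne_zero.mpr (inv_ne_zero hz)) fun z hz => hz)
    exact (hid.inv fun z hz => hz).neg
  have dG : ∀ w, w ≠ 0 → theta w (q ^ 4) ≠ 0 →
      DifferentiableOn ℂ (fun z => lerch (q ^ 4) w (z ^ 4)) {0}ᶜ := by
    intro w hw ht
    simp_rw [lerch_eq_regAppell hp hp0 hw ht]
    exact (differentiableOn_regAppell hp hp0 hp id (differentiableOn_const w) (hid.pow 4)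
      (fun _ _ => hw) fun z hz => pow_ne_zero 4 hz).const_mul _
  have dR : DifferentiableOn ℂ R {0}ᶜ :=
    (dG _ hw1 ht1).add (((hid.inv fun z hz => hz).pow 2).mul (dG _ hw2 ht2))
  have hR : ∀ z, z ≠ 0 → R (q * z) = -q * R z + q * (1 + z⁻¹ ^ 2) * theta (z ^ 4) (q ^ 4) := by
    intro z hz
    simp only [R]
    rw [mul_pow q z 4, lerch_q_mul hp hp0 hw1 (pow_ne_zero 4 hz) ht1,
      lerch_q_mul hp hp0 hw2 (pow_ne_zero 4 hz) ht2]
    field_simp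
    ring
  have hL : ∀ z, z ≠ 0 → L (q * z) = -q * L z + q * (1 + z⁻¹ ^ 2) * theta (z ^ 4) (q ^ 4) := by
    intro z hz
    have r := regAppell_self_shift hq hq0 (neg_ne_zero.mpr (inv_ne_zero hz)) hz
    have t1 := theta_q_mul hq hq0 (mul_ne_zero hI hz)
    have t2 := theta_q_mul hq hq0 (neg_ne_zero.mpr (mul_ne_zero hI hz))
    rw [show -z⁻¹ / q = -(q * z)⁻¹ by field_simp] at r
    rw [h4 z hz]
    simp only [L]
    rw [mul_left_comm Complex.I q z, t1, ← mul_neg, t2, r]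
    field_simp
    rw [Complex.I_sq]
    ring
  -- The difference is only multiplied by `-q` under `z ↦ q z`; the square removes the sign.
  have hD := eq_of_mul_invariant (F := fun z => ((L z - R z) * z⁻¹) ^ 2)
    (((dL.sub dR).mul (hid.inv fun z hz => hz)).pow 2) hq0 hq (fun z hz => by
      simp only [hL z hz, hR z hz]
      field_simp
      ring) hz hI
  -- At `z = i` the theta function of `-i z` vanishes in `L`, and the two sums in `R` cancel by reflection.
  have hI0 : L Complex.I - R Complex.I = 0 := by
    have e1 : L Complex.I = 0 := by
      simp only [L, Complex.I_mul_I, neg_neg, theta_eq_zero_one q hq, mul_zero, zero_mul]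
    have e2 : R Complex.I = 0 := by
      simp only [R, Complex.I_pow_four, inv_pow, Complex.I_sq]
      rw [lerch_one_reflect hp hp0 hw1 ht1 (v := -(q ^ 3)⁻¹) (by rw [← inv_pow]; exact ht2)
        (by field_simp)]
      norm_num
    rw [e1, e2, sub_zero]
  rw [hI0, zero_mul, zero_pow two_ne_zero] at hD
  have hD' := (mul_eq_zero.mp (pow_eq_zero_iff two_ne_zero |>.mp hD)).resolve_right
    (inv_ne_zero hz)
  have hLR : L z = R z := sub_eq_zero.mp hD'
  change _ = R z
  rw [← hLR, h4 z hz, lerch_eq_regAppell hq hq0 (neg_ne_zero.mpr (inv_ne_zero hz)) hn]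
  simp only [L]
  rw [← mul_assoc, div_mul_eq_mul_div, div_mul_eq_mul_div, div_eq_iff h]
  linear_combination c * z * (theta (Complex.I * z) q * theta (-(Complex.I * z)) q) *
    theta z q * regAppell id q (-z⁻¹) q z * mul_inv_cancel₀ hn

/-! ### A partial fraction expansion -/

theorem summable_invPoch_window (u : ℤ → ℂ) (q : ℂ) (a b : ℤ) :
    Summable fun k : ℤ => u k * (invPoch q (a - k) * invPoch q (b + k)) := by
  refine summable_of_ne_finset_zero (s := Finset.Icc (-b) a) fun k hk => ?_
  rcases lt_or_ge a k with h | h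
  · rw [invPoch_of_neg q (show a - k < 0 by omega), zero_mul, mul_zero]
  · rw [invPoch_of_neg q (m := b + k), mul_zero, mul_zero]
    by_contra h'
    exact hk (Finset.mem_Icc.mpr ⟨by omega, h⟩)

/-- A recurrence in `a` for the finite alternating sums of the `q`-binomial theorem. -/
theorem tsum_window_recurrence {q : ℂ} (hq0 : q ≠ 0) (hq : ‖q‖ < 1) (a b : ℤ) :
    (1 - q ^ (a + b)) * ∑' k : ℤ, (-1) ^ k * q ^ tri k * (invPoch q (a - k) * invPoch q (b + k)) =
      (1 - q ^ (a - 1)) *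
        ∑' k : ℤ, (-1) ^ k * q ^ tri k * (invPoch q (a - 1 - k) * invPoch q (b + k)) := by
  have s1 := (summable_invPoch_window (fun k => (-1) ^ k * q ^ tri k) q a b).hasSum.mul_left
    (1 - q ^ (a + b))
  have s2 := (summable_invPoch_window (fun k => (-1) ^ k * q ^ tri k) q (a - 1) b).hasSum
  have s3 := s2
  rw [← (Equiv.subRight (1 : ℤ)).hasSum_iff] at s3
  refine s1.unique ?_
  rw [sub_mul, one_mul]
  refine (s2.sub (s3.mul_left (q ^ (a - 1)))).congr_fun fun k => ?_
  simp only [Function.comp, Equiv.subRight_apply]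
  have i1 := invPoch_sub_one hq (a - k)
  have i2 := invPoch_sub_one hq (b + k)
  have t := tri_add_one (k - 1)
  rw [sub_add_cancel] at t
  rw [show a - 1 - k = a - k - 1 by ring, show a - 1 - (k - 1) = a - k by ring,
    show b + (k - 1) = b + k - 1 by ring, i1, i2, zpow_sub_one₀ (by norm_num : (-1 : ℂ) ≠ 0)]
  have e1 : q ^ (a + b) = q ^ (a - k) * q ^ (b + k) := by rw [← zpow_add₀ hq0]; congr 1; ring
  have e2 : q ^ (a - 1) * q ^ tri (k - 1) = q ^ tri k * q ^ (a - k) := by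
    rw [← zpow_add₀ hq0, ← zpow_add₀ hq0]; congr 1; linear_combination -t
  rw [e1]
  norm_num
  linear_combination -(-1) ^ k * (1 - q ^ (b + k)) * invPoch q (a - k) * invPoch q (b + k) * e2

/-- The finite `q`-binomial theorem at a point where the product vanishes. -/
theorem tsum_window_eq_zero {q : ℂ} (hq0 : q ≠ 0) (hq : ‖q‖ < 1) (n : ℕ) {b : ℤ} (hb : 0 ≤ b) :
    ∑' k : ℤ, (-1) ^ k * q ^ tri k * (invPoch q ((n + 1 : ℕ) - k) * invPoch q (b + k)) = 0 := by
  have hne : ∀ m : ℤ, 0 < m → 1 - q ^ m ≠ 0 := fun m hm =>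
    one_sub_ne_zero_of_norm_ne (norm_zpow_lt_one hq hm).ne
  induction n with
  | zero =>
    have h := tsum_window_recurrence hq0 hq ((0 + 1 : ℕ) : ℤ) b
    norm_num at h
    refine (h.resolve_left ?_)
    exact hne _ (by omega)
  | succ n ih =>
    have h := tsum_window_recurrence hq0 hq ((n + 1 + 1 : ℕ) : ℤ) b
    rw [show ((n + 1 + 1 : ℕ) : ℤ) - 1 = (n + 1 : ℕ) by push_cast; ring, ih, mul_zero] at h
    exact (mul_eq_zero.mp h).resolve_left (hne _ (by push_cast; omega))

/-- The summand is odd under `k ↦ -1 - k`. -/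
theorem tsum_window_symm (q : ℂ) (n : ℤ) :
    ∑' k : ℤ, (-1) ^ k * q ^ tri (k + 1) * (invPoch q (n - k) * invPoch q (n + 1 + k)) = 0 := by
  set S := ∑' k : ℤ, (-1) ^ k * q ^ tri (k + 1) * (invPoch q (n - k) * invPoch q (n + 1 + k))
  have h : S = -S := by
    rw [← tsum_neg]
    simp only [S]
    rw [← (Equiv.subLeft (-1 : ℤ)).tsum_eq]
    refine tsum_congr fun k => ?_
    have e : (-1 : ℂ) ^ (-1 - k) = -(-1) ^ k := by
      rw [zpow_sub₀ (by norm_num), zpow_neg_one, inv_neg_one, div_eq_mul_inv, ← zpow_neg,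
        neg_one_mul, zpow_neg, ← inv_zpow, inv_neg_one]
    rw [Equiv.subLeft_apply, e, ← tri_one_sub, show 1 - (-1 - k + 1) = k + 1 by ring,
      show n - (-1 - k) = n + 1 + k by ring, show n + 1 + (-1 - k) = n - k by ring]
    ring
  linear_combination h / 2

/-- The partial fraction expansion of `1 / ((x;q)_{n+1} (q/x;q)_{n+1})`. -/
theorem tsum_partial_fraction {q x : ℂ} (hq0 : q ≠ 0) (hq : ‖q‖ < 1) (hx : x ≠ 0)
    (h : ∀ k : ℤ, 1 - q ^ k * x ≠ 0) (n : ℕ) :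
    ∑' k : ℤ, (-1) ^ k * q ^ tri (k + 1) / (1 - q ^ k * x) *
      (invPoch q (n - k) * invPoch q (n + 1 + k)) =
      (qPoch x q (n + 1) * qPoch (q / x) q (n + 1))⁻¹ := by
  have h' : ∀ m : ℕ, 1 - q / x * q ^ m ≠ 0 := fun m h0 => by
    refine h (-(m + 1 : ℕ)) ?_
    rw [zpow_neg, zpow_natCast, pow_succ]
    field_simp at h0 ⊢
    linear_combination -h0
  have h'' : ∀ m : ℕ, 1 - x * q ^ m ≠ 0 := fun m => by
    have := h m; rwa [mul_comm, zpow_natCast] at this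
  induction n with
  | zero =>
    rw [tsum_eq_sum (s := {-1, 0})]
    · have h1 := one_sub_mul_pow_ne_zero hq hq 0
      have h2 := h'' 0
      have h3 := h' 0
      have h4 := h (-1)
      have e1 : invPoch q 1 = (1 - q)⁻¹ := by simpa [qPoch] using invPoch_natCast q 1
      have e2 : tri (-1 + 1) = 0 := by simp
      rw [Finset.sum_pair (by norm_num), e2]
      simp only [Nat.cast_zero, zero_sub, neg_neg, zero_add, add_neg_cancel, invPoch_zero, sub_self,
        add_zero, zpow_zero, tri_one, e1, qPoch, Finset.prod_range_one,
        zpow_neg_one, mul_one, one_mul, pow_zero, inv_neg_one] at h1 h2 h3 h4 ⊢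
      have e3 : 1 - q⁻¹ * x = (q - x) / q := by field_simp
      have h5 : q - x ≠ 0 := fun h0 => h4 (by rw [e3, h0, zero_div])
      have h6 : x - q ≠ 0 := fun h0 => h5 (by linear_combination -h0)
      have e4 : 1 - q / x = (x - q) / x := by field_simp
      rw [e3, e4]
      field_simp
      ring
    · intro k hk
      simp only [Finset.mem_insert, Finset.mem_singleton, not_or] at hk
      rcases lt_or_ge k 0 with h0 | h0
      · rw [invPoch_of_neg q (m := _ + 1 + k) (by push_cast; omega), mul_zero, mul_zero]
      · rw [invPoch_of_neg q (m := _ - k) (by push_cast; omega), zero_mul, mul_zero]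
  | succ n ih =>
    rw [qPoch_succ x, qPoch_succ (q / x), mul_mul_mul_comm, mul_inv, ← ih]
    -- Multiplying the expansion for `n + 1` by the two new factors gives that for `n`, up to
    -- multiples of two alternating sums that vanish.
    have hA : (1 - x * q ^ (n + 1)) * (1 - q / x * q ^ (n + 1)) ≠ 0 := mul_ne_zero (h'' _) (h' _)
    rw [eq_mul_inv_iff_mul_eq₀ hA]
    have s1 := (summable_invPoch_window (fun k => (-1) ^ k * q ^ tri (k + 1) / (1 - q ^ k * x)) q
      (n + 1 : ℕ) ((n + 1 : ℕ) + 1)).hasSum.mul_right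
        ((1 - x * q ^ (n + 1)) * (1 - q / x * q ^ (n + 1)))
    refine s1.unique ?_
    have s2 := (summable_invPoch_window (fun k => (-1) ^ k * q ^ tri (k + 1) / (1 - q ^ k * x)) q
      n (n + 1)).hasSum
    have s3 := (summable_invPoch_window (fun k => (-1) ^ k * q ^ tri k) q
      (n + 1 : ℕ) ((n + 1 : ℕ) + 1)).hasSum
    have s4 := (summable_invPoch_window (fun k => (-1) ^ k * q ^ tri (k + 1)) q
      (n + 1 : ℕ) ((n + 1 : ℕ) + 1)).hasSum
    rw [tsum_window_eq_zero hq0 hq n (by positivity)] at s3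
    rw [tsum_window_symm] at s4
    have s5 := (s2.add (s3.mul_left (q ^ (n + 1)))).sub (s4.mul_left (q / x * q ^ (n + 1)))
    rw [mul_zero, mul_zero, add_zero, sub_zero] at s5
    refine s5.congr_fun fun k => ?_
    have hk := h k
    have i1 := invPoch_sub_one hq ((n + 1 : ℕ) - k)
    have i2 := invPoch_sub_one hq ((n + 1 : ℕ) + 1 + k)
    rw [show ((n + 1 : ℕ) : ℤ) - k - 1 = n - k by push_cast; ring] at i1
    rw [show ((n + 1 : ℕ) : ℤ) + 1 + k - 1 = n + 1 + k by push_cast; ring] at i2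
    rw [i1, i2]
    have ea : q ^ (((n + 1 : ℕ) : ℤ) - k) = q ^ (n + 1) / q ^ k := by
      rw [zpow_sub₀ hq0, zpow_natCast]
    have eb : q ^ (((n + 1 : ℕ) : ℤ) + 1 + k) = q ^ (n + 1) * q * q ^ k := by
      rw [zpow_add₀ hq0, zpow_add₀ hq0, zpow_natCast, zpow_one]
    have et : q ^ tri (k + 1) = q ^ tri k * q ^ k := by rw [tri_add_one, zpow_add₀ hq0]
    have hz := zpow_ne_zero k hq0
    rw [ea, eb, et]
    field_simp
    ring

/-! ### The Lambert series of `ψ` -/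

theorem qPoch_bisect (x q : ℂ) (n : ℕ) : qPoch x q (2 * n) =
    qPoch x (q ^ 2) n * qPoch (x * q) (q ^ 2) n := by
  induction n with
  | zero => simp [qPoch]
  | succ n ih =>
    rw [show 2 * (n + 1) = 2 * n + 1 + 1 by ring, qPoch_succ, qPoch_succ, ih,
      qPoch_succ, qPoch_succ, ← pow_mul]
    ring

/-- The terms of index `2 n + 1` and `2 n + 2` of `ψ` are combined. -/
theorem psi_eq_tsum_pairs {q : ℂ} (hq0 : q ≠ 0) (hq : ‖q‖ < 1) :
    HasSum (fun n : ℕ => q ^ (4 * (n ^ 2 + n) + 1) *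
      (qPoch q (q ^ 4) (n + 1) * qPoch (q ^ 3) (q ^ 4) (n + 1))⁻¹) (psi q) := by
  have hs := summable_psiTerm hq0 hq
  have h1 : Summable fun k : ℕ => psiTerm q (2 * k + 1) :=
    hs.comp_injective (i := fun k : ℕ => 2 * k) fun a b h => by simpa using h
  have h2 : Summable fun k : ℕ => psiTerm q (2 * k + 1 + 1) :=
    hs.comp_injective (i := fun k : ℕ => 2 * k + 1) fun a b h => by simpa using h
  have h := h1.hasSum.add h2.hasSum
  rw [tsum_even_add_odd (f := fun n => psiTerm q (n + 1)) h1 h2] at h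
  refine h.congr_fun fun k => ?_
  have e := qPoch_bisect q (q ^ 2) (k + 1)
  rw [← pow_mul, ← pow_succ'] at e
  have hne := qPoch_odd_ne_zero hq (2 * k + 1 + 1)
  rw [← e, psiTerm, psiTerm, show 2 * (k + 1) = 2 * k + 1 + 1 by ring]
  rw [qPoch_succ] at hne ⊢
  have h3 := left_ne_zero_of_mul hne
  have h4 := right_ne_zero_of_mul hne
  field_simp
  ring

theorem summable_sq_add_self {q : ℂ} (hq0 : q ≠ 0) (hq : ‖q‖ < 1) :
    Summable fun n : ℤ => ‖q ^ (n ^ 2 + n)‖ := by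
  have h := summable_theta_majorant 1 (pow_ne_zero 2 hq0) (norm_sq_lt_one hq)
  rw [← (Equiv.addRight (1 : ℤ)).summable_iff] at h
  refine h.congr fun n => ?_
  simp only [Function.comp, Equiv.coe_addRight, one_pow, one_mul]
  rw [← zpow_natCast q 2, ← zpow_mul]
  congr 2
  have := two_mul_tri (n + 1)
  push_cast
  linear_combination this

/-- Cauchy's identity with the summation index shifted by `k`. -/
theorem hasSum_sq_window {q : ℂ} (hq0 : q ≠ 0) (hq : ‖q‖ < 1) (k : ℤ) :
    HasSum (fun n : ℤ => q ^ (n ^ 2 + n) * (invPoch q (n - k) * invPoch q (n + 1 + k)))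
      (q ^ (k ^ 2 + k) / qPochInf q q) := by
  have h := (hasSum_cauchy hq0 hq (2 * k + 1)).mul_left (q ^ (k ^ 2 + k))
  rw [← (Equiv.subRight k).hasSum_iff, mul_one_div] at h
  refine h.congr_fun fun n => ?_
  simp only [Function.comp, Equiv.subRight_apply]
  have e : q ^ (n ^ 2 + n) = q ^ (k ^ 2 + k) * q ^ ((n - k) ^ 2 + (n - k) * (2 * k + 1)) := by
    rw [← zpow_add₀ hq0]; congr 1; ring
  rw [show n - k + (2 * k + 1) = n + 1 + k by ring, e]
  ring

/-- Each summand is expanded in partial fractions, and the sum over `n` is evaluated first. -/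
theorem hasSum_reciprocal_products {q x : ℂ} (hq0 : q ≠ 0) (hq : ‖q‖ < 1) (hx : x ≠ 0)
    (ht : theta x q ≠ 0) :
    HasSum (fun n : ℕ => q ^ (n ^ 2 + n) * (qPoch x q (n + 1) * qPoch (q / x) q (n + 1))⁻¹)
      ((∑' k : ℤ, (-1) ^ k * (q ^ 3) ^ tri k * (q ^ 3) ^ k / (1 - q ^ k * x)) /
        qPochInf q q) := by
  have hne := one_sub_zpow_mul_ne_zero hq hq0 hx ht
  obtain ⟨C, hC, hb⟩ := exists_norm_inv_one_sub_le hq hq0 hx hne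
  obtain ⟨B, hB, hb'⟩ := exists_norm_invPoch_le hq
  let f : ℤ → ℂ := fun k => (-1) ^ k * q ^ tri (k + 1) / (1 - q ^ k * x)
  let g : ℤ → ℤ → ℂ := fun k n => q ^ (n ^ 2 + n) * (invPoch q (n - k) * invPoch q (n + 1 + k))
  have hf : Summable fun k : ℤ => ‖q ^ tri (k + 1)‖ * C := by
    have h := summable_theta_majorant 1 hq0 hq
    rw [← (Equiv.addRight (1 : ℤ)).summable_iff] at h
    refine (h.congr fun n => ?_).mul_right C
    simp only [Function.comp, Equiv.coe_addRight, one_pow, one_mul]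
  have hg : Summable fun n : ℤ => ‖q ^ (n ^ 2 + n)‖ * (B * B) :=
    (summable_sq_add_self hq0 hq).mul_right _
  have hF : Summable fun p : ℤ × ℤ => f p.1 * g p.1 p.2 := by
    refine Summable.of_norm_bounded (summable_prod_mul_real
      (f := fun k : ℤ => ‖q ^ tri (k + 1)‖ * C) (g := fun n : ℤ => ‖q ^ (n ^ 2 + n)‖ * (B * B))
      hf hg (fun k => by positivity) fun n => by positivity) fun p => ?_
    have h1 : ‖f p.1‖ ≤ ‖q ^ tri (p.1 + 1)‖ * C := by
      simp only [f]
      rw [div_eq_mul_inv, norm_mul, norm_mul, norm_neg_one_zpow, one_mul]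
      exact mul_le_mul_of_nonneg_left (hb _) (norm_nonneg _)
    have h2 : ‖g p.1 p.2‖ ≤ ‖q ^ (p.2 ^ 2 + p.2)‖ * (B * B) := by
      simp only [g]
      rw [norm_mul, norm_mul (invPoch q _)]
      exact mul_le_mul_of_nonneg_left (mul_le_mul (hb' _) (hb' _) (norm_nonneg _) hB.le)
        (norm_nonneg _)
    rw [norm_mul]
    exact mul_le_mul h1 h2 (norm_nonneg _) (by positivity)
  have s1 : HasSum (fun k : ℤ => f k * (q ^ (k ^ 2 + k) / qPochInf q q))
      (∑' p : ℤ × ℤ, f p.1 * g p.1 p.2) :=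
    hF.hasSum.prod_fiberwise fun k => (hasSum_sq_window hq0 hq k).mul_left (f k)
  have s2 := s1.tsum_eq
  have s3 : ∑' k : ℤ, f k * (q ^ (k ^ 2 + k) / qPochInf q q) =
      (∑' k : ℤ, (-1) ^ k * (q ^ 3) ^ tri k * (q ^ 3) ^ k / (1 - q ^ k * x)) / qPochInf q q := by
    rw [← tsum_div_const]
    refine tsum_congr fun k => ?_
    have e : (q ^ 3) ^ tri k * (q ^ 3) ^ k = q ^ tri (k + 1) * q ^ (k ^ 2 + k) := by
      have := two_mul_tri k
      rw [← zpow_natCast q 3, ← zpow_mul, ← zpow_mul, ← zpow_add₀ hq0, ← zpow_add₀ hq0,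
        tri_add_one]
      congr 1; push_cast; linear_combination this
    rw [mul_assoc _ ((q ^ 3) ^ tri k), e]
    simp only [f]
    ring
  have s4 := (Equiv.prodComm ℤ ℤ).hasSum_iff.mpr hF.hasSum
  have s5 : HasSum (fun n : ℤ => ∑' k : ℤ, f k * g k n) (∑' p : ℤ × ℤ, f p.1 * g p.1 p.2) :=
    s4.prod_fiberwise fun n => (s4.summable.prod_factor n).hasSum
  rw [← s2, s3] at s5
  rw [← (Nat.cast_injective (R := ℤ)).hasSum_iff] at s5
  · refine s5.congr_fun fun n => ?_
    simp only [Function.comp]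
    rw [← tsum_partial_fraction hq0 hq hx hne, ← tsum_mul_left]
    refine tsum_congr fun k => ?_
    simp only [f, g]
    rw [← zpow_natCast]
    push_cast
    ring
  · intro n hn
    have hn0 : n < 0 := by
      by_contra h0
      exact hn ⟨n.toNat, by simp; omega⟩
    refine (tsum_congr fun k => ?_).trans tsum_zero
    simp only [g]
    rcases lt_or_ge n k with h0 | h0
    · rw [invPoch_of_neg q (m := n - k) (by omega), zero_mul, mul_zero, mul_zero]
    · rw [invPoch_of_neg q (m := n + 1 + k) (by omega), mul_zero, mul_zero, mul_zero]

theorem lerch_inv {p w ζ : ℂ} (hp0 : p ≠ 0) (hw : w ≠ 0) :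
    lerch p w⁻¹ ζ = -w * lerch p w (p ^ 2 / ζ) := by
  rw [lerch, lerch, ← (Equiv.neg ℤ).tsum_eq, ← tsum_mul_left]
  refine tsum_congr fun r => ?_
  have hpr := zpow_ne_zero r hp0
  have e : 1 - p ^ (-r) * w⁻¹ = (1 - p ^ r * w) * (-(p ^ r * w)⁻¹) := by
    rw [zpow_neg]; field_simp; ring
  rw [Equiv.neg_apply, e, div_eq_mul_inv, mul_inv, div_zpow, tri_neg, zpow_add₀ hp0, zpow_neg ζ,
    zpow_neg (-1 : ℂ), ← inv_zpow, inv_neg_one, inv_neg, inv_inv, ← zpow_natCast p 2, ← zpow_mul,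
    mul_comm ((2 : ℕ) : ℤ) r, zpow_mul, zpow_natCast]
  ring

theorem lerch_div {p w ζ : ℂ} (hp0 : p ≠ 0) (hζ : ζ ≠ 0) :
    lerch p (w / p) ζ = -ζ * lerch p w (p * ζ) := by
  rw [lerch, lerch, ← (Equiv.addRight (1 : ℤ)).tsum_eq, ← tsum_mul_left]
  refine tsum_congr fun r => ?_
  rw [Equiv.coe_addRight, show p ^ (r + 1) * (w / p) = p ^ r * w by
    rw [zpow_add_one₀ hp0]; field_simp, tri_add_one, zpow_add₀ hp0, zpow_add_one₀ hζ,
    zpow_add_one₀ (by norm_num : (-1 : ℂ) ≠ 0), mul_zpow]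
  ring

theorem psi_eq_tsum_lambert {q : ℂ} (hq0 : q ≠ 0) (hq : ‖q‖ < 1) :
    psi q * qPochInf (q ^ 4) (q ^ 4) =
      q * ∑' k : ℤ, (-1) ^ k * (q ^ 12) ^ tri k * (q ^ 12) ^ k / (1 - (q ^ 4) ^ k * q) := by
  have hp := norm_pow_lt_one hq (n := 4) (by norm_num)
  have ht : theta q (q ^ 4) ≠ 0 := theta_ne_zero_of_norm (a := 1) (b := 4) hq hq0
    (by norm_num) (norm_pow_eq_zpow q 4) (by simp) (by norm_num)
  have h := (hasSum_reciprocal_products (pow_ne_zero 4 hq0) hp hq0 ht).mul_left q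
  rw [show q ^ 4 / q = q ^ 3 by field_simp, ← pow_mul] at h
  have h2 := h.unique ((psi_eq_tsum_pairs hq0 hq).congr_fun fun n => by
    rw [← pow_mul, pow_succ]; ring)
  have := qPochInf_self_ne_zero hp
  rw [← h2]
  field_simp

/-- The trisection of the denominators, from `1 / (1 - u) = (1 + u + u^2) / (1 - u^3)`. -/
theorem psi_eq_lerch {q : ℂ} (hq0 : q ≠ 0) (hq : ‖q‖ < 1) :
    psi q * qPochInf (q ^ 4) (q ^ 4) = q * (lerch (q ^ 12) (q ^ 3) (q ^ 12) +
      q * lerch (q ^ 12) (q ^ 3) (q ^ 16) + q ^ 2 * lerch (q ^ 12) (q ^ 3) (q ^ 20)) := by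
  have hp := norm_pow_lt_one hq (n := 12) (by norm_num)
  have hp0 := pow_ne_zero 12 hq0
  have hw := pow_ne_zero 3 hq0
  have ht : theta (q ^ 3) (q ^ 12) ≠ 0 := theta_ne_zero_of_norm (a := 3) (b := 12) hq hq0
    (by norm_num) (norm_pow_eq_zpow q 12) (norm_pow_eq_zpow q 3) (by norm_num)
  rw [psi_eq_tsum_lambert hq0 hq]
  congr 1
  have s := hasSum_lerch hp hp0 hw ht
  refine HasSum.tsum_eq ((((s (q ^ 12)).add ((s (q ^ 16)).mul_left q)).add
    ((s (q ^ 20)).mul_left (q ^ 2))).congr_fun fun k => ?_)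
  have h1 := one_sub_zpow_mul_ne_zero hp hp0 hw ht k
  have e : ∀ n : ℕ, (q ^ n) ^ k = (q ^ k) ^ n := fun n => by
    rw [← zpow_natCast, ← zpow_natCast, ← zpow_mul, ← zpow_mul, mul_comm]
  have h2 : 1 - (q ^ 12) ^ k * q ^ 3 = (1 - (q ^ 4) ^ k * q) *
      (1 + (q ^ 4) ^ k * q + ((q ^ 4) ^ k * q) ^ 2) := by
    rw [e 12, e 4]; ring
  rw [h2] at h1 ⊢
  have h3 := left_ne_zero_of_mul h1
  have h4 := right_ne_zero_of_mul h1
  have key : (1 - (q ^ 4) ^ k * q)⁻¹ = (1 + (q ^ 4) ^ k * q + ((q ^ 4) ^ k * q) ^ 2) *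
      ((1 - (q ^ 4) ^ k * q) * (1 + (q ^ 4) ^ k * q + ((q ^ 4) ^ k * q) ^ 2))⁻¹ := by
    rw [mul_inv, mul_left_comm, mul_inv_cancel₀ h4, mul_one]
  rw [div_eq_mul_inv, div_eq_mul_inv, div_eq_mul_inv, div_eq_mul_inv, key]
  generalize ((1 - (q ^ 4) ^ k * q) * (1 + (q ^ 4) ^ k * q + ((q ^ 4) ^ k * q) ^ 2))⁻¹ = X
  rw [e 4, e 12, e 16, e 20]
  ring

/-- The case `z = p` of `theta_mul_lerch_eq` with nome `p^3`. -/
theorem lerch_quadrisection {p : ℂ} (hp0 : p ≠ 0) (hp : ‖p‖ < 1) :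
    (theta p (p ^ 3))⁻¹ * lerch (p ^ 3) (-p⁻¹) p = (theta (p ^ 4) (p ^ 12))⁻¹ *
      (lerch (p ^ 12) (-(p ^ 3)⁻¹) (p ^ 4) + p⁻¹ ^ 2 * lerch (p ^ 12) (-(p ^ 3)⁻¹ ^ 3) (p ^ 4)) := by
  have ht : theta p (p ^ 3) ≠ 0 := theta_ne_zero_of_norm (a := 1) (b := 3) hp hp0
    (by norm_num) (norm_pow_eq_zpow p 3) (by simp) (by norm_num)
  have hn : theta (-p⁻¹) (p ^ 3) ≠ 0 := theta_ne_zero_of_norm (a := -1) (b := 3) hp hp0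
    (by norm_num) (norm_pow_eq_zpow p 3) (by simp) (by norm_num)
  have h4 : theta (p ^ 4) (p ^ 12) ≠ 0 := theta_ne_zero_of_norm (a := 4) (b := 12) hp hp0
    (by norm_num) (norm_pow_eq_zpow p 12) (norm_pow_eq_zpow p 4) (by norm_num)
  have h := theta_mul_lerch_eq (norm_pow_lt_one hp (n := 3) (by norm_num)) (pow_ne_zero 3 hp0)
    hp0 ht hn
  rw [← pow_mul] at h
  norm_num only at h
  rw [← h]
  field_simp

theorem psi_eq_appellM_add_eta {q : ℂ} (hq0 : q ≠ 0) (hq : ‖q‖ < 1) :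
    psi q = -appellM q (-q ^ 3) (-q) + q * (etaJ 12 q ^ 3 / (thetaJ 4 12 q * thetaJ 3 12 q)) := by
  have hp := norm_pow_lt_one hq (n := 12) (by norm_num)
  have hp0 := pow_ne_zero 12 hq0
  have hw := pow_ne_zero 3 hq0
  have ht : theta (q ^ 3) (q ^ 12) ≠ 0 := theta_ne_zero_of_norm (a := 3) (b := 12) hq hq0
    (by norm_num) (norm_pow_eq_zpow q 12) (norm_pow_eq_zpow q 3) (by norm_num)
  have h4 : theta (q ^ 4) (q ^ 12) = qPochInf (q ^ 4) (q ^ 4) := by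
    rw [← theta_self_cube (pow_ne_zero 4 hq0) (norm_pow_lt_one hq (by norm_num)), ← pow_mul]
  have hE := qPochInf_self_ne_zero (norm_pow_lt_one hq (n := 4) (by norm_num))
  have h1 := psi_eq_lerch hq0 hq
  have h2 := lerch_quadrisection (p := -q) (neg_ne_zero.mpr hq0) (by rwa [norm_neg])
  have e3 : (-q) ^ 3 = -q ^ 3 := by ring
  have e4 : (-q) ^ 4 = q ^ 4 := by ring
  have e12 : (-q) ^ 12 = q ^ 12 := by ring
  rw [e3, e4, e12, h4, show -(-q)⁻¹ = q⁻¹ by rw [inv_neg, neg_neg],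
    show -(-q ^ 3)⁻¹ = (q ^ 3)⁻¹ by rw [inv_neg, neg_neg],
    show -(-q ^ 3)⁻¹ ^ 3 = (q ^ 9)⁻¹ by rw [inv_neg, ← inv_pow]; ring] at h2
  have e9 : (q ^ 9)⁻¹ = q ^ 3 / q ^ 12 := by field_simp
  rw [lerch_inv hp0 hw, e9, lerch_div hp0 (pow_ne_zero 4 hq0),
    show (q ^ 12) ^ 2 / q ^ 4 = q ^ 20 by field_simp, ← pow_add] at h2
  norm_num only at h2
  rw [lerch_self hp hp0 hw ht] at h1
  rw [appellM_eq_lerch (by simpa using hw), show q * -q / -q ^ 3 = q⁻¹ by field_simp, h2, etaJ, thetaJ,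
    thetaJ]
  simp only [zpow_ofNat]
  rw [h4]
  refine mul_right_cancel₀ hE ?_
  rw [h1]
  field_simp
  ring

/-! ### The double sum with parameters `(3,5,3)`: functional equations -/

/-- The boundary term `(-y)^i q^{3 i(i-1)/2} j(q^{5i} x; q^3)` produced by the `i`-th shift of the
second index in `f_{3,5,3}(x,y,q)`. -/
noncomputable def shiftTheta (q : ℂ) (i : ℤ) (x y : ℂ) : ℂ :=
  (-y) ^ i * q ^ (3 * tri i) * theta (q ^ (5 * i) * x) (q ^ 3)

theorem heckeF_353_iterate {q x y : ℂ} (hq0 : q ≠ 0) (hq : ‖q‖ < 1) (hx : x ≠ 0) (hy : y ≠ 0)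
    (n : ℕ) : heckeF 3 5 3 x y q = ∑ m ∈ Finset.range n, shiftTheta q m x y +
      (-y) ^ n * q ^ (3 * tri n) * heckeF 3 5 3 (q ^ (5 * n) * x) (q ^ (3 * n) * y) q := by
  induction n with
  | zero => simp
  | succ n ih =>
    rw [ih, heckeF_shift_right (by norm_num) (by norm_num) (by norm_num) hq0 hq
      (mul_ne_zero (pow_ne_zero _ hq0) hx) (mul_ne_zero (pow_ne_zero _ hq0) hy),
      Finset.sum_range_succ, shiftTheta, Nat.cast_succ, tri_add_one, mul_add, zpow_add₀ hq0]
    have e1 : q ^ (3 * (n : ℤ)) = q ^ (3 * n) := by exact_mod_cast zpow_natCast q (3 * n)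
    have e2 : q ^ (5 * (n : ℤ)) = q ^ (5 * n) := by exact_mod_cast zpow_natCast q (5 * n)
    have e3 : q ^ (5 : ℤ) * (q ^ (5 * n) * x) = q ^ (5 * (n + 1)) * x := by
      rw [zpow_ofNat]; ring
    have e4 : q ^ (3 : ℤ) * (q ^ (3 * n) * y) = q ^ (3 * (n + 1)) * y := by
      rw [zpow_ofNat]; ring
    rw [e1, e2, e3, e4, zpow_natCast, zpow_ofNat]
    ring

/-- Shifting the second index four times in `f(x,y)`, and the first index four times in
`f(q^8 x, q^{-8} y)`, leads to the same value `f(q^20 x, q^12 y)`. -/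
theorem heckeF_353_quasi {q x y : ℂ} (hq0 : q ≠ 0) (hq : ‖q‖ < 1) (hx : x ≠ 0) (hy : y ≠ 0) :
    heckeF 3 5 3 (q ^ 8 * x) (y / q ^ 8) q = q ^ 32 * (x / y) ^ 4 *
      (heckeF 3 5 3 x y q - ∑ m ∈ Finset.range 4, shiftTheta q m x y) +
      ∑ m ∈ Finset.range 4, shiftTheta q m (y / q ^ 8) (q ^ 8 * x) := by
  have h8 := pow_ne_zero 8 hq0
  have h1 := heckeF_353_iterate hq0 hq hx hy 4
  have h2 := heckeF_353_iterate hq0 hq (div_ne_zero hy h8) (mul_ne_zero h8 hx) 4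
  rw [heckeF_swap, heckeF_swap 3 5 3 (q ^ _ * (y / q ^ 8))] at h2
  rw [h1, h2]
  have e1 : q ^ (3 * 4) * (q ^ 8 * x) = q ^ (5 * 4) * x := by ring
  have e2 : q ^ (5 * 4) * (y / q ^ 8) = q ^ (3 * 4) * y := by field_simp; ring
  rw [e1, e2]
  field_simp
  ring

theorem shiftTheta_add_three {q x : ℂ} (hq0 : q ≠ 0) (hq : ‖q‖ < 1) (hx : x ≠ 0) {y : ℂ}
    (hy : y ≠ 0) (i : ℤ) : shiftTheta q (i + 3) x y =
      y ^ 3 * (x ^ 5)⁻¹ * q ^ (-21 - 16 * i) * shiftTheta q i x y := by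
  have hp := norm_pow_lt_one hq (n := 3) (by norm_num)
  have h := theta_zpow_mul hp (pow_ne_zero 3 hq0) (mul_ne_zero (zpow_ne_zero (5 * i) hq0) hx) 5
  have e : (q ^ 3) ^ (5 : ℤ) * (q ^ (5 * i) * x) = q ^ (5 * (i + 3)) * x := by
    rw [← zpow_natCast q 3, ← zpow_mul, ← mul_assoc, ← zpow_add₀ hq0]
    congr 2; push_cast; ring
  have t3 : tri 3 = 3 := by decide
  have t5 : tri 5 = 10 := by decide
  have eq : q ^ (3 * tri (i + 3)) * ((q ^ 3) ^ (-tri 5) * (q ^ (5 * i)) ^ (-5 : ℤ)) =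
      q ^ (-21 - 16 * i) * q ^ (3 * tri i) := by
    rw [← zpow_natCast q 3, ← zpow_mul, ← zpow_mul, ← zpow_add₀ hq0, ← zpow_add₀ hq0,
      ← zpow_add₀ hq0, tri_add, t3, t5]
    congr 1; push_cast; ring
  rw [e, mul_zpow _ x] at h
  rw [shiftTheta, shiftTheta, h, zpow_add₀ (neg_ne_zero.mpr hy), zpow_neg x, zpow_ofNat,
    zpow_ofNat, zpow_ofNat]
  linear_combination (-y) ^ i * y ^ 3 * (x ^ 5)⁻¹ * theta (q ^ (5 * i) * x) (q ^ 3) * eq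

theorem shiftTheta_shift {q x : ℂ} (hq0 : q ≠ 0) (hq : ‖q‖ < 1) (hx : x ≠ 0) {y : ℂ}
    (hy : y ≠ 0) (i : ℤ) : shiftTheta q i (q ^ 8 * x) (y / q ^ 8) =
      q ^ 32 * (x / y) ^ 4 * shiftTheta q (i + 4) x y := by
  have hp := norm_pow_lt_one hq (n := 3) (by norm_num)
  have h8 := pow_ne_zero 8 hq0
  have h := theta_zpow_mul hp (pow_ne_zero 3 hq0)
    (mul_ne_zero (zpow_ne_zero (5 * i) hq0) (mul_ne_zero h8 hx)) 4
  have e : (q ^ 3) ^ (4 : ℤ) * (q ^ (5 * i) * (q ^ 8 * x)) = q ^ (5 * (i + 4)) * x := by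
    rw [← zpow_natCast q 3, ← zpow_natCast q 8, ← zpow_mul, ← mul_assoc, ← mul_assoc,
      ← zpow_add₀ hq0, ← zpow_add₀ hq0]
    congr 2; push_cast; ring
  have t4 : tri 4 = 6 := by decide
  have eq : q ^ 32 * (q ^ (3 * tri (i + 4)) * ((q ^ 3) ^ (-tri 4) * ((q ^ (5 * i)) ^ (-4 : ℤ) *
      (q ^ 8) ^ (-4 : ℤ)))) = (q ^ 8) ^ (-i) * q ^ (3 * tri i) := by
    rw [← zpow_natCast q 3, ← zpow_natCast q 8, ← zpow_natCast q 32, ← zpow_mul, ← zpow_mul,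
      ← zpow_mul, ← zpow_mul, ← zpow_add₀ hq0, ← zpow_add₀ hq0, ← zpow_add₀ hq0, ← zpow_add₀ hq0,
      ← zpow_add₀ hq0, tri_add, t4]
    congr 1; push_cast; ring
  rw [e, mul_zpow, mul_zpow (q ^ 8)] at h
  rw [shiftTheta, shiftTheta, h, zpow_add₀ (neg_ne_zero.mpr hy), zpow_neg x,
    show -(y / q ^ 8) = -y * (q ^ 8)⁻¹ by ring, mul_zpow, inv_zpow', zpow_ofNat, zpow_ofNat,
    zpow_ofNat, mul_assoc ((-y) ^ i), ← eq]
  field_simp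

/-- The part `shiftTheta q i x y * ∑ (-1)^r Q^{r(r-1)/2} ζ^r / (1 - p^{3r-1-i} w)` of the
Appell-Lerch side, where `p = q^16`, `Q = q^48`, `ζ = (x/y)^3`, `w = -q^{-5} x^{-2}`, multiplied
by `j(w;p)`. -/
noncomputable def appellPart (q : ℂ) (i : ℤ) (x y : ℂ) : ℂ :=
  shiftTheta q i x y *
    regAppell (fun r => 3 * r - 1 - i) (q ^ 16) (-(q ^ 5 * x ^ 2)⁻¹) (q ^ 48) ((x / y) ^ 3)

theorem regAppell_sub_three {p w ζ : ℂ} (hp : ‖p‖ < 1) (hp0 : p ≠ 0) (hw : w ≠ 0) (hζ : ζ ≠ 0)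
    (i : ℤ) : regAppell (fun r => 3 * r - 1 - (i + 3)) p w (p ^ 3) ζ =
      -(ζ * p ^ (1 + i) * w⁻¹) * (regAppell (fun r => 3 * r - 1 - i) p w (p ^ 3) ζ -
        theta w p * theta ζ (p ^ 3)) := by
  have hQ := norm_pow_lt_one hp (n := 3) (by norm_num)
  have hQ0 := pow_ne_zero 3 hp0
  have s1 := (summable_regAppell hp hQ0 hQ (fun r => 3 * r - 1 - (i + 3)) w ζ).hasSum
  rw [← (Equiv.addRight (1 : ℤ)).hasSum_iff] at s1
  have s2 := (summable_regAppell hp hQ0 hQ (fun r => 3 * r - 1 - i) w ζ).hasSum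
  have t := hasSum_theta hQ0 hQ hζ
  have s3 := (s2.sub (t.mul_left (theta w p))).mul_left (-(ζ * p ^ (1 + i) * w⁻¹))
  refine s1.unique (s3.congr_fun fun r => ?_)
  simp only [Function.comp, Equiv.coe_addRight]
  have e : (p ^ 3) ^ r = p ^ (1 + i) * p ^ (3 * r - 1 - i) := by
    rw [← zpow_natCast p 3, ← zpow_mul, ← zpow_add₀ hp0]; congr 1; push_cast; ring
  rw [show 3 * (r + 1) - 1 - (i + 3) = 3 * r - 1 - i by ring, ← regTheta_mul hp hp0 hw
    (3 * r - 1 - i), tri_add_one, zpow_add₀ hQ0, e, zpow_add_one₀ hζ,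
    zpow_add_one₀ (by norm_num : (-1 : ℂ) ≠ 0)]
  field_simp
  ring

theorem regAppell_div_three {p w ζ : ℂ} (hp : ‖p‖ < 1) (hp0 : p ≠ 0) (hw : w ≠ 0) (hζ : ζ ≠ 0)
    (i : ℤ) : regAppell (fun r => 3 * r - 1 - i) p (w / p) (p ^ 3) (p ^ 3 * ζ) =
      w / p * ζ⁻¹ * regAppell (fun r => 3 * r - 1 - (i + 4)) p w (p ^ 3) ζ := by
  have hQ0 := pow_ne_zero 3 hp0
  rw [regAppell, regAppell, ← (Equiv.subRight (1 : ℤ)).tsum_eq, ← tsum_mul_left]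
  refine tsum_congr fun r => ?_
  have t := tri_add_one (r - 1)
  rw [sub_add_cancel] at t
  rw [Equiv.subRight_apply, regTheta_div_q hp hp0 hw, t, zpow_add₀ hQ0,
    show 3 * (r - 1) - 1 - i - 1 = 3 * r - 1 - (i + 4) by ring, mul_zpow,
    zpow_sub_one₀ hζ, zpow_sub_one₀ (by norm_num : (-1 : ℂ) ≠ 0), inv_neg_one]
  field_simp

/-- The index `i` matters modulo `3` only, up to an explicit theta function. -/
theorem appellPart_add_three {q x y : ℂ} (hq0 : q ≠ 0) (hq : ‖q‖ < 1) (hx : x ≠ 0) (hy : y ≠ 0)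
    (i : ℤ) : appellPart q (i + 3) x y = appellPart q i x y -
      shiftTheta q i x y * (theta (-(q ^ 5 * x ^ 2)⁻¹) (q ^ 16) * theta ((x / y) ^ 3) (q ^ 48)) := by
  have hp := norm_pow_lt_one hq (n := 16) (by norm_num)
  have hp0 := pow_ne_zero 16 hq0
  have hw : -(q ^ 5 * x ^ 2)⁻¹ ≠ 0 :=
    neg_ne_zero.mpr (inv_ne_zero (mul_ne_zero (pow_ne_zero 5 hq0) (pow_ne_zero 2 hx)))
  have h := regAppell_sub_three hp hp0 hw (pow_ne_zero 3 (div_ne_zero hx hy)) i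
  rw [← pow_mul] at h
  norm_num only at h
  have e : q ^ (-21 - 16 * i) * (q ^ 16) ^ (1 + i) * q ^ 5 = 1 := by
    rw [← zpow_natCast q 16, ← zpow_natCast q 5, ← zpow_mul, ← zpow_add₀ hq0, ← zpow_add₀ hq0]
    rw [show -21 - 16 * i + ((16 : ℕ) : ℤ) * (1 + i) + (5 : ℕ) = 0 by push_cast; ring, zpow_zero]
  rw [appellPart, appellPart, h, shiftTheta_add_three hq0 hq hx hy, ← mul_sub]
  have e2 : y ^ 3 * (x ^ 5)⁻¹ * q ^ (-21 - 16 * i) * -((x / y) ^ 3 * (q ^ 16) ^ (1 + i) *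
      (-(q ^ 5 * x ^ 2)⁻¹)⁻¹) = 1 := by
    rw [← e, inv_neg, inv_inv]
    field_simp
  linear_combination shiftTheta q i x y * (regAppell (fun r => 3 * r - 1 - i) (q ^ 16)
    (-(q ^ 5 * x ^ 2)⁻¹) (q ^ 48) ((x / y) ^ 3) - theta (-(q ^ 5 * x ^ 2)⁻¹) (q ^ 16) *
      theta ((x / y) ^ 3) (q ^ 48)) * e2

theorem appellPart_shift {q x y : ℂ} (hq0 : q ≠ 0) (hq : ‖q‖ < 1) (hx : x ≠ 0) (hy : y ≠ 0)
    (i : ℤ) : appellPart q i (q ^ 8 * x) (y / q ^ 8) =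
      -(q ^ 11 * (x * y)⁻¹) * appellPart q (i + 4) x y := by
  have hp := norm_pow_lt_one hq (n := 16) (by norm_num)
  have hp0 := pow_ne_zero 16 hq0
  have hw : -(q ^ 5 * x ^ 2)⁻¹ ≠ 0 :=
    neg_ne_zero.mpr (inv_ne_zero (mul_ne_zero (pow_ne_zero 5 hq0) (pow_ne_zero 2 hx)))
  have h := regAppell_div_three hp hp0 hw (pow_ne_zero 3 (div_ne_zero hx hy)) i
  rw [← pow_mul] at h
  norm_num only at h
  rw [appellPart, appellPart, shiftTheta_shift hq0 hq hx hy,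
    show (q ^ 8 * x / (y / q ^ 8)) ^ 3 = q ^ 48 * (x / y) ^ 3 by field_simp,
    show -(q ^ 5 * (q ^ 8 * x) ^ 2)⁻¹ = -(q ^ 5 * x ^ 2)⁻¹ / q ^ 16 by field_simp, h]
  field_simp

/-- The sum of Appell-Lerch series attached to `f_{3,5,3}(x,y,q)` by the shifts of the second
index, multiplied by the theta functions in its denominators. Exchanging `x` and `y` gives the
part attached to the first index. -/
noncomputable def appellSide (q x y : ℂ) : ℂ := ∑ i ∈ Finset.range 3, appellPart q i x y

/-- The shift moves the three parts with indices `0, 1, 2` to `4, 5, 6`; returning to `0, 1, 2`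
produces the same boundary terms as for the double sum. -/
theorem appellSide_shift {q x y : ℂ} (hq0 : q ≠ 0) (hq : ‖q‖ < 1) (hx : x ≠ 0) (hy : y ≠ 0) :
    appellSide q (q ^ 8 * x) (y / q ^ 8) = -(q ^ 11 * (x * y)⁻¹) * (appellSide q x y -
      (∑ m ∈ Finset.range 4, shiftTheta q m x y) *
        (theta (-(q ^ 5 * x ^ 2)⁻¹) (q ^ 16) * theta ((x / y) ^ 3) (q ^ 48))) := by
  have h := appellPart_add_three hq0 hq hx hy
  have h0 := h 0
  have h1 := h 1
  have h2 := h 2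
  have h3 := h 3
  norm_num only at h0 h1 h2 h3
  simp only [appellSide, Finset.sum_range_succ, Finset.sum_range_zero, Nat.cast_zero, Nat.cast_one,
    Nat.cast_ofNat, appellPart_shift hq0 hq hx hy]
  norm_num only
  rw [h3, h2, h1, h0]
  ring

/-- The difference of `f_{3,5,3}(x,y,q)` and the two sums of Appell-Lerch series, multiplied by the
theta functions in the denominators; the factor `(x/y)^3` comes from `j(1/ζ) = -ζ⁻¹ j(ζ)`. -/
noncomputable def appellDefect (q x y : ℂ) : ℂ :=
  heckeF 3 5 3 x y q * theta ((x / y) ^ 3) (q ^ 48) * theta (-(q ^ 5 * x ^ 2)⁻¹) (q ^ 16) *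
      theta (-(q ^ 5 * y ^ 2)⁻¹) (q ^ 16) -
    appellSide q x y * theta (-(q ^ 5 * y ^ 2)⁻¹) (q ^ 16) +
    (x / y) ^ 3 * appellSide q y x * theta (-(q ^ 5 * x ^ 2)⁻¹) (q ^ 16)

/-- In the difference the boundary terms of the double sum and of the two Appell-Lerch sides
cancel. -/
theorem appellDefect_shift {q x y : ℂ} (hq0 : q ≠ 0) (hq : ‖q‖ < 1) (hx : x ≠ 0) (hy : y ≠ 0) :
    appellDefect q (q ^ 8 * x) (y / q ^ 8) = -(q ^ 16 * (y / x)) * appellDefect q x y := by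
  have hp := norm_pow_lt_one hq (n := 16) (by norm_num)
  have hp0 := pow_ne_zero 16 hq0
  have hQ := norm_pow_lt_one hq (n := 48) (by norm_num)
  have hQ0 := pow_ne_zero 48 hq0
  have h8 := pow_ne_zero 8 hq0
  have hwx : -(q ^ 5 * x ^ 2)⁻¹ ≠ 0 :=
    neg_ne_zero.mpr (inv_ne_zero (mul_ne_zero (pow_ne_zero 5 hq0) (pow_ne_zero 2 hx)))
  have hwy : -(q ^ 5 * y ^ 2)⁻¹ ≠ 0 :=
    neg_ne_zero.mpr (inv_ne_zero (mul_ne_zero (pow_ne_zero 5 hq0) (pow_ne_zero 2 hy)))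
  have hz := pow_ne_zero 3 (div_ne_zero hx hy)
  have f1 := heckeF_353_quasi hq0 hq hx hy
  have a1 := appellSide_shift hq0 hq hx hy
  have a2 := appellSide_shift hq0 hq (div_ne_zero hy h8) (mul_ne_zero h8 hx)
  rw [mul_div_cancel₀ y h8, mul_div_cancel_left₀ x h8] at a2
  have ez : (q ^ 8 * x / (y / q ^ 8)) ^ 3 = q ^ 48 * (x / y) ^ 3 := by field_simp
  have ez' : (y / q ^ 8 / (q ^ 8 * x)) ^ 3 = (q ^ 48 * (x / y) ^ 3)⁻¹ := by field_simp
  have ex : -(q ^ 5 * (q ^ 8 * x) ^ 2)⁻¹ = -(q ^ 5 * x ^ 2)⁻¹ / q ^ 16 := by field_simp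
  have ey : -(q ^ 5 * (y / q ^ 8) ^ 2)⁻¹ = q ^ 16 * -(q ^ 5 * y ^ 2)⁻¹ := by field_simp
  have t1 := theta_div_q hp hp0 hwx
  have t2 := theta_q_mul hp hp0 hwy
  have t3 := theta_q_mul hQ hQ0 hz
  have t4 := theta_inv hQ (mul_ne_zero hQ0 hz) hQ0
  rw [ez', ey, t4, t2, t3] at a2
  simp only [appellDefect]
  rw [f1, ez, ex, ey, t1, t2, t3, a1]
  generalize theta (-(q ^ 5 * x ^ 2)⁻¹) (q ^ 16) = Tx at *
  generalize theta (-(q ^ 5 * y ^ 2)⁻¹) (q ^ 16) = Ty at *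
  generalize theta ((x / y) ^ 3) (q ^ 48) = J at *
  generalize ∑ m ∈ Finset.range 4, shiftTheta q m x y = S at *
  generalize ∑ m ∈ Finset.range 4, shiftTheta q m (y / q ^ 8) (q ^ 8 * x) = S' at *
  generalize heckeF 3 5 3 x y q = F at *
  generalize appellSide q x y = A at *
  generalize appellSide q (y / q ^ 8) (q ^ 8 * x) = A' at *
  rw [a2]
  field_simp
  ring

/-! ### Sections with a common multiplier -/

/-- The zeros of the theta function are simple. -/
theorem regTheta_ne_zero_of_eq_one {p : ℂ} (hp : ‖p‖ < 1) (hp0 : p ≠ 0) (n : ℤ) :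
    regTheta n (p ^ (-n)) p ≠ 0 := by
  induction n using Int.induction_on with
  | zero => rw [neg_zero, zpow_zero, regTheta_zero_one]; exact pow_ne_zero 3 (qPochInf_self_ne_zero hp)
  | succ n ih =>
    have h := regTheta_q_mul hp hp0 (zpow_ne_zero (-((n : ℤ) + 1)) hp0) n
    rw [← zpow_one_add₀ hp0, show (1 : ℤ) + -((n : ℤ) + 1) = -n by ring] at h
    rw [h] at ih
    exact right_ne_zero_of_mul ih
  | pred n ih =>
    have h := regTheta_q_mul hp hp0 (zpow_ne_zero (- -(n : ℤ)) hp0) (-n - 1)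
    rw [← zpow_one_add₀ hp0, show (1 : ℤ) + - -(n : ℤ) = -(-n - 1) by ring, sub_add_cancel] at h
    rw [h]
    exact mul_ne_zero (neg_ne_zero.mpr (inv_ne_zero (zpow_ne_zero _ hp0))) ih

/-- Two sections of the same line bundle on the torus `ℂˣ / Q^ℤ` are proportional as soon as one
of them vanishes at the zeros, all simple, of the other. -/
theorem mul_eq_mul_of_multiplier {H K μ : ℂ → ℂ} {Q : ℂ} (hQ0 : Q ≠ 0) (hQ : ‖Q‖ < 1)
    (dH : DifferentiableOn ℂ H {0}ᶜ) (dK : DifferentiableOn ℂ K {0}ᶜ)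
    (hH : ∀ z, z ≠ 0 → H (Q * z) = μ z * H z) (hK : ∀ z, z ≠ 0 → K (Q * z) = μ z * K z)
    (hμ : ∀ z, z ≠ 0 → μ z ≠ 0) (h : ∀ z, z ≠ 0 → K z = 0 → H z = 0 ∧ deriv K z ≠ 0) {z w : ℂ}
    (hz : z ≠ 0) (hw : w ≠ 0) : H z * K w = H w * K z := by
  obtain ⟨G, dG, hG⟩ := exists_differentiableOn_div isOpen_compl_singleton dH dK
    fun z hz => h z hz
  have hinv : ∀ y, y ≠ 0 → K y ≠ 0 → G (Q * y) = G y := by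
    intro y hy hKy
    have h1 := hG (Q * y) (mul_ne_zero hQ0 hy)
    rw [hH y hy, hK y hy, ← hG y hy] at h1
    refine mul_right_cancel₀ (mul_ne_zero (hμ y hy) hKy) ?_
    linear_combination h1
  have hcont : ∀ y, y ≠ 0 → ContinuousAt G y := fun y hy =>
    (dG.differentiableAt (isOpen_compl_singleton.mem_nhds hy)).continuousAt
  have hinv' : ∀ y, y ≠ 0 → G (Q * y) = G y := by
    intro y hy
    -- At a zero of `K` the invariance follows by continuity, the zero being isolated.
    by_cases hKy : K y = 0
    · have hd := (h y hy hKy).2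
      have hne := (dK.differentiableAt (isOpen_compl_singleton.mem_nhds hy)).hasDerivAt
        |>.eventually_ne (c := 0) hd
      have c1 : Tendsto (fun v => G (Q * v)) (𝓝[≠] y) (𝓝 (G (Q * y))) := by
        have : ContinuousAt (fun v => G (Q * v)) y :=
          ContinuousAt.comp (f := fun v => Q * v) (hcont _ (mul_ne_zero hQ0 hy))
            (continuousAt_const.mul continuousAt_id)
        exact this.tendsto.mono_left nhdsWithin_le_nhds
      have c2 : Tendsto G (𝓝[≠] y) (𝓝 (G y)) := (hcont y hy).tendsto.mono_left nhdsWithin_le_nhds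
      refine tendsto_nhds_unique (c1.congr' ?_) c2
      have hy0 : ∀ᶠ v in 𝓝[≠] y, v ≠ 0 :=
        (eventually_ne_nhds hy).filter_mono nhdsWithin_le_nhds
      filter_upwards [hne, hy0] with v hv hv0 using hinv v hv0 hv
    · exact hinv y hy hKy
  rw [← hG z hz, ← hG w hw, eq_of_mul_invariant dG hQ0 hQ hinv' hz hw]
  ring

theorem zero_iff_of_multiplier {H μ : ℂ → ℂ} {Q : ℂ} (hQ0 : Q ≠ 0)
    (hH : ∀ z, z ≠ 0 → H (Q * z) = μ z * H z) (hμ : ∀ z, z ≠ 0 → μ z ≠ 0) (n : ℤ) :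
    ∀ z, z ≠ 0 → (H (Q ^ n * z) = 0 ↔ H z = 0) := by
  have h1 : ∀ z, z ≠ 0 → (H (Q * z) = 0 ↔ H z = 0) := fun z hz => by
    rw [hH z hz, mul_eq_zero, or_iff_right (hμ z hz)]
  induction n using Int.induction_on with
  | zero => simp
  | succ n ih =>
    intro z hz
    rw [zpow_add_one₀ hQ0, mul_assoc, ih _ (mul_ne_zero hQ0 hz), h1 z hz]
  | pred n ih =>
    intro z hz
    rw [← h1 _ (mul_ne_zero (zpow_ne_zero _ hQ0) hz), ← mul_assoc, ← zpow_one_add₀ hQ0,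
      show (1 : ℤ) + (-n - 1) = -n by ring, ih z hz]

/-! ### The double sum with parameters `(3,5,3)` as Appell-Lerch sums and a theta quotient -/

/-- The theta section, with zeros where `t^2` is `q` times a power of `q^16`, to which the
difference of the two sides is proportional. -/
noncomputable def defectTheta (q t : ℂ) : ℂ := t ^ 2 * theta (t ^ 2 / q) (q ^ 16)

/-- The zeros of `defectTheta` are simple. -/
theorem deriv_defectTheta_ne_zero {q : ℂ} (hq0 : q ≠ 0) (hq : ‖q‖ < 1) {z : ℂ} (hz : z ≠ 0)
    {n : ℤ} (hn : z ^ 2 / q = (q ^ 16) ^ (-n)) : deriv (defectTheta q) z ≠ 0 := by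
  have hp := norm_pow_lt_one hq (n := 16) (by norm_num)
  have hp0 := pow_ne_zero 16 hq0
  let R : ℂ → ℂ := fun y => y ^ 2 * regTheta n (y ^ 2 / q) (q ^ 16)
  have hR : DifferentiableAt ℂ R z := by
    refine (differentiableAt_id.pow 2).mul ?_
    have h1 := (differentiableOn_regTheta hp n).differentiableAt
      (isOpen_compl_singleton.mem_nhds (div_ne_zero (pow_ne_zero 2 hz) hq0))
    exact DifferentiableAt.comp (f := fun y : ℂ => y ^ 2 / q) z h1
      ((differentiableAt_id.pow 2).div_const q)
  have hE : HasDerivAt (fun y : ℂ => 1 - (q ^ 16) ^ n * (y ^ 2 / q))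
      (-((q ^ 16) ^ n * (2 * z / q))) z := by
    have h1 := (((hasDerivAt_pow 2 z).div_const q).const_mul ((q ^ 16) ^ n)).const_sub 1
    simpa using h1
  have hK : defectTheta q =ᶠ[𝓝 z] fun y => (1 - (q ^ 16) ^ n * (y ^ 2 / q)) * R y := by
    filter_upwards [eventually_ne_nhds hz] with y hy
    rw [defectTheta, ← regTheta_mul hp hp0 (div_ne_zero (pow_ne_zero 2 hy) hq0) n]
    ring
  have h0 : 1 - (q ^ 16) ^ n * (z ^ 2 / q) = 0 := by
    rw [hn, ← zpow_add₀ hp0, add_neg_cancel, zpow_zero, sub_self]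
  have hd := hK.deriv_eq.trans (hE.mul hR.hasDerivAt).deriv
  rw [hd, h0, zero_mul, add_zero]
  refine mul_ne_zero (neg_ne_zero.mpr (mul_ne_zero (zpow_ne_zero _ hp0)
    (div_ne_zero (mul_ne_zero two_ne_zero hz) hq0))) (mul_ne_zero (pow_ne_zero 2 hz) ?_)
  rw [hn]
  exact regTheta_ne_zero_of_eq_one hp hp0 n

theorem differentiableOn_appellSide {q : ℂ} (hq0 : q ≠ 0) (hq : ‖q‖ < 1) {x y : ℂ → ℂ}
    (hx : DifferentiableOn ℂ x {0}ᶜ) (hy : DifferentiableOn ℂ y {0}ᶜ)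
    (hx0 : ∀ z, z ≠ 0 → x z ≠ 0) (hy0 : ∀ z, z ≠ 0 → y z ≠ 0) :
    DifferentiableOn ℂ (fun z => appellSide q (x z) (y z)) {0}ᶜ := by
  unfold appellSide appellPart shiftTheta
  refine DifferentiableOn.fun_sum fun i _ => DifferentiableOn.mul (DifferentiableOn.mul
    (DifferentiableOn.mul ?_ (differentiableOn_const _)) ?_) ?_
  · exact hy.neg.zpow (Or.inl fun z hz => neg_ne_zero.mpr (hy0 z hz))
  · exact differentiableOn_theta_comp (norm_pow_lt_one hq (by norm_num)) (hx.const_mul _)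
      fun z hz => mul_ne_zero (zpow_ne_zero _ hq0) (hx0 z hz)
  · refine differentiableOn_regAppell (norm_pow_lt_one hq (by norm_num)) (pow_ne_zero 48 hq0)
      (norm_pow_lt_one hq (by norm_num)) _ ?_ ((hx.div hy hy0).pow 3)
      (fun z hz => neg_ne_zero.mpr (inv_ne_zero (mul_ne_zero (pow_ne_zero 5 hq0)
        (pow_ne_zero 2 (hx0 z hz))))) fun z hz => pow_ne_zero 3 (div_ne_zero (hx0 z hz) (hy0 z hz))
    exact (((hx.pow 2).const_mul _).inv fun z hz => mul_ne_zero (pow_ne_zero 5 hq0)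
        (pow_ne_zero 2 (hx0 z hz))).neg

theorem differentiableOn_appellDefect {q : ℂ} (hq0 : q ≠ 0) (hq : ‖q‖ < 1) :
    DifferentiableOn ℂ (fun t => appellDefect q t (q / t)) {0}ᶜ := by
  have hid : DifferentiableOn ℂ (fun z : ℂ => z) {0}ᶜ := differentiableOn_id
  have hinv : DifferentiableOn ℂ (fun z : ℂ => q / z) {0}ᶜ :=
    DifferentiableOn.div (differentiableOn_const _) hid fun z hz => hz
  have hinv0 : ∀ z, z ≠ 0 → q / z ≠ 0 := fun z hz => div_ne_zero hq0 hz
  have hid0 : ∀ z : ℂ, z ≠ 0 → z ≠ 0 := fun z hz => hz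
  have hp := norm_pow_lt_one hq (n := 16) (by norm_num)
  have hw : ∀ x : ℂ → ℂ, DifferentiableOn ℂ x {0}ᶜ → (∀ z, z ≠ 0 → x z ≠ 0) →
      DifferentiableOn ℂ (fun z => theta (-(q ^ 5 * x z ^ 2)⁻¹) (q ^ 16)) {0}ᶜ := fun x hx hx0 =>
    differentiableOn_theta_comp hp (((hx.pow 2).const_mul _).inv fun z hz =>
      mul_ne_zero (pow_ne_zero 5 hq0) (pow_ne_zero 2 (hx0 z hz))).neg fun z hz =>
        neg_ne_zero.mpr (inv_ne_zero (mul_ne_zero (pow_ne_zero 5 hq0) (pow_ne_zero 2 (hx0 z hz))))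
  have hz : DifferentiableOn ℂ (fun z => (z / (q / z)) ^ 3) {0}ᶜ := (hid.div hinv hinv0).pow 3
  unfold appellDefect
  refine DifferentiableOn.add (DifferentiableOn.sub (DifferentiableOn.mul (DifferentiableOn.mul
    (DifferentiableOn.mul (differentiableOn_heckeF (by norm_num) (by norm_num) (by norm_num)
      hq0 hq hid hinv hid0 hinv0) ?_) (hw _ hid hid0)) (hw _ hinv hinv0)) (DifferentiableOn.mul
      (differentiableOn_appellSide hq0 hq hid hinv hid0 hinv0) (hw _ hinv hinv0)))
      (DifferentiableOn.mul (DifferentiableOn.mul hz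
      (differentiableOn_appellSide hq0 hq hinv hid hinv0 hid0)) (hw _ hid hid0))
  exact differentiableOn_theta_comp (norm_pow_lt_one hq (by norm_num)) hz fun z hz =>
    pow_ne_zero 3 (div_ne_zero hz (hinv0 z hz))

/-- The double sum drops out at `x = y`, and the two Appell-Lerch sides cancel by symmetry. -/
theorem appellDefect_self (q : ℂ) {x : ℂ} (hq : ‖q‖ < 1) (hx : x ≠ 0) :
    appellDefect q x x = 0 := by
  rw [appellDefect, div_self hx, one_pow, theta_eq_zero_one _ (norm_pow_lt_one hq (by norm_num))]
  ring

/-- At a zero of `defectTheta` a power of the multiplier moves `t` to a point where `t = q / t`,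
at which the difference vanishes. -/
theorem appellDefect_proportional {q : ℂ} (hq0 : q ≠ 0) (hq : ‖q‖ < 1) {t u : ℂ} (ht : t ≠ 0)
    (hu : u ≠ 0) : appellDefect q t (q / t) * defectTheta q u =
      appellDefect q u (q / u) * defectTheta q t := by
  have hp := norm_pow_lt_one hq (n := 16) (by norm_num)
  have hp0 := pow_ne_zero 16 hq0
  have h8 := pow_ne_zero 8 hq0
  have hμ : ∀ z, z ≠ 0 → -(q ^ 16 * (q / z / z)) ≠ 0 := fun z hz =>
    neg_ne_zero.mpr (mul_ne_zero hp0 (div_ne_zero (div_ne_zero hq0 hz) hz))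
  have hH : ∀ z, z ≠ 0 → appellDefect q (q ^ 8 * z) (q / (q ^ 8 * z)) =
      -(q ^ 16 * (q / z / z)) * appellDefect q z (q / z) := by
    intro z hz
    rw [← appellDefect_shift hq0 hq hz (div_ne_zero hq0 hz), div_div q z, mul_comm z]
  refine mul_eq_mul_of_multiplier (H := fun t => appellDefect q t (q / t)) (K := defectTheta q)
    (μ := fun z => -(q ^ 16 * (q / z / z))) h8 (norm_pow_lt_one hq (by norm_num))
    (differentiableOn_appellDefect hq0 hq) ?_ hH ?_ hμ ?_ ht hu
  · have hid : DifferentiableOn ℂ (fun z : ℂ => z) {0}ᶜ := differentiableOn_id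
    exact (hid.pow 2).mul (differentiableOn_theta_comp hp ((hid.pow 2).div_const q)
      fun z hz => div_ne_zero (pow_ne_zero 2 hz) hq0)
  · intro z hz
    rw [defectTheta, defectTheta, show (q ^ 8 * z) ^ 2 / q = q ^ 16 * (z ^ 2 / q) by ring,
      theta_q_mul hp hp0 (div_ne_zero (pow_ne_zero 2 hz) hq0)]
    field_simp
  · intro z hz hKz
    have hz2 := div_ne_zero (pow_ne_zero 2 hz) hq0
    have hθ := (mul_eq_zero.mp hKz).resolve_left (pow_ne_zero 2 hz)
    obtain ⟨n, hn⟩ : ∃ n : ℤ, z ^ 2 / q * (q ^ 16) ^ n = 1 := by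
      by_contra! hcon
      exact theta_ne_zero hp hp0 hz2 hcon hθ
    have hn' : z ^ 2 / q = (q ^ 16) ^ (-n) := by
      rw [zpow_neg]; exact eq_inv_of_mul_eq_one_left hn
    refine ⟨?_, deriv_defectTheta_ne_zero hq0 hq hz hn'⟩
    have hx := mul_ne_zero (zpow_ne_zero n h8) hz
    have hsq : q / ((q ^ 8) ^ n * z) = (q ^ 8) ^ n * z := by
      have e : (q ^ 16) ^ n = (q ^ 8) ^ n * (q ^ 8) ^ n := by
        rw [← mul_zpow, ← pow_add]
      rw [div_eq_iff hx]
      rw [e] at hn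
      field_simp at hn
      linear_combination -hn
    refine (zero_iff_of_multiplier (H := fun t => appellDefect q t (q / t)) h8 hH hμ n z hz).mp ?_
    simp only [hsq]
    exact appellDefect_self q hq hx

theorem regAppell_one_of_ne {p Q ζ : ℂ} (hp : ‖p‖ < 1) (hp0 : p ≠ 0) {k : ℤ → ℤ}
    (hk : ∀ r, k r ≠ 0) : regAppell k p 1 Q ζ = 0 := by
  refine (tsum_congr fun r => ?_).trans tsum_zero
  rw [regTheta_one hp hp0 (hk r), mul_zero]

/-- At `w = 1` a regularised sum keeps only the term whose denominator vanishes; the exponent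
`3 r - 1 - i` is zero for `i = 2`, `r = 1` alone. -/
theorem appellSide_of_sq {q : ℂ} (hq0 : q ≠ 0) (hq : ‖q‖ < 1) {x y : ℂ}
    (hx : -(q ^ 5 * x ^ 2)⁻¹ = 1) : appellSide q x y = -(y ^ 2 * q ^ 3 * (x / y) ^ 3 *
      theta (q ^ 10 * x) (q ^ 3) * qPochInf (q ^ 16) (q ^ 16) ^ 3) := by
  have hp := norm_pow_lt_one hq (n := 16) (by norm_num)
  have hp0 := pow_ne_zero 16 hq0
  simp only [appellSide, Finset.sum_range_succ, Finset.sum_range_zero, appellPart, hx]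
  rw [regAppell_one_of_ne hp hp0 (fun r => by omega), regAppell_one_of_ne hp hp0
    (fun r => by push_cast; omega), regAppell, tsum_eq_single 1]
  · have t2 : tri 2 = 1 := by decide
    norm_num [shiftTheta, t2, regTheta_zero_one]
    ring
  · intro r hr
    rw [regTheta_one hp hp0 (by push_cast; omega), mul_zero]

/-- At `t^2 = -q^{-5}` the theta function in `w = 1` removes the double sum and one of the two
Appell-Lerch sides. -/
theorem appellDefect_of_sq {q : ℂ} (hq0 : q ≠ 0) (hq : ‖q‖ < 1) {t : ℂ}
    (ht : q ^ 5 * t ^ 2 = -1) : appellDefect q t (q / t) = (q ^ 26)⁻¹ *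
      (qPochInf (-q ^ 3) (q ^ 6) * qPochInf (q ^ 3) (q ^ 3)) * qPochInf (q ^ 16) (q ^ 16) ^ 3 *
        theta (q ^ 12) (q ^ 16) := by
  have hp := norm_pow_lt_one hq (n := 16) (by norm_num)
  have hp0 := pow_ne_zero 16 hq0
  have h3 := norm_pow_lt_one hq (n := 3) (by norm_num)
  have h30 := pow_ne_zero 3 hq0
  have ht0 : t ≠ 0 := by rintro rfl; norm_num at ht
  have hw : -(q ^ 5 * t ^ 2)⁻¹ = 1 := by rw [ht]; norm_num
  have hv2 : (q ^ 4 * t) ^ 2 = -q ^ 3 := by linear_combination q ^ 3 * ht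
  have hv0 := mul_ne_zero (pow_ne_zero 4 hq0) ht0
  have hv : q ^ 3 / (q ^ 4 * t) = -(q ^ 4 * t) := by
    rw [div_eq_iff hv0]; linear_combination hv2
  have e1 : theta (q ^ 4 * t) (q ^ 3) = qPochInf (-q ^ 3) (q ^ 6) * qPochInf (q ^ 3) (q ^ 3) := by
    rw [theta, hv, ← qPochInf_sq _ h3, hv2, ← pow_mul]
  have e2 : theta (q ^ 10 * t) (q ^ 3) = -(q ^ 6)⁻¹ * theta (q ^ 4 * t) (q ^ 3) := by
    have h1 := theta_q_mul h3 h30 hv0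
    have h2 := theta_q_mul h3 h30 (mul_ne_zero h30 hv0)
    rw [show q ^ 10 * t = q ^ 3 * (q ^ 3 * (q ^ 4 * t)) by ring, h2, h1]
    have : (q ^ 3 * (q ^ 4 * t))⁻¹ * (q ^ 4 * t)⁻¹ = -(q ^ 6)⁻¹ := by
      rw [← mul_inv, ← inv_neg]; congr 1; linear_combination q ^ 3 * hv2
    linear_combination theta (q ^ 4 * t) (q ^ 3) * this
  have e3 : -(q ^ 5 * (q / t) ^ 2)⁻¹ = (q ^ 12)⁻¹ := by
    have : t ^ 2 = -(q ^ 5)⁻¹ := by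
      field_simp; linear_combination ht
    rw [div_pow, this]; field_simp
  have e4 : (q / t) ^ 2 * q ^ 3 * (t / (q / t)) ^ 3 = (q ^ 8)⁻¹ := by
    have : (q / t) ^ 2 * q ^ 3 * (t / (q / t)) ^ 3 = q ^ 2 * (t ^ 2) ^ 2 := by
      field_simp
    have h2 : t ^ 2 = -(q ^ 5)⁻¹ := by field_simp; linear_combination ht
    rw [this, h2]; field_simp
  rw [appellDefect, appellSide_of_sq hq0 hq hw, hw, theta_eq_zero_one _ hp, e3,
    theta_inv hp (pow_ne_zero 12 hq0) hp0, e4, e2, e1]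
  field_simp
  ring

/-- Both sides are rearrangements of the same infinite product. -/
theorem theta_product_identity {q : ℂ} (hq0 : q ≠ 0) (hq : ‖q‖ < 1) :
    qPochInf (-q ^ 3) (q ^ 6) * qPochInf (q ^ 3) (q ^ 3) * qPochInf (q ^ 16) (q ^ 16) ^ 3 *
      theta (q ^ 12) (q ^ 16) = theta (-q ^ 6) (q ^ 16) * (theta (q ^ 6) (q ^ 12) *
        theta (q ^ 16) (q ^ 32) * theta (q ^ 6) (q ^ 16) * theta (q ^ 4) (q ^ 32)) := by
  have hn : ∀ n : ℕ, n ≠ 0 → ‖q ^ n‖ < 1 := fun n hn => norm_pow_lt_one hq hn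
  have a1 := qPochInf_dissect (q ^ 3) (hn 3 (by norm_num))
  have a2 := qPochInf_dissect (q ^ 6) (hn 6 (by norm_num))
  have a3 := qPochInf_sq (q ^ 3) (hn 6 (by norm_num))
  have b1 := qPochInf_dissect (q ^ 12) (hn 16 (by norm_num))
  have b2 := qPochInf_dissect (q ^ 4) (hn 16 (by norm_num))
  have b3 := qPochInf_dissect (q ^ 16) (hn 16 (by norm_num))
  have b4 := qPochInf_sq (q ^ 6) (hn 16 (by norm_num))
  have b5 := qPochInf_sq (q ^ 10) (hn 16 (by norm_num))
  simp only [← pow_mul, ← pow_add] at a1 a2 a3 b1 b2 b3 b4 b5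
  norm_num only at a1 a2 a3 b1 b2 b3 b4 b5
  unfold theta
  rw [show q ^ 16 / q ^ 12 = q ^ 4 by field_simp, show q ^ 16 / -q ^ 6 = -q ^ 10 by field_simp,
    show q ^ 12 / q ^ 6 = q ^ 6 by field_simp, show q ^ 32 / q ^ 16 = q ^ 16 by field_simp,
    show q ^ 16 / q ^ 6 = q ^ 10 by field_simp, show q ^ 32 / q ^ 4 = q ^ 28 by field_simp]
  have l1 : qPochInf (-q ^ 3) (q ^ 6) * qPochInf (q ^ 3) (q ^ 3) =
      qPochInf (q ^ 6) (q ^ 12) * qPochInf (q ^ 6) (q ^ 12) * qPochInf (q ^ 12) (q ^ 12) := by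
    rw [a1, a2, a3]; ring
  rw [l1, b1, b2]
  have l2 : qPochInf (-q ^ 6) (q ^ 16) * qPochInf (-q ^ 10) (q ^ 16) *
      (qPochInf (q ^ 6) (q ^ 16) * qPochInf (q ^ 10) (q ^ 16)) =
      qPochInf (q ^ 12) (q ^ 32) * qPochInf (q ^ 20) (q ^ 32) := by
    rw [b4, b5]; ring
  linear_combination (qPochInf (q ^ 6) (q ^ 12) * qPochInf (q ^ 6) (q ^ 12) *
    qPochInf (q ^ 12) (q ^ 12)) * (qPochInf (q ^ 12) (q ^ 32) * qPochInf (q ^ 28) (q ^ 32) *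
    qPochInf (q ^ 4) (q ^ 32) * qPochInf (q ^ 20) (q ^ 32)) * qPochInf (q ^ 16) (q ^ 16) ^ 2 *
    (qPochInf (q ^ 16) (q ^ 16) + qPochInf (q ^ 16) (q ^ 32) * qPochInf (q ^ 32) (q ^ 32)) * b3 -
    (qPochInf (q ^ 6) (q ^ 12) * qPochInf (q ^ 6) (q ^ 12) * qPochInf (q ^ 12) (q ^ 12)) *
    (qPochInf (q ^ 28) (q ^ 32) * qPochInf (q ^ 4) (q ^ 32)) * qPochInf (q ^ 16) (q ^ 16) ^ 2 *
    (qPochInf (q ^ 16) (q ^ 32) * qPochInf (q ^ 32) (q ^ 32)) ^ 2 * l2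

/-- The value at `t = 1` of the constant of proportionality. -/
theorem appellDefect_one {q : ℂ} (hq0 : q ≠ 0) (hq : ‖q‖ < 1) :
    appellDefect q 1 q = (q ^ 16)⁻¹ * (theta (q ^ 6) (q ^ 12) * theta (q ^ 16) (q ^ 32) *
      theta (q ^ 6) (q ^ 16) * theta (q ^ 4) (q ^ 32)) * theta q (q ^ 16) := by
  have hp := norm_pow_lt_one hq (n := 16) (by norm_num)
  have hp0 := pow_ne_zero 16 hq0
  obtain ⟨t, ht⟩ := IsAlgClosed.exists_pow_nat_eq (-(q ^ 5)⁻¹) (n := 2) (by norm_num)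
  have ht' : q ^ 5 * t ^ 2 = -1 := by rw [ht]; field_simp
  have ht0 : t ≠ 0 := by rintro rfl; norm_num at ht'
  have h := appellDefect_proportional hq0 hq one_ne_zero ht0
  have e1 : defectTheta q t = -(q ^ 11)⁻¹ * theta (-q ^ 6) (q ^ 16) := by
    have h1 := theta_inv hp (neg_ne_zero.mpr (pow_ne_zero 6 hq0)) hp0
    rw [defectTheta, ht, show -(q ^ 5)⁻¹ / q = (-q ^ 6)⁻¹ by field_simp, h1]
    field_simp
  have e2 : defectTheta q 1 = -q⁻¹ * theta q (q ^ 16) := by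
    rw [defectTheta, one_pow, one_mul, one_div, theta_inv hp hq0 hp0]
  have h6 : theta (-q ^ 6) (q ^ 16) ≠ 0 := theta_ne_zero_of_norm (a := 6) (b := 16) hq hq0
    (by norm_num) (norm_pow_eq_zpow q 16) (by rw [norm_neg]; exact norm_pow_eq_zpow q 6)
    (by norm_num)
  rw [appellDefect_of_sq hq0 hq ht', e1, e2, div_one, mul_assoc ((q ^ 26)⁻¹),
    mul_assoc ((q ^ 26)⁻¹), theta_product_identity hq0 hq] at h
  refine mul_right_cancel₀ h6 ?_
  have hq11 := pow_ne_zero 11 hq0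
  field_simp at h ⊢
  linear_combination -h

theorem appellM_inv {q x z : ℂ} (hq0 : q ≠ 0) (hq : ‖q‖ < 1) (hx : x ≠ 0) (hz : z ≠ 0) :
    appellM x⁻¹ q z⁻¹ = x * appellM x q z := by
  have hw : x * z / q ≠ 0 := div_ne_zero (mul_ne_zero hx hz) hq0
  rw [appellM_eq_lerch hq0, appellM_eq_lerch hq0, theta_inv hq hz hq0,
    show x⁻¹ * z⁻¹ / q = (x * z / q)⁻¹ / q / q by field_simp, lerch_div hq0 (inv_ne_zero hz),
    lerch_div hq0 (mul_ne_zero hq0 (inv_ne_zero hz)), lerch_inv hq0 hw,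
    show q ^ 2 / (q * (q * z⁻¹)) = z by field_simp, mul_inv]
  field_simp

theorem appellPart_eq_appellM {q : ℂ} (hq0 : q ≠ 0) (hq : ‖q‖ < 1) {X x y : ℂ} (i : ℤ)
    (hx : x ≠ 0) (hX : (q ^ 16) ^ (-1 - i) * -(q ^ 5 * x ^ 2)⁻¹ = X * (x / y) ^ 3 / q ^ 48)
    (h : theta (-(q ^ 5 * x ^ 2)⁻¹) (q ^ 16) ≠ 0) (h' : theta ((x / y) ^ 3) (q ^ 48) ≠ 0) :
    appellPart q i x y = shiftTheta q i x y * (theta (-(q ^ 5 * x ^ 2)⁻¹) (q ^ 16) *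
      theta ((x / y) ^ 3) (q ^ 48) * appellM X (q ^ 48) ((x / y) ^ 3)) := by
  have hp := norm_pow_lt_one hq (n := 16) (by norm_num)
  have hw : -(q ^ 5 * x ^ 2)⁻¹ ≠ 0 :=
    neg_ne_zero.mpr (inv_ne_zero (mul_ne_zero (pow_ne_zero 5 hq0) (pow_ne_zero 2 hx)))
  have e := tsum_appellTerm_eq (m := 3) hp (pow_ne_zero 16 hq0) hw
    (by rw [zpow_ofNat, ← pow_mul]) hX h
  rw [appellPart, appellM, e, show (fun r : ℤ => 3 * r + (-1 - i)) = fun r => 3 * r - 1 - i by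
    ext; ring]
  generalize theta (-(q ^ 5 * x ^ 2)⁻¹) (q ^ 16) = T at *
  generalize theta ((x / y) ^ 3) (q ^ 48) = J at *
  rw [mul_assoc T, mul_inv_cancel_left₀ h', mul_inv_cancel_left₀ h]

theorem thetaQuot_three {q : ℂ} (hq0 : q ≠ 0) : thetaQuot 3 1 q q =
    q ^ 2 * theta (q ^ 6) (q ^ 12) * theta (q ^ 16) (q ^ 32) *
      (theta q (q ^ 16) * theta (q ^ 6) (q ^ 16)) * theta (q ^ 4) (q ^ 32) /
    (q ^ 3 * theta (q ^ 3) (q ^ 48) * (theta (-q ^ 5) (q ^ 16) * theta (-q ^ 7) (q ^ 16))) := by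
  simp only [thetaQuot, thetaJ]
  norm_num only [one_pow, one_zpow, mul_one, div_one, one_mul]
  simp only [zpow_ofNat]
  rw [← pow_succ, ← pow_add, show q ^ 6 / q ^ 2 = q ^ 4 by field_simp]

theorem shiftTheta_one_self {q : ℂ} (hq0 : q ≠ 0) (hq : ‖q‖ < 1) :
    shiftTheta q 0 1 q = 0 ∧ shiftTheta q 1 1 q = q⁻¹ * qPochInf q q ∧
      shiftTheta q 2 1 q = -(q ^ 7)⁻¹ * qPochInf q q := by
  have hp := norm_pow_lt_one hq (n := 3) (by norm_num)
  have hp0 := pow_ne_zero 3 hq0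
  have t2 : tri 2 = 1 := by decide
  have t3 : tri 3 = 3 := by decide
  have j1 := theta_self_cube hq0 hq
  have j2 := theta_symm hp0 hq0
  rw [show q ^ 3 / q = q ^ 2 by field_simp, j1] at j2
  have j5 := theta_q_mul hp hp0 (pow_ne_zero 2 hq0)
  have j10 := theta_zpow_mul hp hp0 hq0 3
  rw [j2, ← pow_add] at j5
  rw [j1, t3, zpow_neg, zpow_neg] at j10
  norm_num only at j5 j10
  rw [zpow_ofNat, ← pow_mul, ← pow_succ] at j10
  norm_num only at j10
  refine ⟨?_, ?_, ?_⟩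
  · simp [shiftTheta, theta_eq_zero_one _ hp]
  · simp only [shiftTheta, tri_one, mul_zero, mul_one, zpow_ofNat, j5]
    field_simp
  · norm_num only [shiftTheta, t2, mul_one]
    simp only [zpow_ofNat]
    rw [j10]
    simp only [zpow_ofNat]
    field_simp

theorem shiftTheta_self_one {q : ℂ} (hq0 : q ≠ 0) (hq : ‖q‖ < 1) :
    shiftTheta q 0 q 1 = qPochInf q q ∧ shiftTheta q 1 q 1 = 0 ∧
      shiftTheta q 2 q 1 = -(q ^ 12)⁻¹ * qPochInf q q := by
  have hp := norm_pow_lt_one hq (n := 3) (by norm_num)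
  have hp0 := pow_ne_zero 3 hq0
  have t2 : tri 2 = 1 := by decide
  have t3 : tri 3 = 3 := by decide
  have j1 := theta_self_cube hq0 hq
  have j2 := theta_symm hp0 hq0
  rw [show q ^ 3 / q = q ^ 2 by field_simp, j1] at j2
  have j6 : theta (q ^ 6) (q ^ 3) = 0 := by
    rw [show q ^ 6 = q ^ 3 * (q ^ 3 * 1) by ring, theta_q_mul hp hp0 (by simpa using hp0),
      theta_q_mul hp hp0 one_ne_zero, theta_eq_zero_one _ hp, mul_zero, mul_zero]
  have j11 := theta_zpow_mul hp hp0 (pow_ne_zero 2 hq0) 3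
  rw [j2, t3, zpow_neg, zpow_neg] at j11
  norm_num only at j11
  rw [zpow_ofNat, ← pow_mul, ← pow_add] at j11
  norm_num only at j11
  refine ⟨?_, ?_, ?_⟩
  · simp [shiftTheta, j1]
  · simp only [shiftTheta, mul_one, zpow_ofNat]
    rw [← pow_succ, j6, mul_zero]
  · norm_num only [shiftTheta, t2, mul_one]
    simp only [zpow_ofNat]
    rw [← pow_succ, j11]
    field_simp

/-- The defect at `t = 1`, divided by its theta functions. In each of the two Appell-Lerch sides
one of the three boundary terms `shiftTheta` vanishes, which leaves four sums. -/
theorem psi_eq_appellM_four {q : ℂ} (hq0 : q ≠ 0) (hq : ‖q‖ < 1) :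
    psi q = -appellM (-q ^ 22) (q ^ 48) (q ^ 3) - q⁻¹ * appellM (-q ^ 14) (q ^ 48) (q ^ 3)⁻¹ -
      (q ^ 2)⁻¹ * appellM (-q ^ 10) (q ^ 48) (q ^ 3)⁻¹ -
      (q ^ 5)⁻¹ * appellM (-q ^ 2) (q ^ 48) (q ^ 3) + 1 / etaJ 1 q * thetaQuot 3 1 q q := by
  have hp := norm_pow_lt_one hq (n := 16) (by norm_num)
  have hp0 := pow_ne_zero 16 hq0
  have hQ := norm_pow_lt_one hq (n := 48) (by norm_num)
  have hQ0 := pow_ne_zero 48 hq0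
  have h3 := pow_ne_zero 3 hq0
  have n5 : theta (-q ^ 5) (q ^ 16) ≠ 0 := theta_ne_zero_of_norm (a := 5) (b := 16) hq hq0
    (by norm_num) (norm_pow_eq_zpow q 16) (by rw [norm_neg]; exact norm_pow_eq_zpow q 5)
    (by norm_num)
  have n7 : theta (-q ^ 7) (q ^ 16) ≠ 0 := theta_ne_zero_of_norm (a := 7) (b := 16) hq hq0
    (by norm_num) (norm_pow_eq_zpow q 16) (by rw [norm_neg]; exact norm_pow_eq_zpow q 7)
    (by norm_num)
  have n3 : theta (q ^ 3) (q ^ 48) ≠ 0 := theta_ne_zero_of_norm (a := 3) (b := 48) hq hq0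
    (by norm_num) (norm_pow_eq_zpow q 48) (norm_pow_eq_zpow q 3) (by norm_num)
  have i5 := theta_inv hp (neg_ne_zero.mpr (pow_ne_zero 5 hq0)) hp0
  have i7 := theta_inv hp (neg_ne_zero.mpr (pow_ne_zero 7 hq0)) hp0
  have i3 := theta_inv hQ h3 hQ0
  have w5 : -(q ^ 5 * 1 ^ 2)⁻¹ = (-q ^ 5)⁻¹ := by rw [one_pow, mul_one, inv_neg]
  have w7 : -(q ^ 5 * q ^ 2)⁻¹ = (-q ^ 7)⁻¹ := by rw [← pow_add, inv_neg]
  have z1 : (1 / q) ^ 3 = (q ^ 3)⁻¹ := by rw [one_div, inv_pow]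
  have z2 : (q / 1) ^ 3 = q ^ 3 := by rw [div_one]
  obtain ⟨s0, s1, s2⟩ := shiftTheta_one_self hq0 hq
  obtain ⟨r0, r1, r2⟩ := shiftTheta_self_one hq0 hq
  have n5' : theta (-q ^ 5)⁻¹ (q ^ 16) ≠ 0 := by
    rw [i5]; exact mul_ne_zero (neg_ne_zero.mpr (inv_ne_zero (neg_ne_zero.mpr (pow_ne_zero 5 hq0)))) n5
  have n7' : theta (-q ^ 7)⁻¹ (q ^ 16) ≠ 0 := by
    rw [i7]; exact mul_ne_zero (neg_ne_zero.mpr (inv_ne_zero (neg_ne_zero.mpr (pow_ne_zero 7 hq0)))) n7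
  have n3' : theta (q ^ 3)⁻¹ (q ^ 48) ≠ 0 := by
    rw [i3]; exact mul_ne_zero (neg_ne_zero.mpr (inv_ne_zero h3)) n3
  have z : ∀ (n : ℕ), (q ^ 16) ^ (-(n : ℤ)) = (q ^ (16 * n))⁻¹ := fun n => by
    rw [zpow_neg, zpow_natCast, pow_mul]
  have A1 := appellPart_eq_appellM (X := -q ^ 14) (x := 1) (y := q) hq0 hq 1 one_ne_zero
    (by rw [show (-1 - 1 : ℤ) = -(2 : ℕ) by norm_num, z]; field_simp)
    (by rw [w5]; exact n5') (by rw [z1]; exact n3')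
  have A2 := appellPart_eq_appellM (X := (-q ^ 2)⁻¹) (x := 1) (y := q) hq0 hq 2 one_ne_zero
    (by rw [show (-1 - 2 : ℤ) = -(3 : ℕ) by norm_num, z]; field_simp)
    (by rw [w5]; exact n5') (by rw [z1]; exact n3')
  have B0 := appellPart_eq_appellM (X := -q ^ 22) (x := q) (y := 1) hq0 hq 0 hq0
    (by rw [show (-1 - 0 : ℤ) = -(1 : ℕ) by norm_num, z]; field_simp)
    (by rw [w7]; exact n7') (by rw [z2]; exact n3)
  have B2 := appellPart_eq_appellM (X := (-q ^ 10)⁻¹) (x := q) (y := 1) hq0 hq 2 hq0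
    (by rw [show (-1 - 2 : ℤ) = -(3 : ℕ) by norm_num, z]; field_simp)
    (by rw [w7]; exact n7') (by rw [z2]; exact n3)
  have m2 := appellM_inv hQ0 hQ (x := -q ^ 2) (z := q ^ 3) (neg_ne_zero.mpr (pow_ne_zero 2 hq0)) h3
  have m10 := appellM_inv hQ0 hQ (x := -q ^ 10) (z := (q ^ 3)⁻¹)
    (neg_ne_zero.mpr (pow_ne_zero 10 hq0)) (inv_ne_zero h3)
  rw [inv_inv] at m10
  rw [w5, z1] at A1 A2
  rw [w7, z2] at B0 B2
  rw [s1] at A1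
  rw [s2, m2] at A2
  rw [r0] at B0
  rw [r2, m10] at B2
  have S1 : appellSide q 1 q = appellPart q 1 1 q + appellPart q 2 1 q := by
    simp [appellSide, Finset.sum_range_succ, appellPart, s0]
  have S2 : appellSide q q 1 = appellPart q 0 q 1 + appellPart q 2 q 1 := by
    simp [appellSide, Finset.sum_range_succ, appellPart, r1]
  have hD := appellDefect_one hq0 hq
  rw [appellDefect, z1, w5, w7, S1, S2, A1, A2, B0, B2, heckeF_353_one hq0 hq, i3, i5, i7] at hD
  have hJ := qPochInf_self_ne_zero hq
  rw [thetaQuot_three hq0, etaJ_one]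
  generalize theta (-q ^ 5) (q ^ 16) = T5 at *
  generalize theta (-q ^ 7) (q ^ 16) = T7 at *
  generalize theta (q ^ 3) (q ^ 48) = T3 at *
  generalize appellM (-q ^ 22) (q ^ 48) (q ^ 3) = M22 at *
  generalize appellM (-q ^ 14) (q ^ 48) (q ^ 3)⁻¹ = M14 at *
  generalize appellM (-q ^ 10) (q ^ 48) (q ^ 3)⁻¹ = M10 at *
  generalize appellM (-q ^ 2) (q ^ 48) (q ^ 3) = M2 at *
  generalize theta (q ^ 6) (q ^ 12) = U1 at *
  generalize theta (q ^ 16) (q ^ 32) = U2 at *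
  generalize theta (q ^ 6) (q ^ 16) = U3 at *
  generalize theta (q ^ 4) (q ^ 32) = U4 at *
  generalize theta q (q ^ 16) = U5 at *
  generalize qPochInf q q = J at *
  generalize psi q = P at *
  clear A1 A2 B0 B2 S1 S2 m2 m10 s0 s1 s2 r0 r1 r2 i3 i5 i7 n3' n5' n7'
  field_simp at hD ⊢
  linear_combination hD

/-! ### Convergence and agreement of the series -/

/-- The Appell-Lerch series converges when `x z / p` has modulus `|q|^a` with `a` not a multiple of
the exponent `b` of the nome `p`, for then no denominator vanishes. -/
theorem summable_appellTerm_of_norm {q p x z : ℂ} {a b : ℤ} (hq : ‖q‖ < 1) (hq0 : q ≠ 0)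
    (hb : 0 < b) (hp : ‖p‖ = ‖q‖ ^ b) (hx : x ≠ 0) (hz : z ≠ 0) (hw : ‖x * z / p‖ = ‖q‖ ^ a)
    (h : ¬ b ∣ a) : Summable (appellTerm x p z) := by
  have hn := norm_pos_iff.mpr hq0
  have hp0 : p ≠ 0 := norm_ne_zero_iff.mp (by rw [hp]; positivity)
  have hp1 : ‖p‖ < 1 := by rw [hp, ← norm_zpow]; exact norm_zpow_lt_one hq hb
  exact summable_appellTerm hp1 hp0 hx hz (theta_ne_zero_of_norm hq hq0 hb hp hw h)

theorem tsum_psiHeckeTerm_eq_andrews {q : ℂ} (hq0 : q ≠ 0) (hq : ‖q‖ < 1) :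
    -(1 / qPochInf q q) * ∑' n : ℕ, psiHeckeTerm q (n + 1) =
      1 / qPochInf q q * (∑' n : ℕ, andrewsTerm q n) - 1 := by
  obtain ⟨v, w, h1, h2, -⟩ := hasSum_single_sums hq0 hq
  have := qPochInf_self_ne_zero hq
  rw [h1.tsum_eq, h2.tsum_eq]
  field_simp
  ring

theorem tsum_psiHeckeTerm_eq_mortenson {q : ℂ} (hq0 : q ≠ 0) (hq : ‖q‖ < 1) :
    -(1 / qPochInf q q) * ∑' n : ℕ, psiHeckeTerm q (n + 1) =
      1 / (2 * qPochInf q q) * (∑' n : ℕ, mortensonTerm q n) - 1 / 2 := by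
  obtain ⟨v, w, h1, -, h2⟩ := hasSum_single_sums hq0 hq
  have := qPochInf_self_ne_zero hq
  rw [h1.tsum_eq, h2.tsum_eq]
  field_simp
  ring

end MockTheta

theorem mainTheorem7 (q : ℂ) (hq0 : q ≠ 0) (hq1 : ‖q‖ < 1) :
    -- all the series involved converge
    (Summable (fun n : ℕ => psiTerm q (n + 1)) ∧
      Summable (fun n : ℕ => psiHeckeTerm q (n + 1)) ∧
      Summable (andrewsTerm q) ∧
      Summable (mortensonTerm q) ∧
      Summable (companionTerm q) ∧
      Summable (fun n : ℕ => companionHeckeTerm q (n + 1)) ∧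
      Summable (heckeTerm 3 5 3 (q ^ 4) (q ^ 5) q) ∧
      Summable (heckeTerm 3 5 3 1 q q) ∧
      Summable (heckeTerm 1 2 1 q 1 (q ^ 2)) ∧
      Summable (appellTerm (-q ^ 22) (q ^ 48) (q ^ 3)) ∧
      Summable (appellTerm (-q ^ 14) (q ^ 48) (q ^ (-3 : ℤ))) ∧
      Summable (appellTerm (-q ^ 10) (q ^ 48) (q ^ (-3 : ℤ))) ∧
      Summable (appellTerm (-q ^ 2) (q ^ 48) (q ^ 3)) ∧
      Summable (appellTerm q (-q ^ 3) (-q)) ∧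
      Summable (appellTerm (q ^ 2) (q ^ 6) q)) ∧
    -- the representations of `ψ^{(3)}(q)`
    (psi q = -(1 / qPochInf q q) * ∑' n : ℕ, psiHeckeTerm q (n + 1) ∧
      psi q = 1 / (2 * etaJ 1 q) *
        (q * heckeF 3 5 3 (q ^ 4) (q ^ 5) q - heckeF 3 5 3 1 q q) ∧
      psi q = -(1 / etaJ 1 q) * heckeF 3 5 3 1 q q ∧
      psi q = -appellM (-q ^ 22) (q ^ 48) (q ^ 3)
        - q ^ (-1 : ℤ) * appellM (-q ^ 14) (q ^ 48) (q ^ (-3 : ℤ))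
        - q ^ (-2 : ℤ) * appellM (-q ^ 10) (q ^ 48) (q ^ (-3 : ℤ))
        - q ^ (-5 : ℤ) * appellM (-q ^ 2) (q ^ 48) (q ^ 3)
        + 1 / etaJ 1 q * thetaQuot 3 1 q q ∧
      psi q = -appellM q (-q ^ 3) (-q)
        + q * (etaJ 12 q ^ 3 / (thetaJ 4 12 q * thetaJ 3 12 q))) ∧
    -- the companion identity
    ((∑' n : ℕ, companionTerm q n) = qPochInf (-q) q / qPochInf q q *
        (1 + 2 * ∑' n : ℕ, companionHeckeTerm q (n + 1)) ∧
      (∑' n : ℕ, companionTerm q n) =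
        1 - 2 * (etaJ 2 q / etaJ 1 q ^ 2) * heckeF 1 2 1 q 1 (q ^ 2) ∧
      (∑' n : ℕ, companionTerm q n) = 1 - 2 * appellM (q ^ 2) (q ^ 6) q) ∧
    -- agreement with the representations of Andrews and of Mortenson
    (-(1 / qPochInf q q) * ∑' n : ℕ, psiHeckeTerm q (n + 1) =
        1 / qPochInf q q * (∑' n : ℕ, andrewsTerm q n) - 1 ∧
      -(1 / qPochInf q q) * ∑' n : ℕ, psiHeckeTerm q (n + 1) =
        1 / (2 * qPochInf q q) * (∑' n : ℕ, mortensonTerm q n) - 1 / 2) := by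
  have hJ := qPochInf_self_ne_zero hq1
  have hz : ∀ n : ℕ, q ^ n ≠ 0 := fun n => pow_ne_zero n hq0
  have hs : ∀ (x z : ℂ) (a : ℤ), x ≠ 0 → z ≠ 0 → ‖x * z / q ^ 48‖ = ‖q‖ ^ a → ¬ (48 : ℤ) ∣ a →
      Summable (appellTerm x (q ^ 48) z) := fun x z a hx hz hw h =>
    summable_appellTerm_of_norm hq1 hq0 (by norm_num) (norm_pow_eq_zpow q 48) hx hz hw h
  have e3 : q ^ (-3 : ℤ) = (q ^ 3)⁻¹ := by rw [zpow_neg]; rfl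
  obtain ⟨v, w, hv1, hv2, hv3⟩ := hasSum_single_sums hq0 hq1
  refine ⟨⟨summable_psiTerm hq0 hq1, hv1.summable, hv2.summable, hv3.summable,
    summable_companionTerm hq0 hq1, (hasSum_companionHeckeTerm hq0 hq1).summable,
    summable_heckeTerm (by norm_num) (by norm_num) (by norm_num) _ _ hq0 hq1,
    summable_heckeTerm (by norm_num) (by norm_num) (by norm_num) _ _ hq0 hq1,
    summable_heckeTerm (by norm_num) (by norm_num) (by norm_num) _ _ (hz 2) (norm_sq_lt_one hq1),
    hs _ _ (-23) (neg_ne_zero.mpr (hz 22)) (hz 3) ?_ (by norm_num),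
    hs _ _ (-37) (neg_ne_zero.mpr (hz 14)) (zpow_ne_zero _ hq0) ?_ (by norm_num),
    hs _ _ (-41) (neg_ne_zero.mpr (hz 10)) (zpow_ne_zero _ hq0) ?_ (by norm_num),
    hs _ _ (-43) (neg_ne_zero.mpr (hz 2)) (hz 3) ?_ (by norm_num),
    summable_appellTerm_of_norm (a := -1) (b := 3) hq1 hq0 (by norm_num)
      (by rw [norm_neg]; exact norm_pow_eq_zpow q 3) hq0 (neg_ne_zero.mpr hq0) ?_ (by norm_num),
    summable_appellTerm_of_norm (a := -3) (b := 6) hq1 hq0 (by norm_num)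
      (norm_pow_eq_zpow q 6) (hz 2) hq0 ?_ (by norm_num)⟩,
    ⟨psi_eq_tsum_psiHeckeTerm hq0 hq1, ?_, ?_, ?_, psi_eq_appellM_add_eta hq0 hq1⟩,
    ⟨companion_eq_tsum hq0 hq1, companion_eq_heckeF hq0 hq1, companion_eq_appellM hq0 hq1⟩,
    ⟨tsum_psiHeckeTerm_eq_andrews hq0 hq1, tsum_psiHeckeTerm_eq_mortenson hq0 hq1⟩⟩
  · rw [show -q ^ 22 * q ^ 3 / q ^ 48 = -(q ^ 23)⁻¹ by field_simp, norm_neg, norm_inv, zpow_neg,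
      norm_pow_eq_zpow]
    rfl
  · rw [e3, show -q ^ 14 * (q ^ 3)⁻¹ / q ^ 48 = -(q ^ 37)⁻¹ by field_simp, norm_neg, norm_inv,
      zpow_neg, norm_pow_eq_zpow]
    rfl
  · rw [e3, show -q ^ 10 * (q ^ 3)⁻¹ / q ^ 48 = -(q ^ 41)⁻¹ by field_simp, norm_neg, norm_inv,
      zpow_neg, norm_pow_eq_zpow]
    rfl
  · rw [show -q ^ 2 * q ^ 3 / q ^ 48 = -(q ^ 43)⁻¹ by field_simp, norm_neg, norm_inv, zpow_neg,
      norm_pow_eq_zpow]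
    rfl
  · rw [show q * -q / -q ^ 3 = q⁻¹ by field_simp, norm_inv, zpow_neg_one]
  · rw [show q ^ 2 * q / q ^ 6 = (q ^ 3)⁻¹ by field_simp, norm_inv, zpow_neg, norm_pow_eq_zpow]
    rfl
  · have h := heckeF_353_shift hq0 hq1
    rw [show q * heckeF 3 5 3 (q ^ 4) (q ^ 5) q = -heckeF 3 5 3 1 q q by rw [h, neg_neg],
      heckeF_353_one hq0 hq1, etaJ_one]
    field_simp
    ring
  · rw [heckeF_353_one hq0 hq1, etaJ_one]
    field_simp
  · have h := psi_eq_appellM_four hq0 hq1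
    rw [e3, zpow_neg_one, show q ^ (-2 : ℤ) = (q ^ 2)⁻¹ by rw [zpow_neg]; rfl,
      show q ^ (-5 : ℤ) = (q ^ 5)⁻¹ by rw [zpow_neg]; rfl]
    exact h
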